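/- Time is measured in arithmetic operations over $\mathbb R$: a program works on real registers and pays one unit for loading a constant, for $+,-,\times,\div$, for a square root, for a comparison, and for one evaluation of a given function $f:\mathbb R\to\mathbb R$. Let $\omega$ be a matrix multiplication exponent, i.e. two $n\times n$ matrices can be multiplied by arithmetic circuits with $O(n^\omega)$ operations, and let $\alpha$ be the dual exponent, the supremum of all $\beta$ such that an $n\times n$ matrix can be multiplied with an $n\times\lceil n^{\beta}\rceil$ matrix in $O(n^{2+o(1)})$ operations. Let $0\le a\le\alpha$, let $A\in\mathbb R^{d\times n}$ have full rank $d$ with $1\le d\le n$, and let $0<\varepsilon_{mp}<1/4$. Write $U=\operatorname{diag}(u)$, $\tilde U=\operatorname{diag}(\tilde u)$, $f(v)_i=f(v_i)$, and $\log=\log_2$. Consider the following projection maintenance data structure with variables $M,\tilde u,\tilde v,w$. * Initialize$(u,v)$, for $u>0$: set $\tilde u=u$, $\tilde v=v$, $M=A^\top(AUA^\top)^{-1}A$, $w=M\sqrt U f(v)$. * Update$(u^{new},v^{new})$: let $y_i=u^{new}_i/\tilde u_i-1$, let $\pi$ be a permutation sorting the $|y_i|$ in non-increasing order, and let $k$ be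 the number of $i$ with $|y_i|\ge\varepsilon_{mp}$. If $k\ge n^a$: while $1.5k<n$ and $|y_{\pi(\lceil 1.5k\rceil)}|\ge(1-1/\log n)|y_{\pi(k)}|$, replace $k$ by $\lceil1.5k\rceil$. Let $S=\pi(\{1,\dots,k\})$, let $\tilde u^{new}$ equal $u^{new}$ on $S$ and $\tilde u$ elsewhere, and let $\Delta=\operatorname{diag}(\tilde u^{new}-\tilde u)$ and $W=M_S(\Delta_{S,S}^{-1}+M_{S,S})^{-1}M_S^\top$. - If $k\ge n^a$ (rank-update branch): set $M\leftarrow M-W$, $\tilde u\leftarrow\tilde u^{new}$, $\tilde v\leftarrow v^{new}$, $w\leftarrow M\sqrt{\tilde U}f(\tilde v)$, and return $\tilde u,\tilde v,f(\tilde v),\sqrt{\tilde U}w$. - If $k<n^a$ (small-$k$ branch): let $B$ be the set of $i$ violating $(1-\varepsilon_{mp})\tilde v_i\le v^{new}_i\le(1+\varepsilon_{mp})\tilde v_i$. If $|B|\ge n^a$, put $\tilde v^{new}=v^{new}$ and set $w\leftarrow M\sqrt{\tilde U}f(v^{new})$, $\tilde v\leftarrow v^{new}$; otherwise let $\tilde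 v^{new}$ equal $v^{new}$ on $B$ and $\tilde v$ elsewhere and leave the variables unchanged. Return $\tilde u^{new},\tilde v^{new},f(\tilde v^{new}),\sqrt{\tilde U^{new}}(M-W)\sqrt{\tilde U^{new}}f(\tilde v^{new})$ (with the product $M\sqrt{\tilde U^{new}}f(\tilde v^{new})$ in the last case computed as $w+M(\sqrt{\tilde U^{new}}f(\tilde v^{new})-\sqrt{\tilde U}f(\tilde v))$). Then: 1. (Preprocessing.) Initialize can be implemented in $O(n^2d^{\omega-2})$ time. 2. (Updates.) Let $n\ge3$. There is a program, depending only on $n,d,a,\omega$, implementing Update up to the body of the small-$k$ branch, with the following property. Let $C\ge0$ and let $u^{(0)}>0,v^{(0)}$ be the vectors given to Initialize and $(u^{(1)},v^{(1)}),\dots,(u^{(T)},v^{(T)})$ the subsequent updates, such that for all $0\le t<T$ $$\sum_{i=1}^n\Big(\frac{u^{(t+1)}_i-u^{(t)}_i}{u^{(t)}_i}\Big)^2\le C^2,\qquad \Big|\frac{u^{(t+1)}_i-u^{(t)}_i}{u^{(t)}_i}\Big|\le\frac14\ \text{ for all } i.$$ Then, ignoring the calls of Update that take the small-$k$ branch,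 the total time of the $T$ updates is $$O\Big(T\cdot \frac{C}{\varepsilon_{mp}}\big(n^{\omega-1/2}+n^{2-a/2+o(1)}\big)\log n\Big).$$ Each ignored call takes $O(n\log n)$ time before it enters the small-$k$ branch. The constants in $O(\cdot)$ and the $o(1)$ term (as $n\to\infty$) depend only on $\omega$ and $a$. -/

import Mathlib

/-! ### Arithmetic programs

Programs over real registers, in the style of algebraic computation trees.  One instruction
(loading a constant, a field operation, a square root, an evaluation of the given function `f`,
or a comparison) costs one unit of time. -/

/-- The four field operations. -/
inductive ArithOp where
  | add
  | sub
  | mul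
  | div

/-- The value of a field operation. -/
noncomputable def ArithOp.eval : ArithOp → ℝ → ℝ → ℝ
  | .add, x, y => x + y
  | .sub, x, y => x - y
  | .mul, x, y => x * y
  | .div, x, y => x / y

/-- Arithmetic programs whose registers are indexed by `ρ`; `z` is always the target register,
`P` (or `Q`) is the rest of the program. -/
inductive Prog (ρ : Type) where
  | halt : Prog ρ
  | const (z : ρ) (c : ℝ) (P : Prog ρ) : Prog ρ
  | arith (o : ArithOp) (z x y : ρ) (P : Prog ρ) : Prog ρ
  | sqrt (z x : ρ) (P : Prog ρ) : Prog ρ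
  | call (z x : ρ) (P : Prog ρ) : Prog ρ
  | ifLT (x y : ρ) (P Q : Prog ρ) : Prog ρ

open Classical in
/-- The memory `σ` after writing the value `c` into register `z`. -/
noncomputable def writeReg {ρ : Type} (σ : ρ → ℝ) (z : ρ) (c : ℝ) : ρ → ℝ :=
  fun x => if x = z then c else σ x

open Classical in
/-- The memory after running a program on the memory `σ`, where `call` evaluates `f`. -/
noncomputable def Prog.run {ρ : Type} (f : ℝ → ℝ) : Prog ρ → (ρ → ℝ) → (ρ → ℝ)
  | .halt, σ => σ
  | .const z c P, σ => P.run f (writeReg σ z c)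
  | .arith o z x y P, σ => P.run f (writeReg σ z (o.eval (σ x) (σ y)))
  | .sqrt z x P, σ => P.run f (writeReg σ z (Real.sqrt (σ x)))
  | .call z x P, σ => P.run f (writeReg σ z (f (σ x)))
  | .ifLT x y P Q, σ => if σ x < σ y then P.run f σ else Q.run f σ

open Classical in
/-- The number of instructions executed when a program is run on the memory `σ`. -/
noncomputable def Prog.cost {ρ : Type} (f : ℝ → ℝ) : Prog ρ → (ρ → ℝ) → ℕ
  | .halt, _ => 0
  | .const z c P, σ => P.cost f (writeReg σ z c) + 1
  | .arith o z x y P, σ => P.cost f (writeReg σ z (o.eval (σ x) (σ y))) + 1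
  | .sqrt z x P, σ => P.cost f (writeReg σ z (Real.sqrt (σ x))) + 1
  | .call z x P, σ => P.cost f (writeReg σ z (f (σ x))) + 1
  | .ifLT x y P Q, σ => (if σ x < σ y then P.cost f σ else Q.cost f σ) + 1

/-- Arithmetic circuits: straight-line programs with constants, `+`, `-` and `*` only. -/
def Prog.IsCircuit {ρ : Type} : Prog ρ → Prop
  | .halt => True
  | .const _ _ P => P.IsCircuit
  | .arith o _ _ _ P => o ≠ .div ∧ P.IsCircuit
  | .sqrt _ _ _ => False
  | .call _ _ _ => False
  | .ifLT _ _ _ _ => False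

/-! ### Fast matrix multiplication -/

/-- Registers for the product `Z = X * Y` of an `n × m` by an `m × p` matrix, and scratch
registers. -/
inductive MulReg (n m p : ℕ) where
  | X (i : Fin n) (k : Fin m)
  | Y (k : Fin m) (j : Fin p)
  | Z (i : Fin n) (j : Fin p)
  | tmp (l : ℕ)

/-- An `n × m` matrix can be multiplied with an `m × p` matrix in at most `t` arithmetic
operations. -/
def CanMultiply (n m p t : ℕ) : Prop :=
  ∃ P : Prog (MulReg n m p), P.IsCircuit ∧ ∀ σ : MulReg n m p → ℝ,
    P.cost id σ ≤ t ∧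
    ∀ i j, P.run id σ (.Z i j) = ∑ k : Fin m, σ (.X i k) * σ (.Y k j)

/-- Two `n × n` matrices can be multiplied in `O(n ^ ω)` arithmetic operations. -/
def IsMatMulExponent (ω : ℝ) : Prop :=
  ∃ t : ℕ → ℕ, (∀ n, CanMultiply n n n (t n)) ∧
    (fun n : ℕ => (t n : ℝ)) =O[Filter.atTop] (fun n : ℕ => (n : ℝ) ^ ω)

/-- An `n × n` matrix can be multiplied with an `n × n ^ β` matrix in `O(n ^ (2 + o(1)))`
arithmetic operations. -/
def IsDualAdmissible (β : ℝ) : Prop :=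
  ∃ (t : ℕ → ℕ) (η : ℕ → ℝ), (∀ n : ℕ, CanMultiply n n ⌈(n : ℝ) ^ β⌉₊ (t n)) ∧
    Filter.Tendsto η Filter.atTop (nhds 0) ∧
    (fun n : ℕ => (t n : ℝ)) =O[Filter.atTop] (fun n : ℕ => (n : ℝ) ^ (2 + η n))

/-- The dual matrix exponent `α`. -/
noncomputable def dualExponent : ℝ := sSup {β : ℝ | IsDualAdmissible β}

/-! ### The projection maintenance algorithm -/

/-- The variables of the data structure that change: `M`, `ũ`, `ṽ`, `w`. -/
structure DSState (n : ℕ) where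
  M : Matrix (Fin n) (Fin n) ℝ
  ut : Fin n → ℝ
  vt : Fin n → ℝ
  w : Fin n → ℝ

/-- The four vectors that a call of `Update` returns: `ũ`, `ṽ`, `f(ṽ)` and the approximate
projection `r`. -/
structure DSOutput (n : ℕ) where
  u : Fin n → ℝ
  v : Fin n → ℝ
  fv : Fin n → ℝ
  r : Fin n → ℝ

/-- `√U f(v)`, where `U = diag(u)`. -/
noncomputable def sqrtMul {n : ℕ} (f : ℝ → ℝ) (u v : Fin n → ℝ) : Fin n → ℝ :=
  fun i => Real.sqrt (u i) * f (v i)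

/-- `Aᵀ (A U Aᵀ)⁻¹ A`, where `U = diag(u)`. -/
noncomputable def projCore {n d : ℕ} (A : Matrix (Fin d) (Fin n) ℝ) (u : Fin n → ℝ) :
    Matrix (Fin n) (Fin n) ℝ :=
  A.transpose * (A * Matrix.diagonal u * A.transpose)⁻¹ * A

/-- The result of `Initialize`. -/
noncomputable def initState {n d : ℕ} (A : Matrix (Fin d) (Fin n) ℝ) (f : ℝ → ℝ)
    (u v : Fin n → ℝ) : DSState n where
  M := projCore A u
  ut := u
  vt := v
  w := (projCore A u).mulVec (sqrtMul f u v)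

/-- `y_i = u_i^new / ũ_i - 1`. -/
noncomputable def relDev {n : ℕ} (s : DSState n) (un : Fin n → ℝ) : Fin n → ℝ :=
  fun i => un i / s.ut i - 1

open Classical in
/-- The number of indices `i` with `|y_i| ≥ ε`. -/
noncomputable def numLarge {n : ℕ} (ε : ℝ) (y : Fin n → ℝ) : ℕ :=
  (Finset.univ.filter (fun i => ε ≤ |y i|)).card

/-- `|y_{π(k)}|` with positions `k` counted from 1 (and 0 at positions out of range). -/
noncomputable def sortedAbs {n : ℕ} (y : Fin n → ℝ) (π : Equiv.Perm (Fin n)) (k : ℕ) : ℝ :=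
  if h : 1 ≤ k ∧ k ≤ n then |y (π ⟨k - 1, by omega⟩)| else 0

open Classical in
/-- The while-loop: as long as `1.5 k < n` and `z(⌈1.5 k⌉) ≥ (1 - 1 / log n) z(k)`, replace `k` by
`⌈1.5 k⌉ = (3 k + 1) / 2` (which is then at most `n`).  It is only started with `k ≥ 1`. -/
noncomputable def enlarge (n : ℕ) (z : ℕ → ℝ) (k : ℕ) : ℕ :=
  if _h : 1 ≤ k ∧ 3 * k < 2 * n ∧
      (1 - 1 / Real.logb 2 n) * z k ≤ z ((3 * k + 1) / 2) then
    enlarge n z ((3 * k + 1) / 2)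
  else k
termination_by n - k
decreasing_by omega

/-- The call of `Update` takes the branch `k ≥ n ^ a`.  (The while-loop, which runs only if this
holds, does not decrease `k`; so the test has the same outcome before and after it.) -/
def RankBranch {n : ℕ} (a ε : ℝ) (s : DSState n) (un : Fin n → ℝ) : Prop :=
  (n : ℝ) ^ a ≤ (numLarge ε (relDev s un) : ℝ)

open Classical in
/-- The final value of `k`, given the sorting permutation `π`. -/
noncomputable def batchSize {n : ℕ} (a ε : ℝ) (s : DSState n) (un : Fin n → ℝ)
    (π : Equiv.Perm (Fin n)) : ℕ :=
  if RankBranch a ε s un then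
    enlarge n (sortedAbs (relDev s un) π) (numLarge ε (relDev s un))
  else numLarge ε (relDev s un)

/-- `S = π([k])`. -/
def firstIndices {n : ℕ} (π : Equiv.Perm (Fin n)) (k : ℕ) : Finset (Fin n) :=
  Finset.univ.filter (fun i => (π.symm i : ℕ) < k)

/-- The matrix `M_S (Δ_{S,S}⁻¹ + M_{S,S})⁻¹ (M_S)ᵀ` of the Sherman-Morrison-Woodbury identity,
where `Δ = diag(δ)`. -/
noncomputable def woodburyTerm {n : ℕ} (M : Matrix (Fin n) (Fin n) ℝ) (δ : Fin n → ℝ)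
    (S : Finset (Fin n)) : Matrix (Fin n) (Fin n) ℝ :=
  let MS : Matrix (Fin n) {i // i ∈ S} ℝ := M.submatrix id Subtype.val
  let MSS : Matrix {i // i ∈ S} {i // i ∈ S} ℝ := M.submatrix Subtype.val Subtype.val
  let DSS : Matrix {i // i ∈ S} {i // i ∈ S} ℝ := Matrix.diagonal (fun i => δ i.val)
  MS * (DSS⁻¹ + MSS)⁻¹ * MS.transpose

open Classical in
/-- A call of `Update` with input `un, vn` can turn the state `s` into `s'` and return `o`.
It is a relation because ties in the sorting permutation may be broken in any way. -/
def IsUpdate {n : ℕ} (a ε : ℝ) (f : ℝ → ℝ) (s : DSState n) (un vn : Fin n → ℝ)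
    (s' : DSState n) (o : DSOutput n) : Prop :=
  ∃ π : Equiv.Perm (Fin n), Antitone (fun j => |relDev s un (π j)|) ∧
    let S := firstIndices π (batchSize a ε s un π)
    let utn : Fin n → ℝ := fun i => if i ∈ S then un i else s.ut i
    let W := woodburyTerm s.M (utn - s.ut) S
    if RankBranch a ε s un then
      s'.M = s.M - W ∧
      s'.w = s'.M.mulVec (sqrtMul f utn vn) ∧
      s'.ut = utn ∧
      s'.vt = vn ∧
      o.u = utn ∧ o.v = vn ∧ o.fv = (fun i => f (vn i)) ∧
      o.r = fun i => Real.sqrt (utn i) * s'.w i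
    else
      let bad := Finset.univ.filter
        (fun i => ¬ ((1 - ε) * s.vt i ≤ vn i ∧ vn i ≤ (1 + ε) * s.vt i))
      if (n : ℝ) ^ a ≤ (bad.card : ℝ) then
        s'.M = s.M ∧
        s'.w = s.M.mulVec (sqrtMul f s.ut vn) ∧
        s'.ut = s.ut ∧
        s'.vt = vn ∧
        o.u = utn ∧ o.v = vn ∧ o.fv = (fun i => f (vn i)) ∧
        o.r = fun i => Real.sqrt (utn i) *
          (s.M.mulVec (sqrtMul f utn vn) i - W.mulVec (sqrtMul f utn vn) i)
      else
        let vtn : Fin n → ℝ := fun i => if i ∈ bad then vn i else s.vt i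
        s' = s ∧
        o.u = utn ∧ o.v = vtn ∧ o.fv = (fun i => f (vtn i)) ∧
        o.r = fun i => Real.sqrt (utn i) *
          (s.w i + s.M.mulVec (sqrtMul f utn vtn - sqrtMul f s.ut s.vt) i
            - W.mulVec (sqrtMul f utn vtn) i)

/-- `s 0, …, s T` are the states of the data structure when it is initialized with
`u 0, v 0` and then receives the `T` updates `(u 1, v 1), …, (u T, v T)`. -/
def IsExecution {n d : ℕ} (a ε : ℝ) (A : Matrix (Fin d) (Fin n) ℝ) (f : ℝ → ℝ) (T : ℕ)
    (u v : ℕ → Fin n → ℝ) (s : ℕ → DSState n) : Prop :=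
  s 0 = initState A f (u 0) (v 0) ∧
  ∀ t < T, ∃ o : DSOutput n, IsUpdate a ε f (s t) (u (t + 1)) (v (t + 1)) (s (t + 1)) o

open Classical in
/-- The indices `t < T` such that the call number `t + 1` takes the branch `k ≥ n ^ a`. -/
noncomputable def rankCalls {n : ℕ} (a ε : ℝ) (T : ℕ) (u : ℕ → Fin n → ℝ)
    (s : ℕ → DSState n) : Finset ℕ :=
  (Finset.range T).filter (fun t => RankBranch a ε (s t) (u (t + 1)))

/-- Bounded multiplicative change of the sequence `u 0, …, u T`. -/
def SmallChange {n : ℕ} (C : ℝ) (T : ℕ) (u : ℕ → Fin n → ℝ) : Prop :=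
  ∀ t < T, ∑ i, ((u (t + 1) i - u t i) / u t i) ^ 2 ≤ C ^ 2 ∧
    ∀ i, |(u (t + 1) i - u t i) / u t i| ≤ 1 / 4

/-! ### Memory layout of an implementation -/

/-- Registers of an implementation: the fixed data `A`, `ε`; the input `un`, `vn` of a call; the
variables `M`, `ũ`, `ṽ`, `w`; the returned vectors `f(ṽ)`, `r` (the returned `ũ`, `ṽ` coincide with
the variables); and scratch registers. -/
inductive DSReg (n d : ℕ) where
  | A (i : Fin d) (j : Fin n)
  | eps
  | un (i : Fin n)
  | vn (i : Fin n)
  | M (i j : Fin n)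
  | ut (i : Fin n)
  | vt (i : Fin n)
  | w (i : Fin n)
  | fv (i : Fin n)
  | r (i : Fin n)
  | tmp (l : ℕ)

/-- The memory `σ` contains the fixed data `A`, `ε`. -/
def HoldsData {n d : ℕ} (σ : DSReg n d → ℝ) (A : Matrix (Fin d) (Fin n) ℝ) (ε : ℝ) : Prop :=
  (∀ i j, σ (.A i j) = A i j) ∧ σ .eps = ε

/-- The memory `σ` contains the input vectors of a call. -/
def HoldsInput {n d : ℕ} (σ : DSReg n d → ℝ) (un vn : Fin n → ℝ) : Prop :=
  (∀ i, σ (.un i) = un i) ∧ (∀ i, σ (.vn i) = vn i)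

/-- The memory `σ` contains the state `s`. -/
def HoldsState {n d : ℕ} (σ : DSReg n d → ℝ) (s : DSState n) : Prop :=
  (∀ i j, σ (.M i j) = s.M i j) ∧ (∀ i, σ (.ut i) = s.ut i) ∧
    (∀ i, σ (.vt i) = s.vt i) ∧ (∀ i, σ (.w i) = s.w i)

/-- On input `u, v` the program `P` performs `Initialize`. -/
def ImplementsInit {n d : ℕ} (P : Prog (DSReg n d)) (A : Matrix (Fin d) (Fin n) ℝ) (ε : ℝ)
    (f : ℝ → ℝ) (u v : Fin n → ℝ) : Prop :=
  ∀ σ : DSReg n d → ℝ, HoldsData σ A ε → HoldsInput σ u v →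
    HoldsData (P.run f σ) A ε ∧ HoldsState (P.run f σ) (initState A f u v)

/-- In the state `s`, on input `un, vn`, the program `P` performs the call of `Update`, apart from
the body of the branch `k < n ^ a`: if that branch is taken, then `P` stops on entering it, with
the data structure and the input still unchanged. -/
def ImplementsUpdate {n d : ℕ} (P : Prog (DSReg n d)) (a : ℝ) (A : Matrix (Fin d) (Fin n) ℝ)
    (ε : ℝ) (f : ℝ → ℝ) (s : DSState n) (un vn : Fin n → ℝ) : Prop :=
  ∀ σ : DSReg n d → ℝ, HoldsData σ A ε → HoldsInput σ un vn → HoldsState σ s →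
    HoldsData (P.run f σ) A ε ∧
    (RankBranch a ε s un → ∃ (s' : DSState n) (o : DSOutput n),
      IsUpdate a ε f s un vn s' o ∧ HoldsState (P.run f σ) s' ∧
      (∀ i, P.run f σ (.fv i) = o.fv i) ∧ (∀ i, P.run f σ (.r i) = o.r i)) ∧
    (¬ RankBranch a ε s un → HoldsInput (P.run f σ) un vn ∧ HoldsState (P.run f σ) s)

/-! The time of an update is governed by the size k of the batch written into M. With rectangular
multiplication a batch of size k ≥ n^a costs O(n^(ω-θ) k^θ) for some θ with 1/2 < θ ≤ 1
(`IsMatMulExponent.exists_rect_bound`), so it is enough to bound the sum of k^θ over all rank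
updates. This is an amortized estimate (`sum_batchSize_rpow_le`).

The potential takes the deviations |y_i|, truncated at 2ε and sorted non-increasingly, with weights
g_j = j^(θ-1). A change of u of relative Euclidean size C raises it by at most (3/2) C ‖g‖₂ = O(C
n^(θ-1/2)), by the rearrangement and Cauchy-Schwarz inequalities (`sortedSum_le_add`); the bound on
‖g‖₂ needs θ > 1/2. A batch sets the k largest entries to zero. The while-loop stops only at a gap:
the first k entries exceed those from position 1.5k on by order ε / log n, or there are no such
positions. Hence each position between k/2 and k loses at least that much, and the potential drops
by order k · k^(θ-1) · ε / log n (`sortedSum_add_le`). The loop makes O(log n) rounds, so its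
factors 1 - 1/log n multiply to at least a positive constant (`exp_neg_six_le_pow`). As the
potential starts at zero and stays nonnegative, the sum of k^θ is O(T (C/ε) n^(θ-1/2) log n);
multiplying by n^(ω-θ) gives n^(ω-1/2).

A suitable θ exists when ω > 5/2 - a/2. Otherwise ω is replaced by the larger exponent 5/2 - a/2 +
δ, which yields n^(2-a/2+δ) for every δ > 0, and δ is then made to depend on n
(`exists_tendsto_zero_of_forall_pos`).

The given multiplication circuits may exploit commutativity, so they cannot be applied to blocks
directly. The mixed second-order part of a circuit with t operations is a bilinear algorithm of rank
2t (`CanMultiply.bilinRank`), and bilinear algorithms can be nested. Inversion reduces to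
multiplication by Schur complements (`InvBound.double`). The Woodbury identity keeps M = Aᵀ(AŨAᵀ)⁻¹A
and shows that the matrices to be inverted are nonsingular (`woodbury`).

Straight-line work is described by `Gen`, where values are never overwritten, and compiled into
registers by `Gen.compile`. Comparisons form decision trees with a separate leaf for each batch;
only executed instructions are charged, so the size of the tree is irrelevant. -/

/-! ### Straight-line computations without registers

`Gen c V t W`: from the functions in `V`, all functions in `W` can be computed in `t` operations. -/

/-- All functions in `W` can be computed from those in `V` by `t` operations. -/
inductive Gen {Ω : Type} (c : Ω → ℝ → ℝ) : Set (Ω → ℝ) → ℕ → Set (Ω → ℝ) → Prop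
  | done {V W : Set (Ω → ℝ)} {t : ℕ} : W ⊆ V → Gen c V t W
  | const {V W : Set (Ω → ℝ)} {t : ℕ} (r : ℝ) :
      Gen c (insert (fun _ => r) V) t W → Gen c V (t + 1) W
  | arith {V W : Set (Ω → ℝ)} {t : ℕ} (o : ArithOp) {g h : Ω → ℝ} : g ∈ V → h ∈ V →
      Gen c (insert (fun ω => o.eval (g ω) (h ω)) V) t W → Gen c V (t + 1) W
  | sqrt {V W : Set (Ω → ℝ)} {t : ℕ} {g : Ω → ℝ} : g ∈ V →
      Gen c (insert (fun ω => Real.sqrt (g ω)) V) t W → Gen c V (t + 1) W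
  | call {V W : Set (Ω → ℝ)} {t : ℕ} {g : Ω → ℝ} : g ∈ V →
      Gen c (insert (fun ω => c ω (g ω)) V) t W → Gen c V (t + 1) W

/-- The set of entries of a matrix-valued function. -/
def entries {Ω I J : Type} (X : Ω → Matrix I J ℝ) : Set (Ω → ℝ) :=
  Set.range (fun p : I × J => fun ω => X ω p.1 p.2)

namespace Gen

variable {Ω : Type} {c : Ω → ℝ → ℝ} {V V' W W' : Set (Ω → ℝ)} {s t : ℕ} {g h : Ω → ℝ}

theorem mono (H : Gen c V t W) : ∀ {V' : Set (Ω → ℝ)} {t' : ℕ} {W' : Set (Ω → ℝ)},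
    V ⊆ V' → t ≤ t' → W' ⊆ W → Gen c V' t' W' := by
  induction H with
  | done hW => exact fun hV _ hW' => .done (hW'.trans (hW.trans hV))
  | const r _ ih =>
    intro V' t' W' hV ht hW
    obtain ⟨t', rfl⟩ : ∃ u, t' = u + 1 := ⟨t' - 1, by omega⟩
    exact .const r (ih (Set.insert_subset_insert hV) (by omega) hW)
  | arith o hg hh _ ih =>
    intro V' t' W' hV ht hW
    obtain ⟨t', rfl⟩ : ∃ u, t' = u + 1 := ⟨t' - 1, by omega⟩
    exact .arith o (hV hg) (hV hh) (ih (Set.insert_subset_insert hV) (by omega) hW)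
  | sqrt hg _ ih =>
    intro V' t' W' hV ht hW
    obtain ⟨t', rfl⟩ : ∃ u, t' = u + 1 := ⟨t' - 1, by omega⟩
    exact .sqrt (hV hg) (ih (Set.insert_subset_insert hV) (by omega) hW)
  | call hg _ ih =>
    intro V' t' W' hV ht hW
    obtain ⟨t', rfl⟩ : ∃ u, t' = u + 1 := ⟨t' - 1, by omega⟩
    exact .call (hV hg) (ih (Set.insert_subset_insert hV) (by omega) hW)

theorem weaken (H : Gen c V s W) (h : s ≤ t) : Gen c V t W := H.mono subset_rfl h subset_rfl

theorem mono_left (H : Gen c V t W) (h : V ⊆ V') : Gen c V' t W := H.mono h le_rfl subset_rfl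

theorem mono_right (H : Gen c V t W) (h : W' ⊆ W) : Gen c V t W' := H.mono subset_rfl le_rfl h

theorem keep (H : Gen c V t W) : Gen c V t (V ∪ W) := by
  induction H with
  | done hW => exact .done (Set.union_subset subset_rfl hW)
  | const r _ ih =>
    exact .const r (ih.mono_right (Set.union_subset_union_left _ (Set.subset_insert _ _)))
  | arith o hg hh _ ih =>
    exact .arith o hg hh (ih.mono_right (Set.union_subset_union_left _ (Set.subset_insert _ _)))
  | sqrt hg _ ih =>
    exact .sqrt hg (ih.mono_right (Set.union_subset_union_left _ (Set.subset_insert _ _)))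
  | call hg _ ih =>
    exact .call hg (ih.mono_right (Set.union_subset_union_left _ (Set.subset_insert _ _)))

theorem trans (H : Gen c V s W) : ∀ {t : ℕ} {W' : Set (Ω → ℝ)},
    Gen c (V ∪ W) t W' → Gen c V (s + t) W' := by
  induction H with
  | done hW =>
    exact fun H' => H'.mono (Set.union_subset subset_rfl hW) (by omega) subset_rfl
  | const r _ ih =>
    intro t W' H'
    exact (Gen.const r (ih (H'.mono_left
      (Set.union_subset_union_left _ (Set.subset_insert _ _))))).weaken (by omega)
  | arith o hg hh _ ih =>
    intro t W' H'
    exact (Gen.arith o hg hh (ih (H'.mono_left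
      (Set.union_subset_union_left _ (Set.subset_insert _ _))))).weaken (by omega)
  | sqrt hg _ ih =>
    intro t W' H'
    exact (Gen.sqrt hg (ih (H'.mono_left
      (Set.union_subset_union_left _ (Set.subset_insert _ _))))).weaken (by omega)
  | call hg _ ih =>
    intro t W' H'
    exact (Gen.call hg (ih (H'.mono_left
      (Set.union_subset_union_left _ (Set.subset_insert _ _))))).weaken (by omega)

theorem union (H : Gen c V s W) (H' : Gen c V t W') : Gen c V (s + t) (W ∪ W') :=
  H.trans ((H'.mono_left Set.subset_union_left).keep.mono_right
    (Set.union_subset_union_left _ Set.subset_union_right))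

theorem mem (hg : g ∈ V) : Gen c V 0 {g} := .done (Set.singleton_subset_iff.2 hg)

theorem lit (r : ℝ) : Gen c V 1 {fun _ => r} :=
  .const r (.mem (Set.mem_insert _ _))

theorem bin (o : ArithOp) (Hg : Gen c V s {g}) (Hh : Gen c V t {h}) :
    Gen c V (s + t + 1) {fun ω => o.eval (g ω) (h ω)} :=
  (Hg.union Hh).trans (t := 1)
    (.arith o (Or.inr (Or.inl rfl)) (Or.inr (Or.inr rfl)) (.mem (Set.mem_insert _ _)))

theorem add (Hg : Gen c V s {g}) (Hh : Gen c V t {h}) :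
    Gen c V (s + t + 1) {fun ω => g ω + h ω} := bin .add Hg Hh

theorem sub (Hg : Gen c V s {g}) (Hh : Gen c V t {h}) :
    Gen c V (s + t + 1) {fun ω => g ω - h ω} := bin .sub Hg Hh

theorem mul (Hg : Gen c V s {g}) (Hh : Gen c V t {h}) :
    Gen c V (s + t + 1) {fun ω => g ω * h ω} := bin .mul Hg Hh

theorem div (Hg : Gen c V s {g}) (Hh : Gen c V t {h}) :
    Gen c V (s + t + 1) {fun ω => g ω / h ω} := bin .div Hg Hh

theorem sqrt' (Hg : Gen c V s {g}) : Gen c V (s + 1) {fun ω => Real.sqrt (g ω)} :=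
  Hg.trans (t := 1) (.sqrt (Or.inr rfl) (.mem (Set.mem_insert _ _)))

theorem call' (Hg : Gen c V s {g}) : Gen c V (s + 1) {fun ω => c ω (g ω)} :=
  Hg.trans (t := 1) (.call (Or.inr rfl) (.mem (Set.mem_insert _ _)))

theorem biUnion {ι : Type} (S : Finset ι) {U : ι → Set (Ω → ℝ)}
    (H : ∀ i ∈ S, Gen c V t (U i)) : Gen c V (S.card * t) (⋃ i ∈ S, U i) := by
  classical
  induction S using Finset.induction_on with
  | empty => exact .done (by simp)
  | insert a S ha ih =>
    have h1 := (H a (Finset.mem_insert_self _ _)).union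
      (ih fun i hi => H i (Finset.mem_insert_of_mem hi))
    refine h1.mono subset_rfl ?_ (by simp)
    rw [Finset.card_insert_of_notMem ha, add_mul]
    omega

theorem iUnion {ι : Type} [Fintype ι] {U : ι → Set (Ω → ℝ)}
    (H : ∀ i, Gen c V t (U i)) : Gen c V (Fintype.card ι * t) (⋃ i, U i) := by
  simpa using biUnion Finset.univ (U := U) fun i _ => H i

theorem range {ι : Type} [Fintype ι] {u : ι → Ω → ℝ}
    (H : ∀ i, Gen c V t {u i}) : Gen c V (Fintype.card ι * t) (Set.range u) := by
  simpa using iUnion H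

theorem matrix {I J : Type} [Fintype I] [Fintype J] {X : Ω → Matrix I J ℝ}
    (H : ∀ i j, Gen c V t {fun ω => X ω i j}) :
    Gen c V (Fintype.card I * Fintype.card J * t) (entries X) := by
  have := range (u := fun p : I × J => fun ω => X ω p.1 p.2) fun p => H p.1 p.2
  rwa [Fintype.card_prod] at this

theorem sum {ι : Type} (S : Finset ι) {u : ι → Ω → ℝ} (h0 : (fun _ => 0) ∈ V)
    (H : ∀ i ∈ S, Gen c V t {u i}) :
    Gen c V (S.card * (t + 1)) {fun ω => ∑ i ∈ S, u i ω} := by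
  classical
  induction S using Finset.induction_on with
  | empty => simpa using mem h0
  | insert a S ha ih =>
    have h1 := (H a (Finset.mem_insert_self _ _)).add
      (ih fun i hi => H i (Finset.mem_insert_of_mem hi))
    simp only [Finset.sum_insert ha]
    refine h1.weaken ?_
    rw [Finset.card_insert_of_notMem ha, add_mul]
    omega

theorem linComb {ι : Type} [Fintype ι] (a : ι → ℝ) {u : ι → Ω → ℝ} (h0 : (fun _ => 0) ∈ V)
    (H : ∀ i, u i ∈ V) :
    Gen c V (Fintype.card ι * 3) {fun ω => ∑ i, a i * u i ω} :=
  sum Finset.univ h0 fun i _ => (lit (a i)).mul (mem (H i))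

/-- A circuit is a straight-line computation. -/
theorem of_circuit {ρ : Type} (P : Prog ρ) (hP : P.IsCircuit) :
    ∀ (τ : Ω → ρ → ℝ) (t : ℕ) (V : Set (Ω → ℝ)) (σ : ρ → ℝ), (∀ x, (fun ω => τ ω x) ∈ V) →
      P.cost id σ ≤ t → Gen c V t (Set.range fun x => fun ω => P.run id (τ ω) x) := by
  -- A register may be overwritten, but its old value stays in `V`, so the available set only grows.
  -- The memory `σ` serves only to read off the cost, which for a circuit does not depend on the
  -- memory.
  have hwrite : ∀ (τ : Ω → ρ → ℝ) (V : Set (Ω → ℝ)) (z : ρ) (g : Ω → ℝ),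
      (∀ x, (fun ω => τ ω x) ∈ V) → ∀ x, (fun ω => writeReg (τ ω) z (g ω) x) ∈ insert g V := by
    intro τ V z g hτ x
    by_cases hx : x = z
    · left
      funext ω
      simp [writeReg, hx]
    · right
      simpa [writeReg, hx] using hτ x
  induction P with
  | halt =>
    intro τ t V _ hτ _
    refine .done ?_
    rintro _ ⟨x, rfl⟩
    exact hτ x
  | const z r P ih =>
    intro τ t V σ hτ ht
    rw [Prog.cost] at ht
    obtain ⟨t, rfl⟩ : ∃ u, t = u + 1 := ⟨t - 1, by omega⟩
    exact .const r (ih hP (fun ω => writeReg (τ ω) z r) t _ _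
      (hwrite τ V z (fun _ => r) hτ) (Nat.le_of_succ_le_succ ht))
  | arith o z x y P ih =>
    intro τ t V σ hτ ht
    rw [Prog.cost] at ht
    obtain ⟨t, rfl⟩ : ∃ u, t = u + 1 := ⟨t - 1, by omega⟩
    exact .arith o (hτ x) (hτ y) (ih hP.2
      (fun ω => writeReg (τ ω) z (o.eval (τ ω x) (τ ω y))) t _ _
      (hwrite τ V z (fun ω => o.eval (τ ω x) (τ ω y)) hτ) (Nat.le_of_succ_le_succ ht))
  | sqrt z x P ih => exact hP.elim
  | call z x P ih => exact hP.elim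
  | ifLT x y P Q _ _ => exact hP.elim

end Gen

/-! ### Cost of matrix multiplication -/

/-- Matrices with index sets `I`, `J`, `K` can be multiplied in `t` operations. -/
def MulBound (I J K : Type) [Fintype J] (t : ℕ) : Prop :=
  ∀ (Ω : Type) (c : Ω → ℝ → ℝ) (V : Set (Ω → ℝ)) (X : Ω → Matrix I J ℝ) (Y : Ω → Matrix J K ℝ),
    (fun _ => 0) ∈ V → entries X ⊆ V → entries Y ⊆ V → Gen c V t (entries fun ω => X ω * Y ω)

theorem mem_entries {Ω I J : Type} {X : Ω → Matrix I J ℝ} {V : Set (Ω → ℝ)} (h : entries X ⊆ V)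
    (i : I) (j : J) : (fun ω => X ω i j) ∈ V := h ⟨(i, j), rfl⟩

theorem entries_subset {Ω I J : Type} {X : Ω → Matrix I J ℝ} {V : Set (Ω → ℝ)}
    (h : ∀ i j, (fun ω => X ω i j) ∈ V) : entries X ⊆ V := by
  rintro _ ⟨p, rfl⟩
  exact h p.1 p.2

/-- The circuit is run with its output and scratch registers initially zero; this is why `MulBound`
asks for the zero function among the available values. -/
theorem CanMultiply.mulBound {n m p t : ℕ} (h : CanMultiply n m p t) :
    MulBound (Fin n) (Fin m) (Fin p) t := by
  intro Ω c V X Y h0 hX hY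
  obtain ⟨P, hP, hrun⟩ := h
  let τ : Ω → MulReg n m p → ℝ := fun ω x =>
    match x with
    | .X i k => X ω i k
    | .Y k j => Y ω k j
    | .Z _ _ => 0
    | .tmp _ => 0
  have hτ : ∀ x, (fun ω => τ ω x) ∈ V := by
    rintro (⟨i, k⟩ | ⟨k, j⟩ | ⟨i, j⟩ | l)
    · exact mem_entries hX i k
    · exact mem_entries hY k j
    · exact h0
    · exact h0
  refine (Gen.of_circuit P hP τ t V 0 hτ (hrun 0).1).mono_right (entries_subset fun i j => ?_)
  refine ⟨.Z i j, ?_⟩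
  funext ω
  simp only [(hrun (τ ω)).2 i j, Matrix.mul_apply, τ]

/-- Padding with zeros. -/
theorem MulBound.embed {I J K I' J' K' : Type} [Fintype J] [Fintype J'] {t : ℕ}
    (h : MulBound I' J' K' t) (e₁ : I ↪ I') (e₂ : J ↪ J') (e₃ : K ↪ K') : MulBound I J K t := by
  classical
  intro Ω c V X Y h0 hX hY
  let X' : Ω → Matrix I' J' ℝ := fun ω => Matrix.of fun i j =>
    Function.extend (Prod.map e₁ e₂) (fun p => X ω p.1 p.2) 0 (i, j)
  let Y' : Ω → Matrix J' K' ℝ := fun ω => Matrix.of fun i j =>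
    Function.extend (Prod.map e₂ e₃) (fun p => Y ω p.1 p.2) 0 (i, j)
  have i₁ : Function.Injective (Prod.map e₁ e₂) := e₁.injective.prodMap e₂.injective
  have i₂ : Function.Injective (Prod.map e₂ e₃) := e₂.injective.prodMap e₃.injective
  have eX : ∀ ω i j, X' ω (e₁ i) (e₂ j) = X ω i j := fun ω i j =>
    i₁.extend_apply (fun p => X ω p.1 p.2) 0 (i, j)
  have eY : ∀ ω i j, Y' ω (e₂ i) (e₃ j) = Y ω i j := fun ω i j =>
    i₂.extend_apply (fun p => Y ω p.1 p.2) 0 (i, j)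
  have nX : ∀ ω i j, (i, j) ∉ Set.range (Prod.map e₁ e₂) → X' ω i j = 0 := fun ω i j hij =>
    Function.extend_apply' (fun p : I × J => X ω p.1 p.2) (fun _ => (0 : ℝ)) _ hij
  have nY : ∀ ω i j, (i, j) ∉ Set.range (Prod.map e₂ e₃) → Y' ω i j = 0 := fun ω i j hij =>
    Function.extend_apply' (fun p : J × K => Y ω p.1 p.2) (fun _ => (0 : ℝ)) _ hij
  have vX : entries X' ⊆ V := entries_subset fun i j => by
    by_cases hij : (i, j) ∈ Set.range (Prod.map e₁ e₂)
    · obtain ⟨⟨i, j⟩, h⟩ := hij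
      cases h
      simpa only [eX] using mem_entries hX i j
    · simpa only [nX _ _ _ hij] using h0
  have vY : entries Y' ⊆ V := entries_subset fun i j => by
    by_cases hij : (i, j) ∈ Set.range (Prod.map e₂ e₃)
    · obtain ⟨⟨i, j⟩, h⟩ := hij
      cases h
      simpa only [eY] using mem_entries hY i j
    · simpa only [nY _ i j hij] using h0
  refine (h Ω c V X' Y' h0 vX vY).mono_right (entries_subset fun i k => ?_)
  refine ⟨(e₁ i, e₃ k), ?_⟩
  funext ω
  simp only [Matrix.mul_apply]
  refine (Fintype.sum_of_injective e₂ e₂.injective _ _ (fun j hj => ?_) fun j => ?_).symm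
  · rw [nX, zero_mul]
    rintro ⟨⟨a, b⟩, hab⟩
    exact hj ⟨b, (Prod.ext_iff.1 hab).2⟩
  · rw [eX, eY]

theorem MulBound.mono {I J K : Type} [Fintype J] {s t : ℕ} (h : MulBound I J K s) (hst : s ≤ t) :
    MulBound I J K t :=
  fun Ω c V X Y h0 hX hY => (h Ω c V X Y h0 hX hY).weaken hst

theorem MulBound.blocks_left {I J K Q : Type} [Fintype J] [Fintype Q] {t : ℕ}
    (h : MulBound I J K t) : MulBound (Q × I) J K (Fintype.card Q * t) := by
  intro Ω c V X Y h0 hX hY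
  refine (Gen.iUnion fun q : Q => h Ω c V (fun ω => Matrix.of fun i j => X ω (q, i) j) Y h0
    (entries_subset fun i j => mem_entries hX (q, i) j) hY).mono_right ?_
  refine entries_subset fun i k => Set.mem_iUnion.2 ⟨i.1, (i.2, k), ?_⟩
  funext ω
  simp [Matrix.mul_apply]

theorem MulBound.blocks_right {I J K Q : Type} [Fintype J] [Fintype Q] {t : ℕ}
    (h : MulBound I J K t) : MulBound I J (Q × K) (Fintype.card Q * t) := by
  intro Ω c V X Y h0 hX hY
  refine (Gen.iUnion fun q : Q => h Ω c V X (fun ω => Matrix.of fun i j => Y ω i (q, j)) h0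
    hX (entries_subset fun i j => mem_entries hY i (q, j))).mono_right ?_
  refine entries_subset fun i k => Set.mem_iUnion.2 ⟨k.1, (i, k.2), ?_⟩
  funext ω
  simp [Matrix.mul_apply]

/-- Unlike a partition of the outer dimensions, a partition of the inner one produces partial
products that have to be added; the second summand pays for that. -/
theorem MulBound.blocks_mid {I J K Q : Type} [Fintype I] [Fintype J] [Fintype K] [Fintype Q]
    {t : ℕ} (h : MulBound I J K t) : MulBound I (Q × J) K
      (Fintype.card Q * t + Fintype.card I * Fintype.card K * (Fintype.card Q * 1)) := by
  intro Ω c V X Y h0 hX hY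
  have h1 := Gen.iUnion fun q : Q => h Ω c V (fun ω => Matrix.of fun i j => X ω i (q, j))
    (fun ω => Matrix.of fun j k => Y ω (q, j) k) h0
    (entries_subset fun i j => mem_entries hX i (q, j))
    (entries_subset fun j k => mem_entries hY (q, j) k)
  refine h1.trans (Gen.matrix fun i k => ?_)
  have h2 : ∀ ω, (X ω * Y ω) i k = ∑ q, ∑ j, X ω i (q, j) * Y ω (q, j) k := fun ω => by
    rw [Matrix.mul_apply, Fintype.sum_prod_type]
  simp only [h2]
  refine Gen.sum (t := 0) Finset.univ (Or.inl h0) fun q _ => .mem (Or.inr ?_)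
  refine Set.mem_iUnion.2 ⟨q, (i, k), ?_⟩
  funext ω
  simp [Matrix.mul_apply]

/-- The schoolbook product of a matrix and a vector. -/
theorem Gen.mulVec {Ω I J : Type} [Fintype I] [Fintype J] {c : Ω → ℝ → ℝ} {V : Set (Ω → ℝ)}
    {X : Ω → Matrix I J ℝ} {y : Ω → J → ℝ} (h0 : (fun _ => 0) ∈ V) (hX : entries X ⊆ V)
    (hy : ∀ j, (fun ω => y ω j) ∈ V) :
    Gen c V (Fintype.card I * (Fintype.card J * 2))
      (Set.range fun i => fun ω => (X ω).mulVec (y ω) i) :=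
  Gen.range fun i => Gen.sum (u := fun j ω => X ω i j * y ω j) Finset.univ h0 fun j _ =>
    (Gen.mem (mem_entries hX i j)).mul (Gen.mem (hy j))

/-! ### From circuits to bilinear algorithms -/

/-- The `n × m` by `m × p` matrix multiplication tensor has rank at most `R`. -/
def BilinRank (n m p R : ℕ) : Prop :=
  ∃ (α : Fin R → Fin n → Fin m → ℝ) (β : Fin R → Fin m → Fin p → ℝ)
    (γ : Fin R → Fin n → Fin p → ℝ), ∀ i k k' j i' j',
      ∑ l, α l i k * β l k' j * γ l i' j' = if i = i' ∧ k = k' ∧ j = j' then 1 else 0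

/-- The tensor is symmetric under exchanging the roles of the three factors, so its rank is too.
This turns an algorithm for `n × n` times `n × n^β` into one for `n × n^β` times `n^β × n`, the
shape of a low-rank update. -/
theorem BilinRank.swap {n m p R : ℕ} (h : BilinRank n m p R) : BilinRank n p m R := by
  obtain ⟨α, β, γ, h⟩ := h
  refine ⟨γ, fun l j k => β l k j, α, fun i k k' j i' j' => ?_⟩
  have := h i' j' j k' i k
  calc ∑ l, γ l i k * β l j k' * α l i' j' = ∑ l, α l i' j' * β l j k' * γ l i k :=
        Finset.sum_congr rfl fun l _ => by ring
    _ = _ := this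
    _ = _ := by
      congr 1
      apply propext
      constructor <;> rintro ⟨rfl, rfl, rfl⟩ <;> exact ⟨rfl, rfl, rfl⟩

theorem BilinRank.restrict {n m p m' R : ℕ} (h : BilinRank n m p R) (hm : m' ≤ m) :
    BilinRank n m' p R := by
  obtain ⟨α, β, γ, h⟩ := h
  refine ⟨fun l i k => α l i (Fin.castLE hm k), fun l k j => β l (Fin.castLE hm k) j, γ,
    fun i k k' j i' j' => ?_⟩
  rw [h]
  simp

theorem BilinRank.pad {n m p R R' : ℕ} (h : BilinRank n m p R) (hR : R ≤ R') :
    BilinRank n m p R' := by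
  obtain ⟨α, β, γ, h⟩ := h
  obtain ⟨q, rfl⟩ := Nat.exists_eq_add_of_le hR
  refine ⟨Fin.append α 0, Fin.append β 0, Fin.append γ 0, fun i k k' j i' j' => ?_⟩
  rw [Fin.sum_univ_add]
  simp [h]

/-- Replaces the dual exponent when `β = 0`: there need not be any admissible exponent above `0`,
but outer products are available for free. -/
theorem bilinRank_outer (b : ℕ) : BilinRank b 1 b (b * b) := by
  refine ⟨fun l i _ => if (finProdFinEquiv.symm l).1 = i then 1 else 0,
    fun l _ j => if (finProdFinEquiv.symm l).2 = j then 1 else 0,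
    fun l i j => if (finProdFinEquiv.symm l) = (i, j) then 1 else 0, fun i k k' j i' j' => ?_⟩
  rw [← finProdFinEquiv.sum_comp]
  simp only [Equiv.symm_apply_apply, mul_ite, mul_one, mul_zero]
  rw [Finset.sum_ite_eq' Finset.univ (i', j')]
  simp only [Finset.mem_univ, if_true]
  have : k = k' := Subsingleton.elim _ _
  by_cases h1 : i = i' <;> by_cases h2 : j = j' <;> simp [h1, h2, this, eq_comm]

/-! ### Mixed second-order parts of circuit values -/

section Jets

variable {I J : Type} [Fintype I] [Fintype J]

/-- The product of two linear forms. -/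
def formProd (d : (I → ℝ) × (J → ℝ)) : (I → ℝ) → (J → ℝ) → ℝ :=
  fun X Y => (d.1 ⬝ᵥ X) * (d.2 ⬝ᵥ Y)

/-- The bilinear forms spanned by the products of the listed pairs of linear forms. -/
def bilinSpan (D : List ((I → ℝ) × (J → ℝ))) : Submodule ℝ ((I → ℝ) → (J → ℝ) → ℝ) :=
  Submodule.span ℝ (formProd '' {d | d ∈ D})

theorem bilinSpan_mono {D D' : List ((I → ℝ) × (J → ℝ))} (h : D ⊆ D') :
    bilinSpan D ≤ bilinSpan D' :=
  Submodule.span_mono (Set.image_mono h)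

/-- `F (X, Y, s, u)`, the value of a register for the input `(s X, u Y)`, has an expansion modulo
`s ^ 2` and `u ^ 2` whose mixed term lies in the span of `D`. -/
def HasJet (D : List ((I → ℝ) × (J → ℝ))) (F : (I → ℝ) → (J → ℝ) → ℝ → ℝ → ℝ) : Prop :=
  ∃ (e : ℝ) (l : I → ℝ) (m : J → ℝ), ∃ B ∈ bilinSpan D, ∀ X Y, ∃ p q : ℝ × ℝ → ℝ,
    Continuous p ∧ Continuous q ∧ ∀ s u, F X Y s u =
      e + s * (l ⬝ᵥ X) + u * (m ⬝ᵥ Y) + s * u * B X Y + s ^ 2 * p (s, u) + u ^ 2 * q (s, u)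

variable {D D' : List ((I → ℝ) × (J → ℝ))} {F G : (I → ℝ) → (J → ℝ) → ℝ → ℝ → ℝ}

theorem HasJet.mono (hF : HasJet D F) (h : D ⊆ D') : HasJet D' F := by
  obtain ⟨e, l, m, B, hB, H⟩ := hF
  exact ⟨e, l, m, B, bilinSpan_mono h hB, H⟩

theorem HasJet.const (r : ℝ) : HasJet D fun _ _ _ _ => r :=
  ⟨r, 0, 0, 0, Submodule.zero_mem _, fun _ _ => ⟨0, 0, continuous_const, continuous_const,
    by simp⟩⟩

theorem HasJet.left (a : I → ℝ) : HasJet D fun X _ s _ => s * (a ⬝ᵥ X) :=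
  ⟨0, a, 0, 0, Submodule.zero_mem _, fun _ _ => ⟨0, 0, continuous_const, continuous_const,
    by simp⟩⟩

theorem HasJet.right (a : J → ℝ) : HasJet D fun _ Y _ u => u * (a ⬝ᵥ Y) :=
  ⟨0, 0, a, 0, Submodule.zero_mem _, fun _ _ => ⟨0, 0, continuous_const, continuous_const,
    by simp⟩⟩

theorem HasJet.add (hF : HasJet D F) (hG : HasJet D G) :
    HasJet D fun X Y s u => F X Y s u + G X Y s u := by
  obtain ⟨e, l, m, B, hB, H⟩ := hF
  obtain ⟨e', l', m', B', hB', H'⟩ := hG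
  refine ⟨e + e', l + l', m + m', B + B', Submodule.add_mem _ hB hB', fun X Y => ?_⟩
  obtain ⟨p, q, hp, hq, h⟩ := H X Y
  obtain ⟨p', q', hp', hq', h'⟩ := H' X Y
  refine ⟨p + p', q + q', hp.add hp', hq.add hq', fun s u => ?_⟩
  simp only [h, h', add_dotProduct, Pi.add_apply]
  ring

theorem HasJet.sub (hF : HasJet D F) (hG : HasJet D G) :
    HasJet D fun X Y s u => F X Y s u - G X Y s u := by
  obtain ⟨e, l, m, B, hB, H⟩ := hF
  obtain ⟨e', l', m', B', hB', H'⟩ := hG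
  refine ⟨e - e', l - l', m - m', B - B', Submodule.sub_mem _ hB hB', fun X Y => ?_⟩
  obtain ⟨p, q, hp, hq, h⟩ := H X Y
  obtain ⟨p', q', hp', hq', h'⟩ := H' X Y
  refine ⟨p - p', q - q', hp.sub hp', hq.sub hq', fun s u => ?_⟩
  simp only [h, h', sub_dotProduct, Pi.sub_apply]
  ring

/-- The mixed coefficient of a product is e B' + e' B plus the two cross terms (l·X)(m'·Y) and
(l'·X)(m·Y). Only the cross terms are new, so one multiplication costs two products of linear forms.
-/
theorem HasJet.mul (hF : HasJet D F) (hG : HasJet D G) :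
    ∃ d d', HasJet (d :: d' :: D) fun X Y s u => F X Y s u * G X Y s u := by
  obtain ⟨e, l, m, B, hB, H⟩ := hF
  obtain ⟨e', l', m', B', hB', H'⟩ := hG
  refine ⟨(l, m'), (l', m), e * e', e • l' + e' • l, e • m' + e' • m,
    e • B' + e' • B + formProd (l, m') + formProd (l', m), ?_, fun X Y => ?_⟩
  · have hs : bilinSpan D ≤ bilinSpan ((l, m') :: (l', m) :: D) :=
      bilinSpan_mono fun x hx => by simp [hx]
    refine Submodule.add_mem _ (Submodule.add_mem _ (Submodule.add_mem _
      (Submodule.smul_mem _ _ (hs hB')) (Submodule.smul_mem _ _ (hs hB))) ?_) ?_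
    · exact Submodule.subset_span ⟨_, by simp, rfl⟩
    · exact Submodule.subset_span ⟨_, by simp, rfl⟩
  obtain ⟨p, q, hp, hq, h⟩ := H X Y
  obtain ⟨p', q', hp', hq', h'⟩ := H' X Y
  let x := l ⬝ᵥ X
  let x' := l' ⬝ᵥ X
  let y := m ⬝ᵥ Y
  let y' := m' ⬝ᵥ Y
  let b := B X Y
  let b' := B' X Y
  let f₀ : ℝ × ℝ → ℝ := fun z => e + z.1 * x + z.2 * y + z.1 * z.2 * b
  let g₁ : ℝ × ℝ → ℝ := fun z => e' + z.1 * x' + z.2 * y' + z.1 * z.2 * b' + z.1 ^ 2 * p' z +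
    z.2 ^ 2 * q' z
  refine ⟨fun z => p z * g₁ z + f₀ z * p' z + x * x' + z.2 * (x * b' + b * x') + z.2 ^ 2 * (b * b'),
    fun z => q z * g₁ z + f₀ z * q' z + y * y' + z.1 * (y * b' + b * y'), ?_, ?_, fun s u => ?_⟩
  · simp only [f₀, g₁]
    fun_prop
  · simp only [f₀, g₁]
    fun_prop
  · simp only [h, h', add_dotProduct, smul_dotProduct, Pi.add_apply, Pi.smul_apply, smul_eq_mul,
      formProd, f₀, g₁, x, x', y, y', b, b']
    ring

/-- Only multiplications enlarge the list, each by two pairs; constants, sums and differences stay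
within the span. Excluding division matters, as the expansion has to hold for all `s`, `u`. -/
theorem HasJet.of_circuit {ρ : Type} (P : Prog ρ) (hP : P.IsCircuit) :
    ∀ (D : List ((I → ℝ) × (J → ℝ))) (τ : (I → ℝ) → (J → ℝ) → ℝ → ℝ → ρ → ℝ) (σ : ρ → ℝ),
      (∀ x, HasJet D fun X Y s u => τ X Y s u x) → ∃ D' : List ((I → ℝ) × (J → ℝ)),
        D'.length ≤ D.length + 2 * P.cost id σ ∧
        ∀ x, HasJet D' fun X Y s u => P.run id (τ X Y s u) x := by
  have hwrite : ∀ (D : List ((I → ℝ) × (J → ℝ))) (τ : (I → ℝ) → (J → ℝ) → ℝ → ℝ → ρ → ℝ) (z : ρ)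
      (F : (I → ℝ) → (J → ℝ) → ℝ → ℝ → ℝ), HasJet D F →
      (∀ x, HasJet D fun X Y s u => τ X Y s u x) →
      ∀ x, HasJet D fun X Y s u => writeReg (τ X Y s u) z (F X Y s u) x := by
    intro D τ z F hF hτ x
    by_cases hx : x = z
    · simpa [writeReg, hx] using hF
    · simpa [writeReg, hx] using hτ x
  induction P with
  | halt => exact fun D τ σ hτ => ⟨D, by simp, hτ⟩
  | const z r P ih =>
    intro D τ σ hτ
    obtain ⟨D', hD, hJ⟩ := ih hP D _ (writeReg σ z r)
      (hwrite D τ z (fun _ _ _ _ => r) (.const r) hτ)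
    refine ⟨D', ?_, hJ⟩
    rw [Prog.cost]
    omega
  | arith o z x y P ih =>
    intro D τ σ hτ
    have key : ∃ D₁ : List ((I → ℝ) × (J → ℝ)), D ⊆ D₁ ∧ D₁.length ≤ D.length + 2 ∧
        HasJet D₁ fun X Y s u => o.eval (τ X Y s u x) (τ X Y s u y) := by
      cases o with
      | add => exact ⟨D, by simp, by omega, (hτ x).add (hτ y)⟩
      | sub => exact ⟨D, by simp, by omega, (hτ x).sub (hτ y)⟩
      | mul =>
        obtain ⟨d, d', h⟩ := (hτ x).mul (hτ y)
        exact ⟨d :: d' :: D, fun x hx => by simp [hx], by simp, h⟩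
      | div => exact (hP.1 rfl).elim
    obtain ⟨D₁, hsub, hlen, hJ₁⟩ := key
    obtain ⟨D', hD, hJ⟩ := ih hP.2 D₁ _ (writeReg σ z (o.eval (σ x) (σ y)))
      (hwrite D₁ τ z _ hJ₁ fun x => (hτ x).mono hsub)
    refine ⟨D', ?_, hJ⟩
    rw [Prog.cost]
    omega
  | sqrt z x P ih => exact hP.elim
  | call z x P ih => exact hP.elim
  | ifLT x y P Q _ _ => exact hP.elim

/-- Coefficients are isolated by restricting to lines through the origin and letting the parameter
tend to zero; continuity of the remainders is all that is needed, so no polynomial ring appears. -/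
theorem eq_zero_of_jet {e l m b : ℝ} {p q : ℝ × ℝ → ℝ} (hp : Continuous p) (hq : Continuous q)
    (h : ∀ s u, e + s * l + u * m + s * u * b + s ^ 2 * p (s, u) + u ^ 2 * q (s, u) = 0) :
    b = 0 := by
  have lim : ∀ {g : ℝ → ℝ}, Continuous g → (∀ s ≠ 0, g s = 0) → g 0 = 0 := by
    intro g hg h0
    have h1 : Filter.Tendsto g (nhdsWithin 0 {0}ᶜ) (nhds (g 0)) := hg.continuousAt.mono_left
      nhdsWithin_le_nhds
    refine tendsto_nhds_unique h1 (tendsto_const_nhds.congr' ?_)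
    filter_upwards [self_mem_nhdsWithin] with s hs using (h0 s hs).symm
  have he : e = 0 := by simpa using h 0 0
  subst he
  have hl : l = 0 := by
    have := lim (g := fun s => l + s * p (s, 0)) (by fun_prop) fun s hs => by
      have := h s 0
      apply mul_left_cancel₀ hs
      linear_combination this
    simpa using this
  have hm : m = 0 := by
    have := lim (g := fun s => m + s * q (0, s)) (by fun_prop) fun s hs => by
      have := h 0 s
      apply mul_left_cancel₀ hs
      linear_combination this
    simpa using this
  subst hl hm
  -- At second order the remainders contribute `p (0, 0) + q (0, 0)` on the diagonal and on the
  -- antidiagonal alike, whereas the mixed term changes sign; comparing the two lines isolates `b`.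
  have h1 := lim (g := fun s => b + p (s, s) + q (s, s)) (by fun_prop) fun s hs => by
    have := h s s
    apply mul_left_cancel₀ (pow_ne_zero 2 hs)
    linear_combination this
  have h2 := lim (g := fun s => - b + p (s, -s) + q (s, -s)) (by fun_prop) fun s hs => by
    have := h s (-s)
    apply mul_left_cancel₀ (pow_ne_zero 2 hs)
    linear_combination this
  simp only [neg_zero] at h1 h2
  linarith

end Jets

/-- On input `(sX, uY)` an output register holds exactly `s * u` times an entry of the product. Its
mixed part is therefore that entry, which thus lies in the span of at most `2 * t` products of
linear forms; the coefficients give `γ`. -/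
theorem CanMultiply.bilinRank {n m p t : ℕ} (h : CanMultiply n m p t) :
    BilinRank n m p (2 * t) := by
  obtain ⟨P, hP, hrun⟩ := h
  let τ : (Fin n × Fin m → ℝ) → (Fin m × Fin p → ℝ) → ℝ → ℝ → MulReg n m p → ℝ :=
    fun X Y s u x => match x with
    | .X i k => s * X (i, k)
    | .Y k j => u * Y (k, j)
    | .Z _ _ => 0
    | .tmp _ => 0
  have hτ : ∀ x, HasJet [] fun X Y s u => τ X Y s u x := by
    rintro (⟨i, k⟩ | ⟨k, j⟩ | ⟨i, j⟩ | l)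
    · simpa [τ] using HasJet.left (D := []) (J := Fin m × Fin p) (Pi.single (i, k) (1 : ℝ))
    · simpa [τ] using HasJet.right (D := []) (I := Fin n × Fin m) (Pi.single (k, j) (1 : ℝ))
    · exact HasJet.const 0
    · exact HasJet.const 0
  obtain ⟨D, hD, hJ⟩ := HasJet.of_circuit P hP [] τ 0 hτ
  have hlen : D.length ≤ 2 * t := by
    have := (hrun 0).1
    simp only [List.length_nil] at hD
    omega
  refine BilinRank.pad ?_ hlen
  have key : ∀ i j, (fun (X : Fin n × Fin m → ℝ) (Y : Fin m × Fin p → ℝ) =>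
      ∑ k, X (i, k) * Y (k, j)) ∈ bilinSpan D := by
    intro i j
    obtain ⟨e, l, r, B, hB, H⟩ := hJ (.Z i j)
    convert hB using 1
    funext X Y
    obtain ⟨p', q', hp, hq, h⟩ := H X Y
    refine (sub_eq_zero.1 (eq_zero_of_jet (e := e) (l := l ⬝ᵥ X) (m := r ⬝ᵥ Y) hp hq
      fun s u => ?_)).symm
    have h1 := h s u
    beta_reduce at h1
    rw [(hrun _).2 i j] at h1
    have h2 : ∑ k, τ X Y s u (.X i k) * τ X Y s u (.Y k j) =
        s * u * ∑ k, X (i, k) * Y (k, j) := by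
      rw [Finset.mul_sum]
      exact Finset.sum_congr rfl fun k _ => by simp only [τ]; ring
    rw [h2] at h1
    linear_combination -h1
  have hrange : formProd '' {d | d ∈ D} =
      Set.range fun l : Fin D.length => formProd (D.get l) := by
    ext g
    simp only [Set.mem_image, Set.mem_ofPred_eq, Set.mem_range, List.mem_iff_get]
    constructor
    · rintro ⟨_, ⟨l, rfl⟩, rfl⟩
      exact ⟨l, rfl⟩
    · rintro ⟨l, rfl⟩
      exact ⟨_, ⟨l, rfl⟩, rfl⟩
  have key' : ∀ i j, ∃ w : Fin D.length → ℝ, ∑ l, w l • formProd (D.get l) =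
      fun (X : Fin n × Fin m → ℝ) (Y : Fin m × Fin p → ℝ) => ∑ k, X (i, k) * Y (k, j) := by
    intro i j
    have := key i j
    rwa [bilinSpan, hrange, Submodule.mem_span_range_iff_exists_fun] at this
  choose γ hγ using key'
  refine ⟨fun l i k => (D.get l).1 (i, k), fun l k j => (D.get l).2 (k, j),
    fun l i j => γ i j l, fun i k k' j i' j' => ?_⟩
  have := congrFun (congrFun (hγ i' j') (Pi.single (i, k) 1)) (Pi.single (k', j) 1)
  simp only [Finset.sum_apply, Pi.smul_apply, formProd, dotProduct_single, mul_one,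
    smul_eq_mul] at this
  calc _ = ∑ l, γ i' j' l * ((D.get l).1 (i, k) * (D.get l).2 (k', j)) :=
        Finset.sum_congr rfl fun l _ => by ring
    _ = _ := this
    _ = _ := by
      simp only [Pi.single_apply, Prod.mk.injEq]
      by_cases h1 : i = i'
      · by_cases h2 : j = j'
        · simp [h1, h2, eq_comm]
        · simp [Ne.symm h2, h2]
      · simp [Ne.symm h1, h1]

/-! ### Recursive block multiplication -/

/-- One level of recursion with a bilinear algorithm of rank `R`. -/
theorem BilinRank.mulBound_prod {b m b' R t : ℕ} (h : BilinRank b m b' R) {I J K : Type}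
    [Fintype I] [Fintype J] [Fintype K] (H : MulBound I J K t) :
    MulBound (Fin b × I) (Fin m × J) (Fin b' × K)
      (R * (Fintype.card I * Fintype.card J * (b * m * 3)) +
        R * (Fintype.card J * Fintype.card K * (m * b' * 3)) + R * t +
        b * Fintype.card I * (b' * Fintype.card K) * (R * 3)) := by
  obtain ⟨α, β, γ, h⟩ := h
  intro Ω c V X Y h0 hX hY
  -- The factors are read as matrices of blocks. Each of the `R` scalar products becomes one product
  -- of two linear combinations of blocks.
  let XX : Fin R → Ω → Matrix I J ℝ := fun l ω => Matrix.of fun i j =>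
    ∑ x : Fin b × Fin m, α l x.1 x.2 * X ω (x.1, i) (x.2, j)
  let YY : Fin R → Ω → Matrix J K ℝ := fun l ω => Matrix.of fun i j =>
    ∑ x : Fin m × Fin b', β l x.1 x.2 * Y ω (x.1, i) (x.2, j)
  have s1 : Gen c V _ (⋃ l, entries (XX l)) := Gen.iUnion fun l =>
    Gen.matrix fun i j => Gen.linComb (fun x : Fin b × Fin m => α l x.1 x.2)
      (u := fun x ω => X ω (x.1, i) (x.2, j)) h0 fun x => mem_entries hX _ _
  have s2 : Gen c V _ (⋃ l, entries (YY l)) := Gen.iUnion fun l =>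
    Gen.matrix fun i j => Gen.linComb (fun x : Fin m × Fin b' => β l x.1 x.2)
      (u := fun x ω => Y ω (x.1, i) (x.2, j)) h0 fun x => mem_entries hY _ _
  have s3 : Gen c (V ∪ ((⋃ l, entries (XX l)) ∪ ⋃ l, entries (YY l))) _
      (⋃ l, entries fun ω => XX l ω * YY l ω) := Gen.iUnion fun l =>
    H Ω c _ (XX l) (YY l) (Or.inl h0)
      ((Set.subset_iUnion (fun l => entries (XX l)) l).trans
        (Set.subset_union_left.trans Set.subset_union_right))
      ((Set.subset_iUnion (fun l => entries (YY l)) l).trans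
        (Set.subset_union_right.trans Set.subset_union_right))
  -- All block combinations are expanded and the sum over `l` is done first; the tensor identity
  -- then keeps only the terms with matching outer indices. No commutation of blocks occurs.
  have key : ∀ ω i j, (X ω * Y ω) i j =
      ∑ l, γ l i.1 j.1 * (XX l ω * YY l ω) i.2 j.2 := by
    rintro ω ⟨i, x⟩ ⟨j, y⟩
    have e1 : ∀ l, γ l i j * (XX l ω * YY l ω) x y = ∑ z, ∑ u : Fin b × Fin m,
        ∑ v : Fin m × Fin b', (α l u.1 u.2 * β l v.1 v.2 * γ l i j) *
          (X ω (u.1, x) (u.2, z) * Y ω (v.1, z) (v.2, y)) := by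
      intro l
      simp only [Matrix.mul_apply, XX, YY, Matrix.of_apply, Finset.mul_sum, Finset.sum_mul]
      refine Finset.sum_congr rfl fun z _ => ?_
      rw [Finset.sum_comm]
      refine Finset.sum_congr rfl fun u _ => Finset.sum_congr rfl fun v _ => by ring
    simp only [e1]
    rw [Finset.sum_comm, Matrix.mul_apply, Fintype.sum_prod_type_right]
    refine Finset.sum_congr rfl fun z _ => ?_
    rw [Finset.sum_comm]
    have e2 : ∀ u : Fin b × Fin m, ∑ l, ∑ v : Fin m × Fin b',
        (α l u.1 u.2 * β l v.1 v.2 * γ l i j) *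
          (X ω (u.1, x) (u.2, z) * Y ω (v.1, z) (v.2, y)) =
        if u.1 = i then X ω (u.1, x) (u.2, z) * Y ω (u.2, z) (j, y) else 0 := by
      intro u
      rw [Finset.sum_comm]
      simp only [← Finset.sum_mul, h]
      by_cases hu : u.1 = i
      · rw [Finset.sum_eq_single (u.2, j)]
        · simp [hu]
        · rintro ⟨v, w⟩ _ hv
          rw [if_neg, zero_mul]
          rintro ⟨_, h2, h3⟩
          exact hv (Prod.ext h2.symm h3)
        · simp
      · simp [hu]
    simp only [e2]
    rw [Fintype.sum_prod_type_right]
    refine Finset.sum_congr rfl fun k _ => ?_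
    simp
  have s4 : Gen c (V ∪ ((⋃ l, entries (XX l)) ∪ ⋃ l, entries (YY l)) ∪
      (⋃ l, entries fun ω => XX l ω * YY l ω)) _ (entries fun ω => X ω * Y ω) :=
    Gen.matrix (t := R * 3) fun i j => by
      simp only [key]
      have := Gen.linComb (c := c) (V := V ∪ ((⋃ l, entries (XX l)) ∪ ⋃ l, entries (YY l)) ∪
        (⋃ l, entries fun ω => XX l ω * YY l ω)) (fun l => γ l i.1 j.1)
        (u := fun l ω => (XX l ω * YY l ω) i.2 j.2) (Or.inl (Or.inl h0))
        fun l => Or.inr (Set.mem_iUnion.2 ⟨l, (i.2, j.2), rfl⟩)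
      simpa only [Fintype.card_fin] using this
  refine ((s1.union s2).trans (s3.trans s4)).weaken (le_of_eq ?_)
  simp only [Fintype.card_fin, Fintype.card_prod]
  ring

/-- With p = b^L N, the linear combinations of a level cost at most 9 R b² p². Adding 18 b² p² to
the cost makes the recursion purely geometric: half of R · 18 b² p² pays for the combinations, the
other half, by 2 b² ≤ R, for the term 18 b² (b p)² of the next level. -/
theorem BilinRank.mulBound_pow {b m R : ℕ} (h : BilinRank b m b R) (hR : 2 * b ^ 2 ≤ R)
    (hm : m ≤ b) {N t : ℕ} (H : MulBound (Fin N) (Fin N) (Fin N) t) (L : ℕ) :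
    ∃ t', MulBound (Fin (b ^ L * N)) (Fin (m ^ L * N)) (Fin (b ^ L * N)) t' ∧
      t' + 18 * b ^ 2 * (b ^ L * N) ^ 2 ≤ R ^ L * (t + 18 * b ^ 2 * N ^ 2) := by
  induction L with
  | zero =>
    have e : ∀ c : ℕ, Fin (c ^ 0 * N) ≃ Fin N := fun c => finCongr (by simp)
    exact ⟨t, H.embed (e b).toEmbedding (e m).toEmbedding (e b).toEmbedding, by simp⟩
  | succ L ih =>
    obtain ⟨t', H', ht'⟩ := ih
    have e : ∀ c : ℕ, Fin (c ^ (L + 1) * N) ≃ Fin c × Fin (c ^ L * N) := fun c =>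
      (finCongr (by ring)).trans finProdFinEquiv.symm
    refine ⟨_, (h.mulBound_prod H').embed (e b).toEmbedding (e m).toEmbedding (e b).toEmbedding, ?_⟩
    simp only [Fintype.card_fin]
    set p := b ^ L * N
    set q := m ^ L * N
    have hq : q ≤ p := Nat.mul_le_mul_right _ (Nat.pow_le_pow_left hm L)
    have e1 : R * (p * q * (b * m * 3)) ≤ R * (p * p * (b * b * 3)) := by gcongr
    have e2 : R * (q * p * (m * b * 3)) ≤ R * (p * p * (b * b * 3)) := by gcongr
    have e3 : 9 * b ^ 2 * p ^ 2 * (2 * b ^ 2) ≤ 9 * b ^ 2 * p ^ 2 * R := by gcongr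
    have e4 : b ^ (L + 1) * N = b * p := by simp only [p]; ring
    have e5 := Nat.mul_le_mul_left R ht'
    rw [e4, pow_succ' R L]
    nlinarith

/-! ### A circuit has to write all its outputs -/

theorem Prog.exists_written {ρ : Type} (P : Prog ρ) (hP : P.IsCircuit) : ∀ σ₀ : ρ → ℝ,
    ∃ l : List ρ, l.length ≤ P.cost id σ₀ ∧ ∀ σ, ∀ x ∉ l, P.run id σ x = σ x := by
  induction P with
  | halt => exact fun _ => ⟨[], by simp, fun σ x _ => rfl⟩
  | const z r P ih =>
    intro σ₀
    obtain ⟨l, hl, h⟩ := ih hP (writeReg σ₀ z r)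
    refine ⟨z :: l, by simpa [Prog.cost] using hl, fun σ x hx => ?_⟩
    rw [List.mem_cons, not_or] at hx
    rw [Prog.run, h _ _ hx.2, writeReg, if_neg hx.1]
  | arith o z x y P ih =>
    intro σ₀
    obtain ⟨l, hl, h⟩ := ih hP.2 (writeReg σ₀ z (o.eval (σ₀ x) (σ₀ y)))
    refine ⟨z :: l, by simpa [Prog.cost] using hl, fun σ x hx => ?_⟩
    rw [List.mem_cons, not_or] at hx
    rw [Prog.run, h _ _ hx.2, writeReg, if_neg hx.1]
  | sqrt z x P ih => exact hP.elim
  | call z x P ih => exact hP.elim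
  | ifLT x y P Q _ _ => exact hP.elim

/-- An output register that is never written keeps its initial content, which is wrong for zero
factors if that content is 1. So each output costs at least one instruction. -/
theorem CanMultiply.mul_le {n m p t : ℕ} (h : CanMultiply n m p t) : n * p ≤ t := by
  classical
  obtain ⟨P, hP, hrun⟩ := h
  obtain ⟨l, hl, hw⟩ := P.exists_written hP 0
  have hmem : ∀ z : Fin n × Fin p, MulReg.Z z.1 z.2 ∈ l := by
    intro z
    by_contra hz
    let σ : MulReg n m p → ℝ := fun x => match x with
      | .X _ _ => 0
      | .Y _ _ => 0
      | .Z _ _ => 1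
      | .tmp _ => 0
    have h1 := hw σ _ hz
    rw [(hrun σ).2] at h1
    simp [σ] at h1
  have hinj : Function.Injective fun z : Fin n × Fin p => (MulReg.Z z.1 z.2 : MulReg n m p) := by
    rintro ⟨a, b⟩ ⟨c, d⟩ h
    simpa using h
  have h1 : (Finset.univ.image fun z : Fin n × Fin p => (MulReg.Z z.1 z.2 : MulReg n m p)) ⊆
      l.toFinset := by
    intro x hx
    obtain ⟨z, _, rfl⟩ := Finset.mem_image.1 hx
    exact List.mem_toFinset.2 (hmem z)
  have h2 := Finset.card_le_card h1
  rw [Finset.card_image_of_injective _ hinj, Finset.card_univ, Fintype.card_prod,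
    Fintype.card_fin, Fintype.card_fin] at h2
  exact h2.trans ((List.toFinset_card_le l).trans (hl.trans (hrun 0).1))

/-- Comparison of exponents. -/
theorem le_of_rpow_le_isBigO {p q : ℝ} {t : ℕ → ℝ} {η : ℕ → ℝ}
    (hη : Filter.Tendsto η Filter.atTop (nhds 0)) (h : ∀ n : ℕ, (n : ℝ) ^ p ≤ t n)
    (ht : t =O[Filter.atTop] fun n : ℕ => (n : ℝ) ^ (q + η n)) : p ≤ q := by
  by_contra! hlt
  obtain ⟨K, hK⟩ := ht.bound
  have h1 : Filter.Tendsto (fun n : ℕ => (n : ℝ) ^ ((p - q) / 2)) Filter.atTop Filter.atTop :=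
    (tendsto_rpow_atTop (by linarith)).comp tendsto_natCast_atTop_atTop
  obtain ⟨n, hn, hn1, hnη, hnK⟩ := (hK.and ((Filter.eventually_ge_atTop 1).and
    ((hη.eventually (gt_mem_nhds (by linarith : (0 : ℝ) < (p - q) / 2))).and
      (h1.eventually (Filter.eventually_gt_atTop K))))).exists
  have hn1' : (1 : ℝ) ≤ n := by exact_mod_cast hn1
  have hpos : (0 : ℝ) < n := by linarith
  have h2 : (n : ℝ) ^ ((p - q) / 2) * (n : ℝ) ^ (q + η n) ≤ K * (n : ℝ) ^ (q + η n) := by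
    calc (n : ℝ) ^ ((p - q) / 2) * (n : ℝ) ^ (q + η n) = (n : ℝ) ^ ((p - q) / 2 + (q + η n)) :=
          (Real.rpow_add hpos _ _).symm
      _ ≤ (n : ℝ) ^ p := Real.rpow_le_rpow_of_exponent_le hn1' (by linarith)
      _ ≤ t n := h n
      _ ≤ ‖t n‖ := le_abs_self _
      _ ≤ _ := hn
      _ = _ := by rw [Real.norm_of_nonneg (Real.rpow_nonneg hpos.le _)]
  have h3 := le_of_mul_le_mul_right h2 (Real.rpow_pos_of_pos hpos _)
  linarith

/-! ### Bounds on ω and α, and explicit constants -/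

theorem IsMatMulExponent.two_le {ω : ℝ} (h : IsMatMulExponent ω) : 2 ≤ ω := by
  obtain ⟨t, ht, hO⟩ := h
  refine le_of_rpow_le_isBigO (t := fun n => (t n : ℝ)) (η := fun _ => 0) tendsto_const_nhds
    (fun n => ?_) (by simpa using hO)
  have := (ht n).mul_le
  rw [Real.rpow_two, sq]
  exact_mod_cast this

theorem IsDualAdmissible.le_one {β : ℝ} (h : IsDualAdmissible β) : β ≤ 1 := by
  obtain ⟨t, η, ht, hη, hO⟩ := h
  have : 1 + β ≤ 2 := by
    -- The extra 1 at `n = 0` is needed because `0 ^ 0 = 1` while nothing is known about `t 0`; it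
    -- does not affect the asymptotics.
    refine le_of_rpow_le_isBigO (p := 1 + β) (t := fun n => (t n : ℝ) + if n = 0 then 1 else 0) hη
      (fun n => ?_) ?_
    · rcases Nat.eq_zero_or_pos n with rfl | hn
      · rw [if_pos rfl, Nat.cast_zero]
        exact (Real.zero_rpow_le_one _).trans (by linarith [Nat.cast_nonneg (α := ℝ) (t 0)])
      · have hpos : (0 : ℝ) < n := by exact_mod_cast hn
        rw [if_neg hn.ne', add_zero, Real.rpow_add hpos, Real.rpow_one]
        calc (n : ℝ) * (n : ℝ) ^ β ≤ n * (⌈(n : ℝ) ^ β⌉₊ : ℝ) := by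
              gcongr
              exact Nat.le_ceil _
          _ ≤ t n := by exact_mod_cast (ht n).mul_le
    · refine hO.congr' ?_ (by rfl)
      filter_upwards [Filter.eventually_gt_atTop 0] with n hn
      simp [hn.ne']
  linarith

theorem dualExponent_le_one : dualExponent ≤ 1 :=
  Real.sSup_le (fun _ h => IsDualAdmissible.le_one h) zero_le_one

/-- Allows an exponent that is too small for the potential argument to be replaced by a larger one.
-/
theorem IsMatMulExponent.mono {ω ω' : ℝ} (h : IsMatMulExponent ω) (hω : ω ≤ ω') :
    IsMatMulExponent ω' := by
  obtain ⟨t, ht, hO⟩ := h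
  refine ⟨t, ht, hO.trans (Asymptotics.IsBigO.of_bound 1 ?_)⟩
  filter_upwards [Filter.eventually_ge_atTop 1] with n hn
  have hn1 : (1 : ℝ) ≤ n := by exact_mod_cast hn
  rw [one_mul, Real.norm_of_nonneg (by positivity), Real.norm_of_nonneg (by positivity)]
  exact Real.rpow_le_rpow_of_exponent_le hn1 hω

/-- The finitely many sizes before the asymptotic bound sets in are covered by adding their costs to
the constant, since `n ^ ω ≥ 1`. The lower bound `n ^ 2 ≤ t` later lets quadratic overheads be
charged to the multiplication. -/
theorem IsMatMulExponent.exists_bound {ω : ℝ} (h : IsMatMulExponent ω) :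
    ∃ K : ℝ, 1 ≤ K ∧ ∀ n : ℕ, 1 ≤ n → ∃ t : ℕ, MulBound (Fin n) (Fin n) (Fin n) t ∧
      n ^ 2 ≤ t ∧ (t : ℝ) ≤ K * (n : ℝ) ^ ω := by
  obtain ⟨t, ht, hO⟩ := h
  obtain ⟨K, hK⟩ := hO.bound
  obtain ⟨n₀, hn₀⟩ := Filter.eventually_atTop.1 hK
  refine ⟨max 1 (max K (∑ n ∈ Finset.range n₀, (t n : ℝ))), le_max_left _ _, fun n hn =>
    ⟨t n, (ht n).mulBound, by rw [sq]; exact (ht n).mul_le, ?_⟩⟩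
  have hn1 : (1 : ℝ) ≤ n := by exact_mod_cast hn
  have hω : (1 : ℝ) ≤ (n : ℝ) ^ ω := Real.one_le_rpow hn1
    (by linarith [IsMatMulExponent.two_le ⟨t, ht, hO⟩])
  by_cases hlt : n < n₀
  · calc (t n : ℝ) ≤ ∑ n ∈ Finset.range n₀, (t n : ℝ) :=
          Finset.single_le_sum (f := fun n => (t n : ℝ)) (fun _ _ => Nat.cast_nonneg _)
            (Finset.mem_range.2 hlt)
      _ ≤ max 1 (max K (∑ n ∈ Finset.range n₀, (t n : ℝ))) * 1 := by
          rw [mul_one]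
          exact (le_max_right _ _).trans (le_max_right _ _)
      _ ≤ _ := by gcongr
  · have := hn₀ n (by omega)
    rw [Real.norm_of_nonneg (Nat.cast_nonneg _), Real.norm_of_nonneg (by positivity)] at this
    refine this.trans ?_
    gcongr
    exact (le_max_left _ _).trans (le_max_right _ _)

/-! ### Rectangular matrix multiplication -/

/-- The supremum defining the dual exponent need not be attained, hence `β < dualExponent`: some
admissible `β' > β` exists, and its algorithms are restricted to the smaller inner dimension. -/
theorem exists_rank_seq {β : ℝ} (h0 : 0 ≤ β) (hβ : β = 0 ∨ β < dualExponent) :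
    ∃ (r : ℕ → ℕ) (η : ℕ → ℝ) (K : ℝ), (∀ n : ℕ, BilinRank n ⌈(n : ℝ) ^ β⌉₊ n (r n)) ∧
      Filter.Tendsto η Filter.atTop (nhds 0) ∧
      ∀ᶠ n : ℕ in Filter.atTop, (r n : ℝ) ≤ K * (n : ℝ) ^ (2 + η n) := by
  rcases hβ with rfl | hβ
  · refine ⟨fun n => n * n, fun _ => 0, 1, fun n => ?_, tendsto_const_nhds, .of_forall fun n => ?_⟩
    · rw [Real.rpow_zero, Nat.ceil_one]
      exact bilinRank_outer n
    · rw [add_zero, Real.rpow_two, sq, one_mul, Nat.cast_mul]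
  · have hne : {β : ℝ | IsDualAdmissible β}.Nonempty := by
      by_contra hne
      rw [Set.not_nonempty_iff_eq_empty] at hne
      rw [dualExponent, hne, Real.sSup_empty] at hβ
      linarith
    obtain ⟨β', ⟨t, η, ht, hη, hO⟩, hlt⟩ := exists_lt_of_lt_csSup hne hβ
    obtain ⟨K, hK⟩ := hO.bound
    refine ⟨fun n => 2 * t n, η, 2 * K, fun n => ?_, hη, ?_⟩
    · rcases Nat.eq_zero_or_pos n with rfl | hn
      · exact ⟨0, 0, 0, fun i => i.elim0⟩
      · refine (ht n).bilinRank.swap.restrict (Nat.ceil_mono ?_)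
        exact Real.rpow_le_rpow_of_exponent_le (by exact_mod_cast hn) hlt.le
    · filter_upwards [hK] with n hn
      rw [Real.norm_of_nonneg (Nat.cast_nonneg _), Real.norm_of_nonneg (by positivity)] at hn
      push_cast
      linarith

/-- A single sufficiently large base size is fixed. There the constant in the rank bound and the
summand `2 * b ^ 2` are both absorbed by `b ^ (δ / 2)`, and `m < b` follows from `β < 1`. -/
theorem exists_rect_rank {β δ : ℝ} (h0 : 0 ≤ β) (h1 : β < 1) (hβ : β = 0 ∨ β < dualExponent)
    (hδ : 0 < δ) : ∃ b m R : ℕ, 2 ≤ b ∧ m < b ∧ (b : ℝ) ^ β ≤ m ∧ BilinRank b m b R ∧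
      2 * b ^ 2 ≤ R ∧ (R : ℝ) ≤ (b : ℝ) ^ (2 + δ) := by
  obtain ⟨r, η, K, hr, hη, hK⟩ := exists_rank_seq h0 hβ
  have T : ∀ {p : ℝ}, 0 < p → Filter.Tendsto (fun n : ℕ => (n : ℝ) ^ p) Filter.atTop
      Filter.atTop := fun hp => (tendsto_rpow_atTop hp).comp tendsto_natCast_atTop_atTop
  obtain ⟨n, hn2, hnβ, hnη, hnK, hn⟩ := ((Filter.eventually_ge_atTop 2).and
    (((T (by linarith : 0 < 1 - β)).eventually (Filter.eventually_ge_atTop 3)).and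
    ((hη.eventually (gt_mem_nhds (by linarith : (0 : ℝ) < δ / 2))).and
    (((T (half_pos hδ)).eventually (Filter.eventually_ge_atTop (|K| + 2))).and hK)))).exists
  have hn1 : (1 : ℝ) ≤ n := by exact_mod_cast (by omega : 1 ≤ n)
  have hpos : (0 : ℝ) < n := by linarith
  -- The rank is padded by `2 * n ^ 2` to meet the condition of `BilinRank.mulBound_pow`.
  refine ⟨n, ⌈(n : ℝ) ^ β⌉₊, r n + 2 * n ^ 2, hn2, ?_, Nat.le_ceil _, (hr n).pad (by omega),
    by omega, ?_⟩
  · have h2 : (1 : ℝ) ≤ (n : ℝ) ^ β := Real.one_le_rpow hn1 h0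
    have h3 : (n : ℝ) = (n : ℝ) ^ β * (n : ℝ) ^ (1 - β) := by
      rw [← Real.rpow_add hpos, add_sub_cancel, Real.rpow_one]
    have h4 : (⌈(n : ℝ) ^ β⌉₊ : ℝ) < n := by
      calc (⌈(n : ℝ) ^ β⌉₊ : ℝ) < (n : ℝ) ^ β + 1 := Nat.ceil_lt_add_one (by positivity)
        _ ≤ (n : ℝ) ^ β * 3 := by linarith
        _ ≤ (n : ℝ) ^ β * (n : ℝ) ^ (1 - β) := by gcongr
        _ = n := h3.symm
    exact_mod_cast h4
  · have e1 : (n : ℝ) ^ (2 + η n) ≤ (n : ℝ) ^ (2 + δ / 2) :=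
      Real.rpow_le_rpow_of_exponent_le hn1 (by linarith)
    have e2 : (n : ℝ) ^ 2 ≤ (n : ℝ) ^ (2 + δ / 2) := by
      rw [← Real.rpow_two]
      exact Real.rpow_le_rpow_of_exponent_le hn1 (by linarith)
    push_cast
    calc (r n : ℝ) + 2 * (n : ℝ) ^ 2 ≤ |K| * (n : ℝ) ^ (2 + δ / 2) + 2 * (n : ℝ) ^ (2 + δ / 2) := by
          have h5 : K * (n : ℝ) ^ (2 + η n) ≤ |K| * (n : ℝ) ^ (2 + δ / 2) :=
            mul_le_mul (le_abs_self K) e1 (by positivity) (abs_nonneg K)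
          linarith
      _ = (|K| + 2) * (n : ℝ) ^ (2 + δ / 2) := by ring
      _ ≤ (n : ℝ) ^ (δ / 2) * (n : ℝ) ^ (2 + δ / 2) := by gcongr
      _ = (n : ℝ) ^ (2 + δ) := by
        rw [← Real.rpow_add hpos]
        congr 1
        ring

/-- The number of blocks is a power of `b`, hence known only up to a factor `b`, and the exponent it
is raised to may have either sign. -/
theorem rpow_le_of_near {x y b p : ℝ} (hb : 1 ≤ b) (hy : 0 < y) (h1 : y ≤ x) (h2 : x ≤ y * b) :
    y ^ p ≤ b ^ |p| * x ^ p := by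
  have hx : 0 < x := hy.trans_le h1
  rcases le_total 0 p with hp | hp
  · calc y ^ p ≤ 1 * x ^ p := by
          rw [one_mul]
          exact Real.rpow_le_rpow hy.le h1 hp
      _ ≤ _ := by
        gcongr
        exact Real.one_le_rpow hb (abs_nonneg p)
  · calc y ^ p = b ^ |p| * (y * b) ^ p := by
          rw [abs_of_nonpos hp, Real.mul_rpow hy.le (by linarith), mul_left_comm,
            ← Real.rpow_add (by linarith), neg_add_cancel, Real.rpow_zero, mul_one]
      _ ≤ _ := mul_le_mul_of_nonneg_left (Real.rpow_le_rpow_of_nonpos hx h2 hp) (by positivity)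

/-- The outer dimension is cut into B = b^L pieces of size N ≈ n/B, the inner one into m^L ≥ B^β
pieces of the same size. Covering k requires B^(1-β) ≤ n/k. Nesting the rank-R algorithm L times
costs about R^L N^ω ≤ B^(2+δ) (n/B)^ω up to constants, and B ≈ (n/k)^(1/(1-β)) turns this into the
stated power of k/n. -/
theorem IsMatMulExponent.exists_rect_bound {ω β δ : ℝ} (hω : IsMatMulExponent ω) (h0 : 0 ≤ β)
    (h1 : β < 1) (hβ : β = 0 ∨ β < dualExponent) (hδ : 0 < δ) :
    ∃ K : ℝ, 0 ≤ K ∧ ∀ n k : ℕ, 1 ≤ k → k ≤ n → (n : ℝ) ^ β ≤ k → ∃ t : ℕ,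
      MulBound (Fin n) (Fin k) (Fin n) t ∧ n ^ 2 ≤ t ∧
      (t : ℝ) ≤ K * ((n : ℝ) ^ ω * ((k : ℝ) / n) ^ ((ω - 2 - δ) / (1 - β))) := by
  obtain ⟨b, m, R, hb, hm, hbm, hrank, hR, hRb⟩ := exists_rect_rank h0 h1 hβ hδ
  obtain ⟨K₀, hK₀, hmul⟩ := hω.exists_bound
  have hω2 := hω.two_le
  have hb1 : (1 : ℝ) < b := by exact_mod_cast hb
  refine ⟨(1 + 18 * (b : ℝ) ^ 2) * K₀ * 2 ^ ω * (b : ℝ) ^ |2 + δ - ω|, by positivity,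
    fun n k hk hkn hnk => ?_⟩
  have hkpos : (0 : ℝ) < k := by exact_mod_cast hk
  have hkn' : (k : ℝ) ≤ n := by exact_mod_cast hkn
  have hnpos : (0 : ℝ) < n := hkpos.trans_le hkn'
  have h1β : 0 < 1 - β := by linarith
  -- The ideal number of pieces; `B` is the largest power of `b` not exceeding it.
  set x : ℝ := ((n : ℝ) / k) ^ (1 / (1 - β)) with hx
  have hx1 : 1 ≤ x := Real.one_le_rpow ((one_le_div hkpos).2 hkn') (by positivity)
  have hxpos : 0 < x := by linarith
  have hxβ : x ^ (1 - β) = n / k := by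
    rw [hx, ← Real.rpow_mul (by positivity), one_div_mul_cancel h1β.ne', Real.rpow_one]
  obtain ⟨L, hL1, hL2⟩ := exists_nat_pow_near hx1 hb1
  set B : ℕ := b ^ L with hB
  have hBc : (B : ℝ) = (b : ℝ) ^ L := by simp [hB]
  have hBpos : (0 : ℝ) < B := by rw [hBc]; positivity
  rw [← hBc] at hL1
  rw [pow_succ, ← hBc] at hL2
  -- Here `n ^ β ≤ k` enters: the pieces do not become smaller than single entries, so that rounding
  -- `n / B` up to `N` loses at most a factor 2.
  have hxn : x ≤ n := by
    have : x ^ (1 - β) ≤ (n : ℝ) ^ (1 - β) := by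
      rw [hxβ, Real.rpow_sub hnpos, Real.rpow_one]
      gcongr
    exact (Real.rpow_le_rpow_iff hxpos.le hnpos.le h1β).1 this
  have hBn : (B : ℝ) ≤ n := hL1.trans hxn
  set N : ℕ := n / B + 1 with hN
  have hnN : n ≤ B * N := by
    have := Nat.lt_mul_div_succ n (by exact_mod_cast hBpos : 0 < B)
    rw [hN]
    omega
  have hnN' : (n : ℝ) / B ≤ N := by
    rw [div_le_iff₀ hBpos, mul_comm]
    exact_mod_cast hnN
  have hN2 : (N : ℝ) ≤ 2 * n / B := by
    have h3 : ((n / B : ℕ) : ℝ) ≤ (n : ℝ) / B := Nat.cast_div_le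
    have h4 : (1 : ℝ) ≤ n / B := (one_le_div hBpos).2 hBn
    rw [hN]
    push_cast
    rw [mul_div_assoc]
    linarith
  have hkN : k ≤ m ^ L * N := by
    have h3 : (B : ℝ) ^ (1 - β) ≤ n / k := by
      rw [← hxβ]
      exact Real.rpow_le_rpow hBpos.le hL1 h1β.le
    have h4 : (B : ℝ) ^ β ≤ (m : ℝ) ^ L := by
      rw [hBc, ← Real.rpow_natCast, ← Real.rpow_mul (by positivity), mul_comm,
        Real.rpow_mul (by positivity), Real.rpow_natCast]
      gcongr
    have h5 : (k : ℝ) ≤ (m : ℝ) ^ L * N := by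
      calc (k : ℝ) = (B : ℝ) ^ β * ((B : ℝ) ^ (1 - β) * k) / B := by
            rw [← mul_assoc, ← Real.rpow_add hBpos, add_sub_cancel, Real.rpow_one]
            field_simp
        _ ≤ (B : ℝ) ^ β * ((n / k) * k) / B := by gcongr
        _ = (B : ℝ) ^ β * (n / B) := by field_simp
        _ ≤ (m : ℝ) ^ L * N := by gcongr
    exact_mod_cast h5
  obtain ⟨t₀, ht₀, hNt₀, ht₀K⟩ := hmul N (Nat.succ_pos _)
  obtain ⟨t', ht', ht'R⟩ := hrank.mulBound_pow hR hm.le ht₀ L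
  rw [← hB] at ht' ht'R
  refine ⟨t' + (B * N) ^ 2, (ht'.embed (Fin.castLEEmb hnN) (Fin.castLEEmb hkN)
    (Fin.castLEEmb hnN)).mono (by omega), ?_, ?_⟩
  · exact (Nat.pow_le_pow_left hnN 2).trans (by omega)
  · have e1 : t' + (B * N) ^ 2 ≤ R ^ L * ((1 + 18 * b ^ 2) * t₀) := by
      calc t' + (B * N) ^ 2 ≤ t' + 18 * b ^ 2 * (B * N) ^ 2 := by
            have : 1 ≤ 18 * b ^ 2 := by nlinarith
            gcongr
            nlinarith
        _ ≤ _ := ht'R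
        _ ≤ _ := by
          gcongr
          nlinarith
    have e2 : (R : ℝ) ^ L ≤ (B : ℝ) ^ (2 + δ) := by
      rw [hBc, ← Real.rpow_natCast (b : ℝ), ← Real.rpow_mul (by positivity), mul_comm,
        Real.rpow_mul (by positivity), Real.rpow_natCast]
      gcongr
    have e3 : (N : ℝ) ^ ω ≤ 2 ^ ω * (n : ℝ) ^ ω * (B : ℝ) ^ (-ω) := by
      rw [Real.rpow_neg hBpos.le, ← Real.mul_rpow (by norm_num) hnpos.le, ← div_eq_mul_inv,
        ← Real.div_rpow (by positivity) hBpos.le]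
      exact Real.rpow_le_rpow (by positivity) hN2 (by linarith)
    have e4 : (B : ℝ) ^ (2 + δ) * (B : ℝ) ^ (-ω) ≤ (b : ℝ) ^ |2 + δ - ω| * x ^ (2 + δ - ω) := by
      rw [← Real.rpow_add hBpos]
      exact rpow_le_of_near hb1.le hBpos hL1 hL2.le
    have e5 : x ^ (2 + δ - ω) = ((k : ℝ) / n) ^ ((ω - 2 - δ) / (1 - β)) := by
      rw [hx, ← Real.rpow_mul (by positivity), ← inv_div (k : ℝ) n,
        Real.inv_rpow (by positivity), ← Real.rpow_neg (by positivity)]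
      congr 1
      field_simp
      ring
    calc ((t' + (B * N) ^ 2 : ℕ) : ℝ) ≤ (R : ℝ) ^ L * ((1 + 18 * (b : ℝ) ^ 2) * t₀) := by
          exact_mod_cast e1
      _ ≤ (B : ℝ) ^ (2 + δ) * ((1 + 18 * (b : ℝ) ^ 2) * (K₀ * (2 ^ ω * (n : ℝ) ^ ω *
          (B : ℝ) ^ (-ω)))) := by
        gcongr
        exact ht₀K.trans (by gcongr)
      _ = (1 + 18 * (b : ℝ) ^ 2) * K₀ * 2 ^ ω * (n : ℝ) ^ ω *
          ((B : ℝ) ^ (2 + δ) * (B : ℝ) ^ (-ω)) := by ring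
      _ ≤ (1 + 18 * (b : ℝ) ^ 2) * K₀ * 2 ^ ω * (n : ℝ) ^ ω *
          ((b : ℝ) ^ |2 + δ - ω| * x ^ (2 + δ - ω)) := by gcongr
      _ = _ := by rw [e5]; ring

/-! ### Matrix inversion -/

/-- Positive definite matrices with index set `I` can be inverted in `t` operations. -/
def InvBound (I : Type) [Fintype I] [DecidableEq I] (t : ℕ) : Prop :=
  ∀ (Ω : Type) (c : Ω → ℝ → ℝ) (V : Set (Ω → ℝ)) (X : Ω → Matrix I I ℝ),
    (fun _ => 0) ∈ V → (fun _ => 1) ∈ V → entries X ⊆ V → (∀ ω, (X ω).PosDef) →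
      Gen c V t (entries fun ω => (X ω)⁻¹)

section Blocks

open Matrix

set_option linter.unusedSectionVars false

variable {I J : Type} [Fintype I] [DecidableEq I] [Fintype J] [DecidableEq J]

/-- The Schur complement is the congruence of the whole matrix by the injective column with blocks
-A⁻¹B and 1. Restricting inversion to positive definite matrices thus makes the block recursion work
without pivoting. -/
theorem posDef_schur {A : Matrix I I ℝ} {B : Matrix I J ℝ} {D : Matrix J J ℝ}
    (h : (fromBlocks A B Bᵀ D).PosDef) : A.PosDef ∧ (D - Bᵀ * (A⁻¹ * B)).PosDef := by
  have hA : A.PosDef := h.submatrix (e := Sum.inl) Sum.inl_injective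
  have hAu : IsUnit A.det := (isUnit_iff_isUnit_det A).1 hA.isUnit
  have hAt : Aᵀ = A := by
    rw [← conjTranspose_eq_transpose_of_trivial]
    exact hA.isHermitian
  refine ⟨hA, ?_⟩
  have hinj : Function.Injective (fromRows (-(A⁻¹ * B)) (1 : Matrix J J ℝ)).mulVec := by
    intro x y hxy
    funext j
    have := congrFun hxy (Sum.inr j)
    simpa [fromRows_mulVec] using this
  have := h.conjTranspose_mul_mul_same hinj
  convert this using 1
  rw [conjTranspose_eq_transpose_of_trivial, transpose_fromRows, fromCols_mul_fromBlocks,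
    fromCols_mul_fromRows]
  simp only [transpose_neg, transpose_mul, transpose_nonsing_inv, hAt, transpose_one,
    Matrix.neg_mul, Matrix.mul_neg, Matrix.one_mul, Matrix.mul_one, Matrix.add_mul,
    nonsing_inv_mul_cancel_right _ _ hAu]
  simp [Matrix.mul_assoc]
  abel

theorem inv_fromBlocks_schur {A : Matrix I I ℝ} {B : Matrix I J ℝ} {D : Matrix J J ℝ}
    (hA : A.PosDef) (hS : (D - Bᵀ * (A⁻¹ * B)).PosDef) :
    (fromBlocks A B Bᵀ D)⁻¹ =
      fromBlocks (A⁻¹ + A⁻¹ * B * (D - Bᵀ * (A⁻¹ * B))⁻¹ * (A⁻¹ * B)ᵀ)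
        (-(A⁻¹ * B * (D - Bᵀ * (A⁻¹ * B))⁻¹)) (-(A⁻¹ * B * (D - Bᵀ * (A⁻¹ * B))⁻¹)ᵀ)
        (D - Bᵀ * (A⁻¹ * B))⁻¹ := by
  have hAu : IsUnit A.det := (isUnit_iff_isUnit_det A).1 hA.isUnit
  have hAt : Aᵀ = A := by
    rw [← conjTranspose_eq_transpose_of_trivial]
    exact hA.isHermitian
  set S := D - Bᵀ * (A⁻¹ * B) with hSdef
  have hSu : IsUnit S.det := (isUnit_iff_isUnit_det S).1 hS.isUnit
  have hSt : Sᵀ = S := by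
    rw [← conjTranspose_eq_transpose_of_trivial]
    exact hS.isHermitian
  have hD : D = S + Bᵀ * (A⁻¹ * B) := by rw [hSdef]; abel
  apply inv_eq_right_inv
  rw [fromBlocks_multiply, ← fromBlocks_one]
  simp only [transpose_mul, transpose_nonsing_inv, hAt, hSt]
  rw [hD]
  congr 1
  · simp only [Matrix.mul_add, Matrix.mul_neg, Matrix.mul_assoc, mul_nonsing_inv _ hAu,
      mul_nonsing_inv_cancel_left _ _ hAu]
    abel
  · simp only [Matrix.mul_neg, Matrix.mul_assoc, mul_nonsing_inv_cancel_left _ _ hAu]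
    abel
  · simp only [Matrix.mul_add, Matrix.add_mul, Matrix.mul_neg, Matrix.mul_assoc,
      mul_nonsing_inv_cancel_left _ _ hSu]
    abel
  · simp only [Matrix.add_mul, Matrix.mul_neg, Matrix.mul_assoc, mul_nonsing_inv _ hSu]
    abel

theorem posDef_fromBlocks_one {A : Matrix I I ℝ} (hA : A.PosDef) :
    (fromBlocks A 0 0 (1 : Matrix J J ℝ)).PosDef := by
  refine PosDef.of_dotProduct_mulVec_pos ?_ fun x hx => ?_
  · exact hA.isHermitian.fromBlocks (by simp) isHermitian_one
  · obtain ⟨a, b, rfl⟩ : ∃ a b, x = Sum.elim a b := ⟨x ∘ Sum.inl, x ∘ Sum.inr, by simp⟩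
    rw [fromBlocks_mulVec]
    have hs : star (Sum.elim a b) = Sum.elim (star a) (star b) := by
      ext i
      cases i <;> rfl
    simp only [hs, zero_mulVec, add_zero, zero_add, one_mulVec, Sum.elim_comp_inl,
      Sum.elim_comp_inr, sumElim_dotProduct_sumElim]
    by_cases ha : a = 0
    · subst ha
      have hb : b ≠ 0 := by
        rintro rfl
        exact hx (by ext i; cases i <;> rfl)
      simpa using dotProduct_star_self_pos_iff.2 hb
    · have h1 := hA.dotProduct_mulVec_pos ha
      have h2 : 0 ≤ star b ⬝ᵥ b := dotProduct_star_self_nonneg b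
      linarith

/-- An identity block is appended; positive definiteness and the original block of the inverse
survive. This rounds dimensions up to powers of two. -/
theorem InvBound.embed {I' : Type} [Fintype I'] [DecidableEq I'] {t : ℕ} (h : InvBound I' t)
    (e : I ⊕ J ≃ I') : InvBound I t := by
  intro Ω c V X h0 h1 hX hpos
  let X' : Ω → Matrix I' I' ℝ := fun ω =>
    (fromBlocks (X ω) 0 0 (1 : Matrix J J ℝ)).submatrix e.symm e.symm
  have hX' : entries X' ⊆ V := entries_subset fun i j => by
    simp only [X', submatrix_apply]
    rcases e.symm i with i | i <;> rcases e.symm j with j | j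
    · exact mem_entries hX i j
    · exact h0
    · exact h0
    · by_cases hij : i = j
      · simpa [hij] using h1
      · simpa [hij] using h0
  refine (h Ω c V X' h0 h1 hX' fun ω =>
    (posDef_fromBlocks_one (hpos ω)).submatrix e.symm.injective).mono_right
      (entries_subset fun i j => ⟨(e (Sum.inl i), e (Sum.inl j)), ?_⟩)
  funext ω
  simp only [X']
  rw [inv_submatrix_equiv, inv_fromBlocks_zero₂₁_of_isUnit_iff _ _ _
    ⟨fun _ => isUnit_one, fun _ => (hpos ω).isUnit⟩]
  simp

theorem InvBound.unit : InvBound (Fin 1) 2 := by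
  intro Ω c V X h0 h1 hX hpos
  have hd := Gen.matrix (X := fun ω => of fun i j => 1 / X ω i j) fun i j =>
    (Gen.lit (c := c) (V := V) 1).div (Gen.mem (mem_entries hX i j))
  refine (hd.weaken (by simp)).mono_right (entries_subset fun i j => ⟨(i, j), ?_⟩)
  funext ω
  simp [Subsingleton.elim i 0, Subsingleton.elim j 0]

/-- Two inversions (A and the Schur complement S), four products (P = A⁻¹B, BᵀP, Q = PS⁻¹, QPᵀ) and
three entrywise operations. By symmetry the lower left block of the inverse is a transpose and costs
nothing. -/
theorem InvBound.double {s t : ℕ} (h : InvBound I t) (hm : MulBound I I I s) :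
    InvBound (I ⊕ I) (2 * t + 4 * s + 3 * (Fintype.card I * Fintype.card I)) := by
  intro Ω c V X h0 h1 hX hpos
  let A : Ω → Matrix I I ℝ := fun ω => (X ω).toBlocks₁₁
  let B : Ω → Matrix I I ℝ := fun ω => (X ω).toBlocks₁₂
  let D : Ω → Matrix I I ℝ := fun ω => (X ω).toBlocks₂₂
  have hXe : ∀ ω, X ω = fromBlocks (A ω) (B ω) (B ω)ᵀ (D ω) := fun ω => by
    have : (B ω)ᵀ = (X ω).toBlocks₂₁ := by
      ext i j
      have := (hpos ω).isHermitian.apply (Sum.inr i) (Sum.inl j)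
      simpa [B, toBlocks₁₂, toBlocks₂₁] using this
    rw [this]
    exact (fromBlocks_toBlocks (X ω)).symm
  have hA : entries A ⊆ V := entries_subset fun i j => mem_entries hX (.inl i) (.inl j)
  have hB : entries B ⊆ V := entries_subset fun i j => mem_entries hX (.inl i) (.inr j)
  have hD : entries D ⊆ V := entries_subset fun i j => mem_entries hX (.inr i) (.inr j)
  have hBt : entries (fun ω => (B ω)ᵀ) ⊆ V := entries_subset fun i j => mem_entries hB j i
  let P : Ω → Matrix I I ℝ := fun ω => (A ω)⁻¹ * B ω
  let S : Ω → Matrix I I ℝ := fun ω => D ω - (B ω)ᵀ * P ω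
  let Q : Ω → Matrix I I ℝ := fun ω => P ω * (S ω)⁻¹
  have hps : ∀ ω, (A ω).PosDef ∧ (S ω).PosDef := fun ω => posDef_schur (hXe ω ▸ hpos ω)
  let V₁ := V ∪ entries fun ω => (A ω)⁻¹
  let V₂ := V₁ ∪ entries P
  let V₃ := V₂ ∪ entries fun ω => (B ω)ᵀ * P ω
  let V₄ := V₃ ∪ entries S
  let V₅ := V₄ ∪ entries fun ω => (S ω)⁻¹
  let V₆ := V₅ ∪ entries Q
  let V₇ := V₆ ∪ entries fun ω => Q ω * (P ω)ᵀ
  let V₈ := V₇ ∪ entries fun ω => (A ω)⁻¹ + Q ω * (P ω)ᵀ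
  let V₉ := V₈ ∪ entries fun ω => -Q ω
  have l₁ : V ⊆ V₁ := Set.subset_union_left
  have l₂ : V₁ ⊆ V₂ := Set.subset_union_left
  have l₃ : V₂ ⊆ V₃ := Set.subset_union_left
  have l₄ : V₃ ⊆ V₄ := Set.subset_union_left
  have l₅ : V₄ ⊆ V₅ := Set.subset_union_left
  have l₆ : V₅ ⊆ V₆ := Set.subset_union_left
  have l₇ : V₆ ⊆ V₇ := Set.subset_union_left
  have l₈ : V₇ ⊆ V₈ := Set.subset_union_left
  have l₉ : V₈ ⊆ V₉ := Set.subset_union_left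
  have l₁₃ := l₁.trans (l₂.trans l₃)
  have l₁₅ := l₁₃.trans (l₄.trans l₅)
  have mP : entries P ⊆ V₂ := Set.subset_union_right
  have mS : entries (fun ω => (S ω)⁻¹) ⊆ V₅ := Set.subset_union_right
  have mQ : entries Q ⊆ V₆ := Set.subset_union_right
  have mA : entries (fun ω => (A ω)⁻¹) ⊆ V₁ := Set.subset_union_right
  have l₂₅ := l₃.trans (l₄.trans l₅)
  have l₂₆ := l₂₅.trans l₆
  have g₁ : Gen c V t _ := h Ω c V A h0 h1 hA fun ω => (hps ω).1
  have g₂ : Gen c V₁ s (entries P) := hm Ω c V₁ _ B (l₁ h0) mA (hB.trans l₁)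
  have g₃ : Gen c V₂ s _ := hm Ω c V₂ (fun ω => (B ω)ᵀ) P (l₂ (l₁ h0)) (hBt.trans (l₁.trans l₂)) mP
  have g₄ : Gen c V₃ _ (entries S) := Gen.matrix fun i j =>
    (Gen.mem (l₁₃ (mem_entries hD i j))).sub (Gen.mem (mem_entries Set.subset_union_right i j))
  have g₅ : Gen c V₄ t _ := h Ω c V₄ S (l₄ (l₁₃ h0)) (l₄ (l₁₃ h1)) Set.subset_union_right
    fun ω => (hps ω).2
  have g₆ : Gen c V₅ s (entries Q) := hm Ω c V₅ P _ (l₁₅ h0) (mP.trans l₂₅) mS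
  have g₇ : Gen c V₆ s _ := hm Ω c V₆ Q (fun ω => (P ω)ᵀ) (l₆ (l₁₅ h0)) mQ
    (entries_subset fun i j => mem_entries (mP.trans l₂₆) j i)
  have g₈ : Gen c V₇ _ (entries fun ω => (A ω)⁻¹ + Q ω * (P ω)ᵀ) := Gen.matrix fun i j =>
    (Gen.mem (mem_entries (mA.trans (l₂.trans (l₂₆.trans l₇))) i j)).add
      (Gen.mem (mem_entries Set.subset_union_right i j))
  have g₉ : Gen c V₈ (Fintype.card I * Fintype.card I * 1) (entries fun ω => -Q ω) := by
    refine Gen.matrix (t := 1) fun i j => ?_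
    have := (Gen.mem (c := c) (l₈ (l₇ (l₆ (l₁₅ h0))))).sub
      (Gen.mem (c := c) (mem_entries (mQ.trans (l₇.trans l₈)) i j))
    simpa using this
  have g : Gen c V₉ 0 (entries fun ω => (X ω)⁻¹) := .done (entries_subset fun i j => by
    have hi : ∀ ω, (X ω)⁻¹ = fromBlocks ((A ω)⁻¹ + Q ω * (P ω)ᵀ) (-Q ω) (-Q ω)ᵀ (S ω)⁻¹ := fun ω => by
      rw [hXe, inv_fromBlocks_schur (hps ω).1 (hps ω).2, transpose_neg]
    simp only [hi]
    rcases i with i | i <;> rcases j with j | j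
    · exact l₉ (Or.inr ⟨(i, j), rfl⟩)
    · exact Or.inr ⟨(i, j), rfl⟩
    · exact Or.inr ⟨(j, i), rfl⟩
    · exact l₉ (l₈ (l₇ (l₆ (mem_entries mS i j)))))
  refine (g₁.trans (g₂.trans (g₃.trans (g₄.trans (g₅.trans (g₆.trans (g₇.trans (g₈.trans
    (g₉.trans g))))))))).weaken ?_
  omega

/-- Inversion of arbitrary nonsingular matrices by `X⁻¹ = (Xᵀ X)⁻¹ Xᵀ`. -/
theorem InvBound.gen_inv {s t : ℕ} (h : InvBound I t) (hm : MulBound I I I s) {Ω : Type}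
    {c : Ω → ℝ → ℝ} {V : Set (Ω → ℝ)} {X : Ω → Matrix I I ℝ} (h0 : (fun _ => 0) ∈ V)
    (h1 : (fun _ => 1) ∈ V) (hX : entries X ⊆ V) (hu : ∀ ω, IsUnit (X ω)) :
    Gen c V (2 * s + t) (entries fun ω => (X ω)⁻¹) := by
  have hXt : entries (fun ω => (X ω)ᵀ) ⊆ V := entries_subset fun i j => mem_entries hX j i
  have g₁ := hm Ω c V _ X h0 hXt hX
  have g₂ := h Ω c _ (fun ω => (X ω)ᵀ * X ω) (Or.inl h0) (Or.inl h1) Set.subset_union_right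
    fun ω => by
      rw [← conjTranspose_eq_transpose_of_trivial]
      exact PosDef.conjTranspose_mul_self _ (mulVec_injective_iff_isUnit.2 (hu ω))
  have g₃ := hm Ω c ((V ∪ entries fun ω => (X ω)ᵀ * X ω) ∪ entries fun ω => ((X ω)ᵀ * X ω)⁻¹)
    (fun ω => ((X ω)ᵀ * X ω)⁻¹) (fun ω => (X ω)ᵀ) (Or.inl (Or.inl h0))
    Set.subset_union_right (hXt.trans (Set.subset_union_left.trans Set.subset_union_left))
  refine ((g₁.trans (g₂.trans g₃)).weaken (by omega)).mono_right (entries_subset fun i j =>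
    ⟨(i, j), ?_⟩)
  funext ω
  have hdet := (isUnit_iff_isUnit_det (X ω)).1 (hu ω)
  simp only
  rw [Matrix.mul_inv_rev, Matrix.mul_assoc, nonsing_inv_mul (X ω)ᵀ (by rwa [det_transpose]),
    Matrix.mul_one]

end Blocks

/-- The constant 4K is stable under doubling: 2 · 4K + 4K + 3 ≤ 15K ≤ 4K · 2^ω, because ω ≥ 2 and K
≥ 1. Other dimensions are padded to the next power of two. -/
theorem IsMatMulExponent.exists_inv_bound {ω : ℝ} (hω : IsMatMulExponent ω) :
    ∃ K : ℝ, 0 ≤ K ∧ ∀ n : ℕ, 1 ≤ n → ∃ t : ℕ, InvBound (Fin n) t ∧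
      (t : ℝ) ≤ K * (n : ℝ) ^ ω := by
  obtain ⟨K, hK, hmul⟩ := hω.exists_bound
  have hω2 := hω.two_le
  have hpow : ∀ L : ℕ, ∃ t : ℕ, InvBound (Fin (2 ^ L)) t ∧ (t : ℝ) ≤ 4 * K * ((2 : ℝ) ^ L) ^ ω := by
    intro L
    induction L with
    | zero => exact ⟨2, InvBound.unit, by simp; linarith⟩
    | succ L ih =>
      obtain ⟨t, ht, htK⟩ := ih
      obtain ⟨s, hs, hs2, hsK⟩ := hmul (2 ^ L) Nat.one_le_two_pow
      have e : (Fin (2 ^ (L + 1)) ⊕ Fin 0) ≃ Fin (2 ^ L) ⊕ Fin (2 ^ L) :=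
        (Equiv.sumEmpty _ _).trans ((finCongr (by ring)).trans finSumFinEquiv.symm)
      refine ⟨_, (ht.double hs).embed e, ?_⟩
      simp only [Fintype.card_fin]
      have h4 : (4 : ℝ) ≤ 2 ^ ω := by
        calc (4 : ℝ) = 2 ^ (2 : ℝ) := by norm_num
          _ ≤ _ := Real.rpow_le_rpow_of_exponent_le (by norm_num) hω2
      have hs2' : ((2 : ℝ) ^ L * 2 ^ L) ≤ s := by
        rw [← sq]
        exact_mod_cast hs2
      push_cast at hsK ⊢
      rw [pow_succ, Real.mul_rpow (by positivity) (by positivity)]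
      set z : ℝ := ((2 : ℝ) ^ L) ^ ω
      have hz : 0 ≤ z := by positivity
      have h5 : K * z * 4 ≤ K * z * 2 ^ ω := by gcongr
      have h6 : 0 ≤ K * z := by positivity
      nlinarith
  refine ⟨4 * K * 2 ^ ω, by positivity, fun n hn => ?_⟩
  obtain ⟨L, hL1, hL2⟩ := exists_nat_pow_near hn one_lt_two
  obtain ⟨t, ht, htK⟩ := hpow (L + 1)
  have e : Fin n ⊕ Fin (2 ^ (L + 1) - n) ≃ Fin (2 ^ (L + 1)) :=
    finSumFinEquiv.trans (finCongr (by omega))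
  refine ⟨t, ht.embed e, htK.trans ?_⟩
  rw [mul_assoc (4 * K), ← Real.mul_rpow (by norm_num) (by positivity)]
  have hL1' : (2 : ℝ) ^ L ≤ n := by exact_mod_cast hL1
  gcongr
  rw [pow_succ']
  linarith

/-! ### Compilation into programs -/

/-- Prefixing a program with `F` costs `t` and changes the memory by `e`. -/
def IsStraight {ρ : Type} (F : Prog ρ → Prog ρ) (e : (ℝ → ℝ) → (ρ → ℝ) → ρ → ℝ) (t : ℕ) : Prop :=
  ∀ f σ P, (F P).run f σ = P.run f (e f σ) ∧ (F P).cost f σ = P.cost f (e f σ) + t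

section Straight

variable {ρ : Type}

theorem IsStraight.id : IsStraight (fun P : Prog ρ => P) (fun _ σ => σ) 0 :=
  fun _ _ _ => ⟨rfl, rfl⟩

theorem IsStraight.comp {F F' : Prog ρ → Prog ρ} {e e' : (ℝ → ℝ) → (ρ → ℝ) → ρ → ℝ} {t t' : ℕ}
    (h : IsStraight F e t) (h' : IsStraight F' e' t') :
    IsStraight (fun P => F (F' P)) (fun f σ => e' f (e f σ)) (t + t') := fun f σ P => by
  rw [(h f σ _).1, (h f σ _).2, (h' f _ _).1, (h' f _ _).2]
  exact ⟨rfl, by beta_reduce; omega⟩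

theorem IsStraight.const (z : ρ) (r : ℝ) :
    IsStraight (Prog.const z r) (fun _ σ => writeReg σ z r) 1 := fun _ _ _ => ⟨rfl, rfl⟩

theorem IsStraight.arith (o : ArithOp) (z x y : ρ) :
    IsStraight (Prog.arith o z x y) (fun _ σ => writeReg σ z (o.eval (σ x) (σ y))) 1 :=
  fun _ _ _ => ⟨rfl, rfl⟩

theorem IsStraight.sqrt (z x : ρ) :
    IsStraight (Prog.sqrt z x) (fun _ σ => writeReg σ z (Real.sqrt (σ x))) 1 :=
  fun _ _ _ => ⟨rfl, rfl⟩

theorem IsStraight.call (z x : ρ) :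
    IsStraight (Prog.call z x) (fun f σ => writeReg σ z (f (σ x))) 1 := fun _ _ _ => ⟨rfl, rfl⟩

theorem writeReg_same (σ : ρ → ℝ) (z : ρ) (r : ℝ) : writeReg σ z r z = r := if_pos rfl

theorem writeReg_ne (σ : ρ → ℝ) {z x : ρ} (r : ℝ) (h : x ≠ z) : writeReg σ z r x = σ x := if_neg h

/-- There is no move instruction, so a copy is a zero followed by an addition; hence the factor 2.
-/
theorem exists_copy {κ : Type} (dst src : κ → ρ) (hd : Function.Injective dst)
    (hne : ∀ i j, dst i ≠ src j) (l : List κ) :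
    ∃ F e, IsStraight F e (2 * l.length) ∧ ∀ f σ, (∀ i ∈ l, e f σ (dst i) = σ (src i)) ∧
      ∀ x, (∀ i ∈ l, x ≠ dst i) → e f σ x = σ x := by
  induction l with
  | nil => exact ⟨_, _, .id, by simp⟩
  | cons a l ih =>
    obtain ⟨F, e, hF, he⟩ := ih
    have h1 := (IsStraight.const (dst a) 0).comp
      ((IsStraight.arith .add (dst a) (dst a) (src a)).comp hF)
    refine ⟨_, _, by convert h1 using 1; simp only [List.length_cons]; ring, fun f σ => ?_⟩
    have h2 : writeReg (writeReg σ (dst a) 0) (dst a) (ArithOp.add.eval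
        (writeReg σ (dst a) 0 (dst a)) (writeReg σ (dst a) 0 (src a))) =
        writeReg σ (dst a) (σ (src a)) := by
      funext x
      by_cases hx : x = dst a
      · subst hx
        simp [writeReg_same, writeReg_ne _ _ (hne a a).symm, ArithOp.eval]
      · simp [writeReg_ne _ _ hx]
    simp only [h2]
    obtain ⟨h3, h4⟩ := he f (writeReg σ (dst a) (σ (src a)))
    refine ⟨fun i hi => ?_, fun x hx => ?_⟩
    · by_cases hil : i ∈ l
      · rw [h3 i hil, writeReg_ne _ _ (hne a i).symm]
      · obtain rfl : i = a := (List.mem_cons.1 hi).resolve_right hil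
        rw [h4 _ fun j hj h => hil (by rw [hd h]; exact hj), writeReg_same]
    · rw [h4 x fun i hi => hx i (List.mem_cons_of_mem _ hi),
        writeReg_ne _ _ (hx a List.mem_cons_self)]

/-- The functions in `W` can be computed from those in `V` by a program prefix, with scratch
registers `tmp l`. -/
def Compiles {Ω : Type} (c : Ω → ℝ → ℝ) (tmp : ℕ → ρ) (V : Set (Ω → ℝ)) (t : ℕ)
    (W : Set (Ω → ℝ)) : Prop :=
  ∀ (mem : Ω → ρ → ℝ) (n₀ : ℕ), (∀ g ∈ V, ∃ x, (∀ l ≥ n₀, x ≠ tmp l) ∧ ∀ ω, mem ω x = g ω) →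
    ∃ F e s, ∃ n₁ ≥ n₀, s ≤ t ∧ IsStraight F e s ∧
      (∀ g ∈ W, ∃ x, (∀ l ≥ n₁, x ≠ tmp l) ∧ ∀ ω, e (c ω) (mem ω) x = g ω) ∧
      ∀ ω x, (∀ l ≥ n₀, x ≠ tmp l) → e (c ω) (mem ω) x = mem ω x

/-- The new value goes into the first unused scratch register, so neither earlier values nor the
registers outside the scratch space are disturbed. The prefix is the same for all `ω`; only the
memory varies. -/
theorem Compiles.step {Ω : Type} {c : Ω → ℝ → ℝ} {tmp : ℕ → ρ} (htmp : Function.Injective tmp)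
    {V W : Set (Ω → ℝ)} {t : ℕ} {g : Ω → ℝ} (ih : Compiles c tmp (insert g V) t W)
    (h : ∀ (mem : Ω → ρ → ℝ) (z : ρ), (∀ g ∈ V, ∃ x, ∀ ω, mem ω x = g ω) →
      ∃ F e, IsStraight F e 1 ∧ ∀ ω, e (c ω) (mem ω) = writeReg (mem ω) z (g ω)) :
    Compiles c tmp V (t + 1) W := by
  intro mem n₀ hV
  obtain ⟨F₀, e₀, hF₀, he₀⟩ := h mem (tmp n₀) fun g hg => (hV g hg).imp fun x hx => hx.2
  obtain ⟨F, e, s, n₁, hn, hs, hF, hW, hfr⟩ := ih (fun ω => e₀ (c ω) (mem ω)) (n₀ + 1) (by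
    rintro g' (hg' | hg')
    · refine ⟨tmp n₀, fun l hl h => ?_, fun ω => by rw [he₀, writeReg_same, hg']⟩
      have := htmp h
      omega
    · obtain ⟨x, hx, hm⟩ := hV g' hg'
      exact ⟨x, fun l hl => hx l (by omega), fun ω => by
        rw [he₀, writeReg_ne _ _ (hx n₀ le_rfl), hm]⟩)
  refine ⟨_, _, _, n₁, by omega, by omega, hF₀.comp hF, hW, fun ω x hx => ?_⟩
  rw [hfr ω x fun l hl => hx l (by omega), he₀, writeReg_ne _ _ (hx n₀ le_rfl)]

theorem Gen.compile {Ω : Type} {c : Ω → ℝ → ℝ} {V W : Set (Ω → ℝ)} {t : ℕ} (H : Gen c V t W)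
    {tmp : ℕ → ρ} (htmp : Function.Injective tmp) : Compiles c tmp V t W := by
  induction H with
  | done hW =>
    exact fun mem n₀ hV => ⟨_, _, 0, n₀, le_rfl, Nat.zero_le _, .id, fun g hg => hV g (hW hg),
      fun _ _ _ => rfl⟩
  | const r _ ih => exact ih.step htmp fun mem z _ => ⟨_, _, .const z r, fun _ => rfl⟩
  | arith o hg hh _ ih =>
    refine ih.step htmp fun mem z hV => ?_
    obtain ⟨x, hx⟩ := hV _ hg
    obtain ⟨y, hy⟩ := hV _ hh
    exact ⟨_, _, .arith o z x y, fun ω => by rw [hx, hy]⟩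
  | sqrt hg _ ih =>
    refine ih.step htmp fun mem z hV => ?_
    obtain ⟨x, hx⟩ := hV _ hg
    exact ⟨_, _, .sqrt z x, fun ω => by rw [hx]⟩
  | call hg _ ih =>
    refine ih.step htmp fun mem z hV => ?_
    obtain ⟨x, hx⟩ := hV _ hg
    exact ⟨_, _, .call z x, fun ω => by rw [hx]⟩

theorem Gen.exists_straight {Ω κ : Type} [Fintype κ] {c : Ω → ℝ → ℝ} {V W : Set (Ω → ℝ)} {t : ℕ}
    (H : Gen c V t W) {tmp : ℕ → ρ} (htmp : Function.Injective tmp) (mem : Ω → ρ → ℝ)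
    (hV : ∀ g ∈ V, ∃ x, (∀ l, x ≠ tmp l) ∧ ∀ ω, mem ω x = g ω) (dst : κ → ρ)
    (hdst : Function.Injective dst) (hdt : ∀ i l, dst i ≠ tmp l) (out : κ → Ω → ℝ)
    (hout : ∀ i, out i ∈ W) :
    ∃ F e s, s ≤ t + 4 * Fintype.card κ ∧ IsStraight F e s ∧ ∀ ω,
      (∀ i, e (c ω) (mem ω) (dst i) = out i ω) ∧
      ∀ x, (∀ i, x ≠ dst i) → (∀ l, x ≠ tmp l) → e (c ω) (mem ω) x = mem ω x := by
  obtain ⟨F, e, s, n₁, -, hs, hF, hW, hfr⟩ := H.compile htmp mem 0 fun g hg => by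
    obtain ⟨x, hx, h⟩ := hV g hg
    exact ⟨x, fun l _ => hx l, h⟩
  choose src hsrc hsrc' using fun i => hW (out i) (hout i)
  -- A target register may itself hold a value still to be copied elsewhere, so all results are
  -- first copied into fresh scratch registers; two copies of two instructions give the `4 *
  -- Fintype.card κ`.
  let mid : κ → ρ := fun i => tmp (n₁ + Fintype.equivFin κ i)
  have hmid : Function.Injective mid := by
    intro i j h
    have := htmp h
    exact (Fintype.equivFin κ).injective (Fin.ext (by omega))
  obtain ⟨F₁, e₁, hF₁, h₁⟩ := exists_copy mid src hmid
    (fun i j h => hsrc j _ (Nat.le_add_right _ _) h.symm) Finset.univ.toList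
  obtain ⟨F₂, e₂, hF₂, h₂⟩ := exists_copy dst mid hdst (fun i j => hdt i _) Finset.univ.toList
  rw [Finset.length_toList, Finset.card_univ] at hF₁ hF₂
  refine ⟨_, _, _, ?_, hF.comp (hF₁.comp hF₂), fun ω => ⟨fun i => ?_, fun x hx hxt => ?_⟩⟩
  · omega
  · rw [(h₂ _ _).1 i (by simp), (h₁ _ _).1 i (by simp), hsrc']
  · rw [(h₂ _ _).2 x fun i _ => hx i, (h₁ _ _).2 x fun i _ => hxt _, hfr ω x fun l _ => hxt l]

end Straight

/-- The registers written by `Initialize` and `Update`. -/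
def outReg {n d : ℕ} : (Fin n × Fin n) ⊕ (Fin 5 × Fin n) → DSReg n d
  | .inl (i, j) => .M i j
  | .inr (0, i) => .ut i
  | .inr (1, i) => .vt i
  | .inr (2, i) => .w i
  | .inr (3, i) => .fv i
  | .inr (4, i) => .r i

theorem outReg_injective {n d : ℕ} : Function.Injective (outReg (n := n) (d := d)) := by
  rintro (⟨i, j⟩ | ⟨k, i⟩) (⟨i', j'⟩ | ⟨k', i'⟩) h
  · simpa [outReg] using h
  · fin_cases k' <;> simp [outReg] at h
  · fin_cases k <;> simp [outReg] at h
  · fin_cases k <;> fin_cases k' <;> simp_all [outReg]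

/-- The contents of the registers other than the scratch registers. -/
def regReads {n d : ℕ} {Ω : Type} (mem : Ω → DSReg n d → ℝ) : Set (Ω → ℝ) :=
  {g | ∃ x : DSReg n d, (∀ l, x ≠ .tmp l) ∧ ∀ ω, mem ω x = g ω}

theorem mem_regReads {n d : ℕ} {Ω : Type} (mem : Ω → DSReg n d → ℝ) {x : DSReg n d}
    (hx : ∀ l, x ≠ .tmp l) : (fun ω => mem ω x) ∈ regReads mem := ⟨x, hx, fun _ => rfl⟩

theorem Gen.exists_store {n d : ℕ} {Ω : Type} {c : Ω → ℝ → ℝ} {W : Set (Ω → ℝ)} {t : ℕ}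
    {mem : Ω → DSReg n d → ℝ} (H : Gen c (regReads mem) t W) (M : Ω → Matrix (Fin n) (Fin n) ℝ)
    (ut vt w fv r : Ω → Fin n → ℝ) (hM : entries M ⊆ W) (hut : ∀ i, (fun ω => ut ω i) ∈ W)
    (hvt : ∀ i, (fun ω => vt ω i) ∈ W) (hw : ∀ i, (fun ω => w ω i) ∈ W)
    (hfv : ∀ i, (fun ω => fv ω i) ∈ W) (hr : ∀ i, (fun ω => r ω i) ∈ W) :
    ∃ F e s, s ≤ t + 4 * (n * n + 5 * n) ∧ IsStraight F e s ∧ ∀ ω,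
      (∀ i j, e (c ω) (mem ω) (.M i j) = M ω i j) ∧
      (∀ i, e (c ω) (mem ω) (.ut i) = ut ω i) ∧ (∀ i, e (c ω) (mem ω) (.vt i) = vt ω i) ∧
      (∀ i, e (c ω) (mem ω) (.w i) = w ω i) ∧ (∀ i, e (c ω) (mem ω) (.fv i) = fv ω i) ∧
      (∀ i, e (c ω) (mem ω) (.r i) = r ω i) ∧
      (∀ i j, e (c ω) (mem ω) (.A i j) = mem ω (.A i j)) ∧
      e (c ω) (mem ω) .eps = mem ω .eps := by
  let out : (Fin n × Fin n) ⊕ (Fin 5 × Fin n) → Ω → ℝ := fun x ω => match x with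
    | .inl (i, j) => M ω i j
    | .inr (0, i) => ut ω i
    | .inr (1, i) => vt ω i
    | .inr (2, i) => w ω i
    | .inr (3, i) => fv ω i
    | .inr (4, i) => r ω i
  obtain ⟨F, e, s, hs, hF, h⟩ := H.exists_straight (tmp := DSReg.tmp)
    (fun _ _ h => DSReg.tmp.inj h) mem (fun g hg => hg) outReg outReg_injective
    (by
      rintro (⟨i, j⟩ | ⟨k, i⟩) l
      · simp [outReg]
      · fin_cases k <;> simp [outReg]) out (by
      rintro (⟨i, j⟩ | ⟨k, i⟩)
      · exact mem_entries hM i j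
      · fin_cases k
        · exact hut i
        · exact hvt i
        · exact hw i
        · exact hfv i
        · exact hr i)
  refine ⟨F, e, s, by simpa using hs, hF, fun ω => ⟨fun i j => (h ω).1 (.inl (i, j)),
    fun i => (h ω).1 (.inr (0, i)), fun i => (h ω).1 (.inr (1, i)),
    fun i => (h ω).1 (.inr (2, i)), fun i => (h ω).1 (.inr (3, i)),
    fun i => (h ω).1 (.inr (4, i)), fun i j => (h ω).2 _ ?_ (by simp), (h ω).2 _ ?_ (by simp)⟩⟩
  · rintro (⟨i', j'⟩ | ⟨k, i'⟩)
    · simp [outReg]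
    · fin_cases k <;> simp [outReg]
  · rintro (⟨i', j'⟩ | ⟨k, i'⟩)
    · simp [outReg]
    · fin_cases k <;> simp [outReg]

/-! ### Initialization -/

open Matrix in
-- Full rank means independent rows, so this is a congruence of a positive diagonal matrix by an
-- injective map.
theorem posDef_gram {n d : ℕ} {A : Matrix (Fin d) (Fin n) ℝ} (hA : A.rank = d) {u : Fin n → ℝ}
    (hu : ∀ i, 0 < u i) : (A * diagonal u * Aᵀ).PosDef := by
  rw [← conjTranspose_eq_transpose_of_trivial]
  refine (PosDef.diagonal hu).mul_mul_conjTranspose_same ?_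
  rw [vecMul_injective_iff]
  rw [linearIndependent_iff_card_eq_finrank_span, Fintype.card_fin]
  exact hA.symm.trans (rank_eq_finrank_span_row A)

/-- The dimension n is cut into at most 2n/d pieces of length d, which leaves O((n/d)²) square
products of size d. -/
theorem IsMatMulExponent.exists_thin_bound {ω : ℝ} (hω : IsMatMulExponent ω) :
    ∃ K : ℝ, 0 ≤ K ∧ ∀ n d : ℕ, 1 ≤ d → d ≤ n → ∃ t : ℕ,
      MulBound (Fin d) (Fin n) (Fin d) t ∧ MulBound (Fin n) (Fin d) (Fin d) t ∧
      MulBound (Fin n) (Fin d) (Fin n) t ∧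
      (t : ℝ) ≤ K * ((n : ℝ) ^ 2 * (d : ℝ) ^ (ω - 2)) := by
  obtain ⟨K, hK, hmul⟩ := hω.exists_bound
  refine ⟨8 * K, by positivity, fun n d hd hdn => ?_⟩
  obtain ⟨t, ht, hdt, htK⟩ := hmul d hd
  set q := n / d + 1 with hq
  have hnq : n ≤ q * d := by
    have := Nat.lt_mul_div_succ n hd
    rw [hq, mul_comm]
    omega
  have e : Fin n ↪ Fin q × Fin d := (Fin.castLEEmb hnq).trans finProdFinEquiv.symm.toEmbedding
  have hq1 : 1 ≤ q := Nat.succ_pos _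
  have hdpos : (0 : ℝ) < d := by exact_mod_cast hd
  have hqn : (q : ℝ) ≤ 2 * (n / d) := by
    have h1 : (1 : ℝ) ≤ n / d := (one_le_div hdpos).2 (by exact_mod_cast hdn)
    have h2 : ((n / d : ℕ) : ℝ) ≤ (n : ℝ) / d := Nat.cast_div_le
    rw [hq]
    push_cast
    linarith
  have hqq : q * t ≤ q * (q * t) := Nat.mul_le_mul_left _ (Nat.le_mul_of_pos_left _ hq1)
  -- The factor 2 pays for the additions when the inner dimension is the one that is cut, by `d ^ 2
  -- ≤ t`.
  refine ⟨2 * (q * (q * t)), ?_, ?_, ?_, ?_⟩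
  · refine ((ht.blocks_mid (Q := Fin q)).embed (Function.Embedding.refl _) e
      (Function.Embedding.refl _)).mono ?_
    simp only [Fintype.card_fin]
    nlinarith
  · refine ((ht.blocks_left (Q := Fin q)).embed e (Function.Embedding.refl _)
      (Function.Embedding.refl _)).mono ?_
    simp only [Fintype.card_fin]
    nlinarith
  · refine ((ht.blocks_right (Q := Fin q)).blocks_left (Q := Fin q) |>.embed e
      (Function.Embedding.refl _) e).mono ?_
    simp only [Fintype.card_fin]
    omega
  · push_cast
    calc 2 * ((q : ℝ) * (q * t)) ≤ 2 * ((2 * (n / d)) * ((2 * (n / d)) * (K * (d : ℝ) ^ ω))) := by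
          gcongr
      _ = 8 * K * ((n : ℝ) ^ 2 * ((d : ℝ) ^ ω / (d : ℝ) ^ 2)) := by
          field_simp
          ring
      _ = _ := by
          rw [Real.rpow_sub hdpos, Real.rpow_two]

/-- The inputs on which `Initialize` has to work. -/
def InitInput (n d : ℕ) : Type :=
  {p : (ℝ → ℝ) × (DSReg n d → ℝ) //
    (Matrix.of fun i j => p.2 (.A i j) : Matrix (Fin d) (Fin n) ℝ).rank = d ∧ ∀ i, 0 < p.2 (.un i)}

open Matrix in
theorem gen_init {n d t s : ℕ} (h₁ : MulBound (Fin d) (Fin n) (Fin d) t)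
    (h₂ : MulBound (Fin n) (Fin d) (Fin d) t) (h₃ : MulBound (Fin n) (Fin d) (Fin n) t)
    (hi : InvBound (Fin d) s) :
    ∃ W, Gen (fun p : InitInput n d => p.1.1) (regReads fun p : InitInput n d => p.1.2)
        (3 * t + s + d * n + 2 * n * n + 3 * n + 2) W ∧
      regReads (fun p : InitInput n d => p.1.2) ⊆ W ∧
      (entries fun p : InitInput n d => projCore (of fun i j => p.1.2 (.A i j))
        fun i => p.1.2 (.un i)) ⊆ W ∧
      ∀ i, (fun p : InitInput n d => (projCore (of fun i j => p.1.2 (.A i j))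
        fun i => p.1.2 (.un i)).mulVec (sqrtMul p.1.1 (fun i => p.1.2 (.un i))
          fun i => p.1.2 (.vn i)) i) ∈ W := by
  let A : InitInput n d → Matrix (Fin d) (Fin n) ℝ := fun p => of fun i j => p.1.2 (.A i j)
  let u : InitInput n d → Fin n → ℝ := fun p i => p.1.2 (.un i)
  let v : InitInput n d → Fin n → ℝ := fun p i => p.1.2 (.vn i)
  let c : InitInput n d → ℝ → ℝ := fun p => p.1.1
  let V := regReads fun p : InitInput n d => p.1.2
  have hA : entries A ⊆ V := entries_subset fun i j => mem_regReads _ (x := .A i j) (by simp)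
  have hu : ∀ i, (fun p => u p i) ∈ V := fun i => mem_regReads _ (x := .un i) (by simp)
  have hv : ∀ i, (fun p => v p i) ∈ V := fun i => mem_regReads _ (x := .vn i) (by simp)
  let V₀ := V ∪ ({fun _ => 0} ∪ {fun _ => 1})
  let V₁ := V₀ ∪ entries fun p => A p * diagonal (u p)
  let V₂ := V₁ ∪ entries fun p => A p * diagonal (u p) * (A p)ᵀ
  let V₃ := V₂ ∪ entries fun p => (A p * diagonal (u p) * (A p)ᵀ)⁻¹
  let V₄ := V₃ ∪ entries fun p => (A p)ᵀ * (A p * diagonal (u p) * (A p)ᵀ)⁻¹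
  let V₅ := V₄ ∪ entries fun p => projCore (A p) (u p)
  let V₆ := V₅ ∪ Set.range fun i => fun p => sqrtMul (c p) (u p) (v p) i
  have l₀ : V ⊆ V₀ := Set.subset_union_left
  have l₁ : V₀ ⊆ V₁ := Set.subset_union_left
  have l₂ : V₁ ⊆ V₂ := Set.subset_union_left
  have l₃ : V₂ ⊆ V₃ := Set.subset_union_left
  have l₄ : V₃ ⊆ V₄ := Set.subset_union_left
  have l₅ : V₄ ⊆ V₅ := Set.subset_union_left
  have l₆ : V₅ ⊆ V₆ := Set.subset_union_left
  have l₀₃ := l₁.trans (l₂.trans l₃)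
  have l₀₅ := l₀₃.trans (l₄.trans l₅)
  have h0 : (fun _ => 0) ∈ V₀ := Or.inr (Or.inl rfl)
  have h1 : (fun _ => 1) ∈ V₀ := Or.inr (Or.inr rfl)
  have hAt : entries (fun p => (A p)ᵀ) ⊆ V := entries_subset fun i j => mem_entries hA j i
  have g₀ : Gen c V 2 ({fun _ => 0} ∪ {fun _ => 1}) := (Gen.lit 0).union (Gen.lit 1)
  have g₁ : Gen c V₀ (d * n * 1) (entries fun p => A p * diagonal (u p)) := by
    have := Gen.matrix (c := c) (V := V₀) (X := fun p => A p * diagonal (u p)) (t := 1)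
      fun i j => by
        simp only [mul_diagonal]
        exact (Gen.mem (l₀ (mem_entries hA i j))).mul (Gen.mem (l₀ (hu j)))
    simpa only [Fintype.card_fin] using this
  have g₂ : Gen c V₁ t (entries fun p => A p * diagonal (u p) * (A p)ᵀ) :=
    h₁ _ c V₁ _ _ (l₁ h0) Set.subset_union_right (hAt.trans (l₀.trans l₁))
  have g₃ : Gen c V₂ s (entries fun p => (A p * diagonal (u p) * (A p)ᵀ)⁻¹) :=
    hi _ c V₂ _ (l₂ (l₁ h0)) (l₂ (l₁ h1)) Set.subset_union_right
      fun p => posDef_gram p.2.1 p.2.2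
  have g₄ : Gen c V₃ t (entries fun p => (A p)ᵀ * (A p * diagonal (u p) * (A p)ᵀ)⁻¹) :=
    h₂ _ c V₃ _ _ (l₀₃ h0) (hAt.trans (l₀.trans l₀₃)) Set.subset_union_right
  have g₅ : Gen c V₄ t (entries fun p => projCore (A p) (u p)) :=
    h₃ _ c V₄ _ _ (l₄ (l₀₃ h0)) Set.subset_union_right (hA.trans (l₀.trans (l₀₃.trans l₄)))
  have g₆ : Gen c V₅ (n * 3) (Set.range fun i => fun p => sqrtMul (c p) (u p) (v p) i) := by
    have := Gen.range (c := c) (V := V₅) (u := fun i => fun p => sqrtMul (c p) (u p) (v p) i)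
      (t := 3) fun i => ((Gen.mem (l₀₅ (l₀ (hu i)))).sqrt').mul
        ((Gen.mem (l₀₅ (l₀ (hv i)))).call')
    simpa only [Fintype.card_fin] using this
  have g₇ := Gen.mulVec (c := c) (V := V₆) (X := fun p => projCore (A p) (u p))
    (y := fun p => sqrtMul (c p) (u p) (v p)) (l₆ (l₀₅ h0)) (Set.subset_union_right.trans l₆)
    fun j => Or.inr ⟨j, rfl⟩
  rw [Fintype.card_fin] at g₇
  have g := g₀.trans (g₁.trans (g₂.trans (g₃.trans (g₄.trans (g₅.trans (g₆.trans
    g₇.keep))))))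
  refine ⟨_, g.weaken ?_, ?_, ?_, fun i => Or.inr ⟨i, rfl⟩⟩
  · ring_nf
    omega
  · exact l₀.trans (l₀₅.trans (l₆.trans Set.subset_union_left))
  · exact (Set.subset_union_right : _ ⊆ V₅).trans (l₆.trans Set.subset_union_left)

theorem IsMatMulExponent.exists_init {ω : ℝ} (hω : IsMatMulExponent ω) :
    ∃ K : ℝ, ∀ n d : ℕ, 1 ≤ d → d ≤ n →
      ∃ P : Prog (DSReg n d),
        ∀ (A : Matrix (Fin d) (Fin n) ℝ) (ε : ℝ) (f : ℝ → ℝ) (u v : Fin n → ℝ),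
          A.rank = d → (∀ i, 0 < u i) →
          ImplementsInit P A ε f u v ∧
          ∀ σ : DSReg n d → ℝ, HoldsData σ A ε → HoldsInput σ u v →
            (P.cost f σ : ℝ) ≤ K * ((n : ℝ) ^ 2 * (d : ℝ) ^ (ω - 2)) := by
  obtain ⟨K₁, hK₁, hthin⟩ := hω.exists_thin_bound
  obtain ⟨K₂, hK₂, hinv⟩ := hω.exists_inv_bound
  have hω2 := hω.two_le
  refine ⟨3 * K₁ + K₂ + 32, fun n d hd hdn => ?_⟩
  obtain ⟨t, h₁, h₂, h₃, ht⟩ := hthin n d hd hdn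
  obtain ⟨s, hs, hsK⟩ := hinv d hd
  obtain ⟨W, hG, hV, hM, hw⟩ := gen_init h₁ h₂ h₃ hs
  -- The contents of `fv` and `r` are irrelevant after initialization; `un` is stored there as a
  -- dummy.
  obtain ⟨F, e, r, hr, hF, he⟩ := hG.exists_store _
    (fun p i => p.1.2 (.un i)) (fun p i => p.1.2 (.vn i)) _ (fun p i => p.1.2 (.un i))
    (fun p i => p.1.2 (.un i)) hM (fun i => hV (mem_regReads _ (x := .un i) (by simp)))
    (fun i => hV (mem_regReads _ (x := .vn i) (by simp))) hw (fun i => hV (mem_regReads _ (x := .un i) (by simp)))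
    (fun i => hV (mem_regReads _ (x := .un i) (by simp)))
  refine ⟨F .halt, fun A ε f u v hA hu => ⟨fun σ hd hin => ?_, fun σ hd' hin => ?_⟩⟩
  · have hAσ : (Matrix.of fun i j => σ (.A i j) : Matrix (Fin d) (Fin n) ℝ) = A := by
      ext i j
      exact hd.1 i j
    have := he ⟨(f, σ), by rw [hAσ]; exact hA, fun i => (hu i).trans_eq (hin.1 i).symm⟩
    simp only [hin.1, hin.2, hd.1, hd.2] at this
    obtain ⟨a₁, a₂, a₃, a₄, -, -, a₅, a₆⟩ := this
    rw [(hF f σ .halt).1]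
    exact ⟨⟨a₅, a₆⟩, a₁, a₂, a₃, a₄⟩
  · rw [(hF f σ .halt).2, Prog.cost, zero_add]
    have hd1 : (1 : ℝ) ≤ d := by exact_mod_cast hd
    have hdn' : (d : ℝ) ≤ n := by exact_mod_cast hdn
    have e1 : (n : ℝ) ^ 2 ≤ (n : ℝ) ^ 2 * (d : ℝ) ^ (ω - 2) :=
      le_mul_of_one_le_right (by positivity) (Real.one_le_rpow hd1 (by linarith))
    have e2 : (d : ℝ) ^ ω ≤ (n : ℝ) ^ 2 * (d : ℝ) ^ (ω - 2) := by
      calc (d : ℝ) ^ ω = (d : ℝ) ^ 2 * (d : ℝ) ^ (ω - 2) := by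
            rw [← Real.rpow_two, ← Real.rpow_add (by linarith), add_sub_cancel]
        _ ≤ _ := by gcongr
    have e3 : (r : ℝ) ≤ 3 * t + s + d * n + 2 * n * n + 3 * n + 2 + 4 * (n * n + 5 * n) := by
      exact_mod_cast hr
    have e4 : (s : ℝ) ≤ K₂ * ((n : ℝ) ^ 2 * (d : ℝ) ^ (ω - 2)) := hsK.trans (by gcongr)
    have e5 : (d : ℝ) * n + 2 * n * n + 3 * n + 2 + 4 * (n * n + 5 * n) ≤ 32 * (n : ℝ) ^ 2 := by
      nlinarith
    nlinarith

/-! ### The Woodbury identity -/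

section Woodbury

open Matrix

variable {n d : ℕ}

theorem isUnit_gram {A : Matrix (Fin d) (Fin n) ℝ} (hA : A.rank = d) {u : Fin n → ℝ}
    (hu : ∀ i, 0 < u i) : IsUnit (A * diagonal u * Aᵀ) := (posDef_gram hA hu).isUnit

/-- The capacitance matrix `Δ_{S,S}⁻¹ + M_{S,S}`. -/
noncomputable def capMatrix (M : Matrix (Fin n) (Fin n) ℝ) (δ : Fin n → ℝ)
    (S : Finset (Fin n)) : Matrix {i // i ∈ S} {i // i ∈ S} ℝ :=
  (diagonal fun i : {i // i ∈ S} => δ i.val)⁻¹ + M.submatrix Subtype.val Subtype.val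

/-- The entries of Δ may have both signs, so the capacitance matrix need not be positive definite.
Its invertibility comes from the matrix determinant lemma: its determinant times those of Δ and of
the old Gram matrix is the determinant of the new Gram matrix, which is nonzero. -/
theorem woodbury {A : Matrix (Fin d) (Fin n) ℝ} (hA : A.rank = d) {u u' : Fin n → ℝ}
    (hu : ∀ i, 0 < u i) (hu' : ∀ i, 0 < u' i) {S : Finset (Fin n)} (hS : ∀ i ∈ S, u' i ≠ u i)
    (hSc : ∀ i ∉ S, u' i = u i) :
    IsUnit (capMatrix (projCore A u) (u' - u) S) ∧
      projCore A u - woodburyTerm (projCore A u) (u' - u) S = projCore A u' := by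
  set G := A * diagonal u * Aᵀ with hG
  set AS : Matrix (Fin d) {i // i ∈ S} ℝ := A.submatrix id Subtype.val with hAS
  set D : Matrix {i // i ∈ S} {i // i ∈ S} ℝ := diagonal fun i => (u' - u) i.val with hD
  have hGu : IsUnit G := isUnit_gram hA hu
  have hGd : IsUnit G.det := (isUnit_iff_isUnit_det G).1 hGu
  have hGt : (G⁻¹)ᵀ = G⁻¹ := by
    rw [transpose_nonsing_inv, ← conjTranspose_eq_transpose_of_trivial,
      (posDef_gram hA hu).isHermitian.eq]
  have hG' : A * diagonal u' * Aᵀ = G + AS * D * ASᵀ := by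
    ext i j
    have e1 : ∀ w : Fin n → ℝ, (A * diagonal w * Aᵀ) i j = ∑ x, A i x * w x * A j x := fun w => by
      rw [mul_apply]
      simp only [mul_diagonal, transpose_apply]
    have e2 : (AS * D * ASᵀ) i j = ∑ x : {x // x ∈ S}, A i x * (u' x - u x) * A j x := by
      rw [mul_apply]
      simp only [hD, mul_diagonal, transpose_apply]
      rfl
    rw [Matrix.add_apply, e1, hG, e1, e2, Finset.sum_coe_sort S fun x => A i x * (u' x - u x) * A j x,
      Finset.sum_subset (Finset.subset_univ S) fun x _ hx => by rw [hSc x hx]; ring,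
      ← Finset.sum_add_distrib]
    exact Finset.sum_congr rfl fun x _ => by ring
  have hDu : IsUnit D := by
    rw [hD, isUnit_diagonal]
    exact Pi.isUnit_iff.2 fun i => (sub_ne_zero.2 (hS i.1 i.2)).isUnit
  have hDd : IsUnit D.det := (isUnit_iff_isUnit_det D).1 hDu
  have hSS : (projCore A u).submatrix Subtype.val Subtype.val = ASᵀ * G⁻¹ * AS := rfl
  have hMS : (projCore A u).submatrix id Subtype.val = Aᵀ * G⁻¹ * AS := rfl
  have hcap : capMatrix (projCore A u) (u' - u) S = D⁻¹ + ASᵀ * G⁻¹ * AS := rfl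
  have hunit : IsUnit (D⁻¹ + ASᵀ * G⁻¹ * AS) := by
    have h1 := det_add_mul (AS * D) ASᵀ hGd
    have h2 : 1 + ASᵀ * G⁻¹ * (AS * D) = (D⁻¹ + ASᵀ * G⁻¹ * AS) * D := by
      rw [Matrix.add_mul, nonsing_inv_mul _ hDd, Matrix.mul_assoc (ASᵀ * G⁻¹)]
    rw [← hG', h2, det_mul] at h1
    have h3 := (isUnit_iff_isUnit_det _).1 (isUnit_gram hA hu')
    rw [h1] at h3
    rw [isUnit_iff_isUnit_det]
    exact isUnit_of_mul_isUnit_left (isUnit_of_mul_isUnit_right h3)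
  refine ⟨hunit, ?_⟩
  have h4 := add_mul_mul_inv_eq_sub G AS D ASᵀ hGu hDu hunit
  have h5 : woodburyTerm (projCore A u) (u' - u) S =
      (Aᵀ * G⁻¹ * AS) * (D⁻¹ + ASᵀ * G⁻¹ * AS)⁻¹ * (Aᵀ * G⁻¹ * AS)ᵀ := rfl
  rw [h5, projCore, projCore, hG', h4, ← hG]
  simp only [transpose_mul, transpose_transpose, hGt, Matrix.mul_sub, Matrix.sub_mul,
    Matrix.mul_assoc]

end Woodbury

/-! ### The batch size -/

/-- This is where `n ≥ 3` matters: for `n = 2` the factor in the loop condition would vanish. -/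
theorem one_sub_inv_logb_pos {n : ℕ} (hn : 3 ≤ n) : 0 < 1 - 1 / Real.logb 2 n := by
  have h1 : 1 < Real.logb 2 n := by
    rw [Real.lt_logb_iff_rpow_lt (by norm_num) (by positivity), Real.rpow_one]
    exact_mod_cast hn
  have := (div_lt_one (by linarith)).2 h1
  linarith

/-- Here `m` counts the rounds: each multiplies `k` by at least 3/2 and lowers the threshold by at
most one factor `1 - 1 / log n`. The disjunction records the two ways in which the loop can stop. -/
theorem enlarge_spec {n : ℕ} (hn : 3 ≤ n) (z : ℕ → ℝ) : ∀ (r k : ℕ), n - k ≤ r → 1 ≤ k → k ≤ n →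
    k ≤ enlarge n z k ∧ enlarge n z k ≤ n ∧
    (2 * n ≤ 3 * enlarge n z k ∨ z ((3 * enlarge n z k + 1) / 2) <
      (1 - 1 / Real.logb 2 n) * z (enlarge n z k)) ∧
    ∃ m : ℕ, 3 ^ m * k ≤ 2 ^ m * enlarge n z k ∧
      (1 - 1 / Real.logb 2 n) ^ m * z k ≤ z (enlarge n z k) := by
  intro r
  induction r with
  | zero =>
    intro k hr hk hkn
    have : enlarge n z k = k := by
      rw [enlarge, dif_neg]
      omega
    rw [this]
    exact ⟨le_rfl, hkn, Or.inl (by omega), 0, by simp, by simp⟩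
  | succ r ih =>
    intro k hr hk hkn
    by_cases h : 1 ≤ k ∧ 3 * k < 2 * n ∧ (1 - 1 / Real.logb 2 n) * z k ≤ z ((3 * k + 1) / 2)
    · have he : enlarge n z k = enlarge n z ((3 * k + 1) / 2) := by
        conv_lhs => rw [enlarge, dif_pos h]
      rw [he]
      obtain ⟨h1, h2, h3, m, h4, h5⟩ := ih ((3 * k + 1) / 2) (by omega) (by omega) (by omega)
      refine ⟨by omega, h2, h3, m + 1, ?_, ?_⟩
      · have h6 : 3 * k ≤ 2 * ((3 * k + 1) / 2) := by omega
        calc 3 ^ (m + 1) * k = 3 ^ m * (3 * k) := by ring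
          _ ≤ 3 ^ m * (2 * ((3 * k + 1) / 2)) := by gcongr
          _ = 2 * (3 ^ m * ((3 * k + 1) / 2)) := by ring
          _ ≤ 2 * (2 ^ m * enlarge n z ((3 * k + 1) / 2)) := by gcongr
          _ = _ := by ring
      · refine le_trans ?_ h5
        rw [pow_succ, mul_assoc]
        exact mul_le_mul_of_nonneg_left h.2.2 (pow_nonneg (one_sub_inv_logb_pos hn).le _)
    · have : enlarge n z k = k := by rw [enlarge, dif_neg h]
      rw [this]
      refine ⟨le_rfl, hkn, ?_, 0, by simp, by simp⟩
      by_contra! hcon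
      exact h ⟨hk, by omega, hcon.2⟩

theorem le_sortedAbs_iff {n : ℕ} {y : Fin n → ℝ} {π : Equiv.Perm (Fin n)}
    (hπ : Antitone fun j => |y (π j)|) (ε : ℝ) {k : ℕ} (hk : 1 ≤ k) (hkn : k ≤ n) :
    ε ≤ sortedAbs y π k ↔ k ≤ numLarge ε y := by
  classical
  have hcard : numLarge ε y = (Finset.univ.filter fun j => ε ≤ |y (π j)|).card := by
    rw [numLarge, ← Finset.card_map π.toEmbedding
      (s := Finset.univ.filter fun j => ε ≤ |y (π j)|)]
    congr 1
    ext i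
    simp only [Finset.mem_filter, Finset.mem_univ, true_and, Finset.mem_map_equiv]
    simp
  rw [hcard, sortedAbs, dif_pos ⟨hk, hkn⟩]
  constructor
  · intro h
    have hsub : Finset.univ.filter (fun j : Fin n => (j : ℕ) < k) ⊆
        Finset.univ.filter fun j => ε ≤ |y (π j)| := by
      intro j hj
      simp only [Finset.mem_filter, Finset.mem_univ, true_and] at hj ⊢
      exact h.trans (hπ (Fin.le_def.2 (by simp only; omega)))
    have := Finset.card_le_card hsub
    rwa [Fin.card_filter_val_lt, min_eq_right hkn] at this
  · intro h
    by_contra hlt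
    have hsub : Finset.univ.filter (fun j => ε ≤ |y (π j)|) ⊆
        Finset.univ.filter fun j : Fin n => (j : ℕ) < k - 1 := by
      intro j hj
      simp only [Finset.mem_filter, Finset.mem_univ, true_and] at hj ⊢
      by_contra hjk
      have := hπ (Fin.le_def.2 (by simp only; omega) : (⟨k - 1, by omega⟩ : Fin n) ≤ j)
      exact hlt (hj.trans this)
    have := Finset.card_le_card hsub
    rw [Fin.card_filter_val_lt, min_eq_right (by omega)] at this
    omega

theorem numLarge_le {n : ℕ} (ε : ℝ) (y : Fin n → ℝ) : numLarge ε y ≤ n := by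
  rw [numLarge]
  exact (Finset.card_filter_le _ _).trans (by simp)

theorem RankBranch.one_le {n : ℕ} {a ε : ℝ} {s : DSState n} {un : Fin n → ℝ} (hn : 1 ≤ n)
    (ha : 0 ≤ a) (h : RankBranch a ε s un) : 1 ≤ numLarge ε (relDev s un) := by
  have h1 : (1 : ℝ) ≤ (n : ℝ) ^ a := Real.one_le_rpow (by exact_mod_cast hn) ha
  exact_mod_cast h1.trans h

theorem card_firstIndices {n : ℕ} (π : Equiv.Perm (Fin n)) {k : ℕ} (hk : k ≤ n) :
    (firstIndices π k).card = k := by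
  have : firstIndices π k = (Finset.univ.filter fun j : Fin n => (j : ℕ) < k).map π.toEmbedding := by
    ext i
    simp only [firstIndices, Finset.mem_filter, Finset.mem_univ, true_and, Finset.mem_map_equiv]
  rw [this, Finset.card_map, Fin.card_filter_val_lt, min_eq_right hk]

/-- The outcome of the computation of `k` in the branch `k ≥ n ^ a`. -/
theorem batchSize_spec {n : ℕ} {a ε : ℝ} {s : DSState n} {un : Fin n → ℝ} (hn : 3 ≤ n)
    (ha : 0 ≤ a) (h : RankBranch a ε s un) {π : Equiv.Perm (Fin n)}
    (hπ : Antitone fun j => |relDev s un (π j)|) :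
    numLarge ε (relDev s un) ≤ batchSize a ε s un π ∧ batchSize a ε s un π ≤ n ∧
    (2 * n ≤ 3 * batchSize a ε s un π ∨
      sortedAbs (relDev s un) π ((3 * batchSize a ε s un π + 1) / 2) <
        (1 - 1 / Real.logb 2 n) * sortedAbs (relDev s un) π (batchSize a ε s un π)) ∧
    ∃ m : ℕ, 3 ^ m ≤ 2 ^ m * n ∧
      (1 - 1 / Real.logb 2 n) ^ m * ε ≤ sortedAbs (relDev s un) π (batchSize a ε s un π) := by
  have h1 := h.one_le (by omega) ha
  have h2 := numLarge_le ε (relDev s un)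
  rw [batchSize, if_pos h]
  obtain ⟨e1, e2, e3, m, e4, e5⟩ := enlarge_spec hn (sortedAbs (relDev s un) π) _ _ le_rfl h1 h2
  refine ⟨e1, e2, e3, m, ?_, ?_⟩
  · calc 3 ^ m ≤ 3 ^ m * numLarge ε (relDev s un) := Nat.le_mul_of_pos_right _ h1
      _ ≤ _ := e4
      _ ≤ _ := Nat.mul_le_mul_left _ e2
  · refine le_trans ?_ e5
    have := (le_sortedAbs_iff hπ ε h1 h2).2 le_rfl
    exact mul_le_mul_of_nonneg_left this (pow_nonneg (one_sub_inv_logb_pos hn).le _)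

theorem relDev_ne_zero_of_mem {n : ℕ} {a ε : ℝ} {s : DSState n} {un : Fin n → ℝ} (hn : 3 ≤ n)
    (ha : 0 ≤ a) (hε : 0 < ε) (h : RankBranch a ε s un) {π : Equiv.Perm (Fin n)}
    (hπ : Antitone fun j => |relDev s un (π j)|) {i : Fin n}
    (hi : i ∈ firstIndices π (batchSize a ε s un π)) : relDev s un i ≠ 0 := by
  obtain ⟨h1, h2, -, m, -, h3⟩ := batchSize_spec hn ha h hπ
  have h0 := h.one_le (by omega) ha
  simp only [firstIndices, Finset.mem_filter, Finset.mem_univ, true_and] at hi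
  rw [sortedAbs, dif_pos ⟨by omega, h2⟩] at h3
  have h4 := hπ (Fin.le_def.2 (by simp only; omega) :
    π.symm i ≤ (⟨batchSize a ε s un π - 1, by omega⟩ : Fin n))
  simp only [Equiv.apply_symm_apply] at h4
  have h5 : 0 < (1 - 1 / Real.logb 2 n) ^ m * ε :=
    mul_pos (pow_pos (one_sub_inv_logb_pos hn) _) hε
  exact abs_pos.1 (h5.trans_le (h3.trans h4))

/-! ### The straight-line part of an update -/

section Leaf

open Matrix

variable {n d : ℕ}

/-- `ũ^new` as a function of the memory. -/
noncomputable def newU (S : Finset (Fin n)) (un ut : Fin n → ℝ) : Fin n → ℝ :=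
  fun i => if i ∈ S then un i else ut i

/-- The memories on which the batch `S` has to be processed. -/
def BatchInput (n d : ℕ) (S : Finset (Fin n)) : Type :=
  {p : (ℝ → ℝ) × (DSReg n d → ℝ) // (∀ i ∈ S, p.2 (.un i) ≠ p.2 (.ut i)) ∧
    IsUnit (capMatrix (of fun i j => p.2 (.M i j))
      (newU S (fun i => p.2 (.un i)) (fun i => p.2 (.ut i)) - fun i => p.2 (.ut i)) S)}

/-- The set `S` is hard-wired, so selecting rows and columns costs nothing. Two of the four products
form the Woodbury term; the other two come from inverting a matrix that is only known to be
nonsingular. -/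
theorem gen_batch {S : Finset (Fin n)} {t s : ℕ} (hm : MulBound (Fin n) (Fin S.card) (Fin n) t)
    (hi : InvBound (Fin S.card) s) :
    ∃ W, Gen (fun p : BatchInput n d S => p.1.1) (regReads fun p : BatchInput n d S => p.1.2)
        (4 * t + s + 13 * (n * n) + 2) W ∧
      regReads (fun p : BatchInput n d S => p.1.2) ⊆ W ∧
      ∃ M' : BatchInput n d S → Matrix (Fin n) (Fin n) ℝ,
      (∀ p, M' p = of (fun i j => p.1.2 (.M i j)) - woodburyTerm (of fun i j => p.1.2 (.M i j))
        (newU S (fun i => p.1.2 (.un i)) (fun i => p.1.2 (.ut i)) - fun i => p.1.2 (.ut i)) S) ∧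
      entries M' ⊆ W ∧
      (∀ i, (fun p => (M' p).mulVec (sqrtMul p.1.1
        (newU S (fun i => p.1.2 (.un i)) (fun i => p.1.2 (.ut i))) fun i => p.1.2 (.vn i)) i) ∈ W) ∧
      (∀ i, (fun p => Real.sqrt (newU S (fun i => p.1.2 (.un i)) (fun i => p.1.2 (.ut i)) i) *
        (M' p).mulVec (sqrtMul p.1.1 (newU S (fun i => p.1.2 (.un i)) (fun i => p.1.2 (.ut i)))
          fun i => p.1.2 (.vn i)) i) ∈ W) ∧
      ∀ i, (fun p : BatchInput n d S => p.1.1 (p.1.2 (.vn i))) ∈ W := by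
  let c : BatchInput n d S → ℝ → ℝ := fun p => p.1.1
  let M : BatchInput n d S → Matrix (Fin n) (Fin n) ℝ := fun p => of fun i j => p.1.2 (.M i j)
  let un : BatchInput n d S → Fin n → ℝ := fun p i => p.1.2 (.un i)
  let ut : BatchInput n d S → Fin n → ℝ := fun p i => p.1.2 (.ut i)
  let vn : BatchInput n d S → Fin n → ℝ := fun p i => p.1.2 (.vn i)
  let uN : BatchInput n d S → Fin n → ℝ := fun p => newU S (un p) (ut p)
  let V := regReads fun p : BatchInput n d S => p.1.2
  have hM : entries M ⊆ V := entries_subset fun i j => mem_regReads _ (x := .M i j) (by simp)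
  have hun : ∀ i, (fun p => un p i) ∈ V := fun i => mem_regReads _ (x := .un i) (by simp)
  have hut : ∀ i, (fun p => ut p i) ∈ V := fun i => mem_regReads _ (x := .ut i) (by simp)
  have hvn : ∀ i, (fun p => vn p i) ∈ V := fun i => mem_regReads _ (x := .vn i) (by simp)
  have huN : ∀ i, (fun p => uN p i) ∈ V := fun i => by
    by_cases h : i ∈ S
    · simpa [uN, newU, h] using hun i
    · simpa [uN, newU, h] using hut i
  let Z : BatchInput n d S → Matrix {i // i ∈ S} {i // i ∈ S} ℝ := fun p =>
    capMatrix (M p) (uN p - ut p) S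
  let MS : BatchInput n d S → Matrix (Fin n) {i // i ∈ S} ℝ := fun p =>
    (M p).submatrix id Subtype.val
  let W : BatchInput n d S → Matrix (Fin n) (Fin n) ℝ := fun p => MS p * (Z p)⁻¹ * (MS p)ᵀ
  let M' : BatchInput n d S → Matrix (Fin n) (Fin n) ℝ := fun p => M p - W p
  let q : BatchInput n d S → Fin n → ℝ := fun p => sqrtMul (c p) (uN p) (vn p)
  have hMS : entries MS ⊆ V := entries_subset fun i j => mem_entries hM i j.val
  have hMSt : entries (fun p => (MS p)ᵀ) ⊆ V := entries_subset fun i j => mem_entries hM j i.val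
  have e : {i // i ∈ S} ≃ Fin S.card := S.equivFin
  have hm₁ : MulBound (Fin n) {i // i ∈ S} (Fin n) t :=
    hm.embed (.refl _) e.toEmbedding (.refl _)
  have hm₂ : MulBound (Fin n) {i // i ∈ S} {i // i ∈ S} t :=
    hm₁.embed (.refl _) (.refl _) (.subtype _)
  have hm₃ : MulBound {i // i ∈ S} {i // i ∈ S} {i // i ∈ S} t :=
    hm₂.embed (.subtype _) (.refl _) (.refl _)
  have hi₁ : InvBound {i // i ∈ S} s := hi.embed (J := Empty) ((Equiv.sumEmpty _ _).trans e)
  have hcard : Fintype.card {i // i ∈ S} ≤ n := by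
    simpa using Finset.card_le_univ S
  let V₀ := V ∪ ({fun _ => 0} ∪ {fun _ => 1})
  let V₁ := V₀ ∪ entries Z
  let V₂ := V₁ ∪ entries fun p => (Z p)⁻¹
  let V₃ := V₂ ∪ entries fun p => MS p * (Z p)⁻¹
  let V₄ := V₃ ∪ entries W
  let V₅ := V₄ ∪ entries M'
  let V₆ := V₅ ∪ Set.range fun i => fun p => q p i
  let V₇ := V₆ ∪ Set.range fun i => fun p => (M' p).mulVec (q p) i
  let V₈ := V₇ ∪ Set.range fun i => fun p => Real.sqrt (uN p i) * (M' p).mulVec (q p) i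
  have l₀ : V ⊆ V₀ := Set.subset_union_left
  have l₁ : V₀ ⊆ V₁ := Set.subset_union_left
  have l₂ : V₁ ⊆ V₂ := Set.subset_union_left
  have l₃ : V₂ ⊆ V₃ := Set.subset_union_left
  have l₄ : V₃ ⊆ V₄ := Set.subset_union_left
  have l₅ : V₄ ⊆ V₅ := Set.subset_union_left
  have l₆ : V₅ ⊆ V₆ := Set.subset_union_left
  have l₇ : V₆ ⊆ V₇ := Set.subset_union_left
  have l₈ : V₇ ⊆ V₈ := Set.subset_union_left
  have l₀₂ := l₁.trans l₂
  have l₀₄ := l₀₂.trans (l₃.trans l₄)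
  have l₀₅ := l₀₄.trans l₅
  have l₀₇ := l₀₅.trans (l₆.trans l₇)
  have h0 : (fun _ => 0) ∈ V₀ := Or.inr (Or.inl rfl)
  have h1 : (fun _ => 1) ∈ V₀ := Or.inr (Or.inr rfl)
  have hZ : ∀ p i j, Z p i j =
      if i = j then 1 / (un p i.val - ut p i.val) + M p i.val j.val else M p i.val j.val := by
    intro p i j
    have hinv : (diagonal fun i : {i // i ∈ S} => (uN p - ut p) i.val)⁻¹ =
        diagonal fun i : {i // i ∈ S} => 1 / (un p i.val - ut p i.val) := by
      apply inv_eq_right_inv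
      rw [diagonal_mul_diagonal, ← diagonal_one]
      congr 1
      funext i
      have := sub_ne_zero.2 (p.2.1 i.val i.2)
      simp only [uN, newU, Pi.sub_apply, if_pos i.2]
      exact mul_one_div_cancel this
    simp only [Z, capMatrix, hinv, Matrix.add_apply, submatrix_apply, diagonal_apply]
    split_ifs <;> simp
  have g₀ : Gen c V 2 ({fun _ => 0} ∪ {fun _ => 1}) := (Gen.lit 0).union (Gen.lit 1)
  have g₁ : Gen c V₀ (n * n * 4) (entries Z) := by
    refine (Gen.matrix (t := 4) fun i j => ?_).weaken
      (Nat.mul_le_mul_right 4 (Nat.mul_le_mul hcard hcard))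
    simp only [hZ]
    by_cases hij : i = j
    · simp only [hij, if_true]
      exact ((Gen.lit 1).div ((Gen.mem (l₀ (hun j))).sub (Gen.mem (l₀ (hut j))))).add
        (Gen.mem (l₀ (mem_entries hM j.val j.val)))
    · simp only [hij, if_false]
      exact (Gen.mem (l₀ (mem_entries hM i.val j.val))).weaken (by omega)
  have g₂ : Gen c V₁ (2 * t + s) (entries fun p => (Z p)⁻¹) :=
    hi₁.gen_inv hm₃ (l₁ h0) (l₁ h1) Set.subset_union_right fun p => p.2.2
  have g₃ : Gen c V₂ t (entries fun p => MS p * (Z p)⁻¹) :=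
    hm₂ _ c V₂ _ _ (l₀₂ h0) (hMS.trans (l₀.trans l₀₂)) Set.subset_union_right
  have g₄ : Gen c V₃ t (entries W) :=
    hm₁ _ c V₃ _ _ (l₃ (l₀₂ h0)) Set.subset_union_right (hMSt.trans (l₀.trans (l₀₂.trans l₃)))
  have g₅ : Gen c V₄ (n * n * 1) (entries M') := by
    have := Gen.matrix (c := c) (V := V₄) (X := M') (t := 1) fun i j =>
      (Gen.mem (l₀₄ (l₀ (mem_entries hM i j)))).sub
        (Gen.mem (mem_entries Set.subset_union_right i j))
    simpa only [Fintype.card_fin] using this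
  have g₆ : Gen c V₅ (n * 3) (Set.range fun i => fun p => q p i) := by
    have := Gen.range (c := c) (V := V₅) (u := fun i => fun p => q p i)
      (t := 3) fun i => ((Gen.mem (l₀₅ (l₀ (huN i)))).sqrt').mul
        ((Gen.mem (l₀₅ (l₀ (hvn i)))).call')
    simpa only [Fintype.card_fin] using this
  have g₇ := Gen.mulVec (c := c) (V := V₆) (X := M') (y := q) (l₆ (l₀₅ h0))
    (Set.subset_union_right.trans l₆) fun j => Or.inr ⟨j, rfl⟩
  have g₈ : Gen c V₇ (n * 2)
      (Set.range fun i => fun p => Real.sqrt (uN p i) * (M' p).mulVec (q p) i) := by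
    have := Gen.range (c := c) (V := V₇)
      (u := fun i => fun p => Real.sqrt (uN p i) * (M' p).mulVec (q p) i) (t := 2)
      fun i => ((Gen.mem (l₀₇ (l₀ (huN i)))).sqrt').mul (Gen.mem (Or.inr ⟨i, rfl⟩))
    simpa only [Fintype.card_fin] using this
  have g₉ : Gen c V₈ (n * 1) (Set.range fun i => fun p => c p (vn p i)) := by
    have := Gen.range (c := c) (V := V₈) (u := fun i => fun p => c p (vn p i)) (t := 1)
      fun i => (Gen.mem (l₈ (l₀₇ (l₀ (hvn i))))).call'
    simpa only [Fintype.card_fin] using this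
  rw [Fintype.card_fin] at g₇
  have g := g₀.trans (g₁.trans (g₂.trans (g₃.trans (g₄.trans (g₅.trans (g₆.trans
    (g₇.trans (g₈.trans g₉.keep))))))))
  have k₈ : V₈ ⊆ V₈ ∪ Set.range fun i => fun p => c p (vn p i) := Set.subset_union_left
  have k₇ := l₈.trans k₈
  refine ⟨_, g.weaken ?_, l₀.trans (l₀₇.trans k₇), M', fun p => rfl,
    (Set.subset_union_right : _ ⊆ V₅).trans (l₆.trans (l₇.trans k₇)),
    fun i => k₇ (Or.inr ⟨i, rfl⟩), fun i => k₈ (Or.inr ⟨i, rfl⟩), fun i => Or.inr ⟨i, rfl⟩⟩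
  have : n ≤ n * n := Nat.le_mul_self n
  ring_nf at this ⊢
  omega

/-- Run on the memory `σ`, the program `P` processes the batch `S` in `t` operations. -/
def ProcessesBatch (P : Prog (DSReg n d)) (f : ℝ → ℝ) (σ : DSReg n d → ℝ)
    (A : Matrix (Fin d) (Fin n) ℝ) (ε : ℝ) (x : DSState n) (un vn : Fin n → ℝ)
    (S : Finset (Fin n)) (t : ℕ) : Prop :=
  HoldsData (P.run f σ) A ε ∧
  (∀ i j, P.run f σ (.M i j) = (x.M - woodburyTerm x.M (newU S un x.ut - x.ut) S) i j) ∧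
  (∀ i, P.run f σ (.ut i) = newU S un x.ut i) ∧ (∀ i, P.run f σ (.vt i) = vn i) ∧
  (∀ i, P.run f σ (.w i) = (x.M - woodburyTerm x.M (newU S un x.ut - x.ut) S).mulVec
    (sqrtMul f (newU S un x.ut) vn) i) ∧
  (∀ i, P.run f σ (.fv i) = f (vn i)) ∧
  (∀ i, P.run f σ (.r i) = Real.sqrt (newU S un x.ut i) *
    (x.M - woodburyTerm x.M (newU S un x.ut - x.ut) S).mulVec
      (sqrtMul f (newU S un x.ut) vn) i) ∧
  P.cost f σ ≤ t

theorem exists_batch {S : Finset (Fin n)} {t s : ℕ}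
    (hm : MulBound (Fin n) (Fin S.card) (Fin n) t) (hi : InvBound (Fin S.card) s) :
    ∃ P : Prog (DSReg n d), ∀ (A : Matrix (Fin d) (Fin n) ℝ) (ε : ℝ) (f : ℝ → ℝ) (x : DSState n)
      (un vn : Fin n → ℝ) (σ : DSReg n d → ℝ), HoldsData σ A ε → HoldsInput σ un vn →
      HoldsState σ x → (∀ i ∈ S, un i ≠ x.ut i) →
      IsUnit (capMatrix x.M (newU S un x.ut - x.ut) S) →
      ProcessesBatch P f σ A ε x un vn S (4 * t + s + 17 * (n * n) + 20 * n + 2) := by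
  obtain ⟨W, hG, hV, M', hM', hMW, hw, hr, hfv⟩ := gen_batch (d := d) hm hi
  obtain ⟨F, e, r, hrr, hF, he⟩ := hG.exists_store M'
    (fun p => newU S (fun i => p.1.2 (.un i)) (fun i => p.1.2 (.ut i)))
    (fun p i => p.1.2 (.vn i)) _ (fun p i => p.1.1 (p.1.2 (.vn i))) _ hMW
    (fun i => by
      by_cases h : i ∈ S
      · simp only [newU, h, if_true]
        exact hV (mem_regReads _ (x := .un i) (by simp))
      · simp only [newU, h, if_false]
        exact hV (mem_regReads _ (x := .ut i) (by simp)))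
    (fun i => hV (mem_regReads _ (x := .vn i) (by simp))) hw hfv hr
  refine ⟨F .halt, fun A ε f x un vn σ hd hin hx hne hcap => ?_⟩
  have hMσ : (of fun i j => σ (.M i j) : Matrix (Fin n) (Fin n) ℝ) = x.M := by
    ext i j
    exact hx.1 i j
  have hunσ : (fun i => σ (.un i)) = un := funext hin.1
  have hutσ : (fun i => σ (.ut i)) = x.ut := funext hx.2.1
  let p : BatchInput n d S := ⟨(f, σ), fun i hi => by
    have := hne i hi
    rwa [← hin.1, ← hx.2.1] at this, by
    show IsUnit (capMatrix (of fun i j => σ (.M i j))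
      (newU S (fun i => σ (.un i)) (fun i => σ (.ut i)) - fun i => σ (.ut i)) S)
    rw [hMσ, hunσ, hutσ]
    exact hcap⟩
  have hMp : M' p = x.M - woodburyTerm x.M (newU S un x.ut - x.ut) S := by
    rw [hM', ← hMσ, ← hunσ, ← hutσ]
  obtain ⟨a₁, a₂, a₃, a₄, a₅, a₆, a₇, a₈⟩ := he p
  have p1 : p.1.1 = f := rfl
  have p2 : p.1.2 = σ := rfl
  rw [p1, p2] at a₁ a₂ a₃ a₄ a₅ a₆ a₇ a₈
  simp only [hMp, hunσ, hutσ, hin.2, hd.1, hd.2] at a₁ a₂ a₃ a₄ a₅ a₆ a₇ a₈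
  rw [ProcessesBatch, (hF f σ .halt).1, (hF f σ .halt).2, Prog.cost, zero_add]
  refine ⟨⟨a₇, a₈⟩, a₁, a₂, a₃, a₄, a₅, a₆, ?_⟩
  omega

end Leaf

/-! ### Decision trees -/

section Trees

variable {ρ ι : Type}

/-- Counting the keys that are at least the contents of register `b`. -/
theorem exists_count (key : ι → ρ) (b : ρ) (l : List ι) : ∀ (m : ℕ) (K : ℕ → Prog ρ),
    ∃ P : Prog ρ, ∀ (f : ℝ → ℝ) (σ : ρ → ℝ), ∃ k, k = m + (l.filter fun i => σ b ≤ σ (key i)).length ∧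
      P.run f σ = (K k).run f σ ∧ P.cost f σ = (K k).cost f σ + l.length := by
  induction l with
  | nil => exact fun m K => ⟨K m, fun f σ => ⟨m, by simp⟩⟩
  | cons a l ih =>
    intro m K
    obtain ⟨P, hP⟩ := ih m K
    obtain ⟨Q, hQ⟩ := ih (m + 1) K
    refine ⟨.ifLT (key a) b P Q, fun f σ => ?_⟩
    by_cases h : σ (key a) < σ b
    · obtain ⟨k, h1, h2, h3⟩ := hP f σ
      refine ⟨k, ?_, ?_, ?_⟩
      · simp [h1, not_le.2 h]
      · rw [Prog.run, if_pos h, h2]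
      · rw [Prog.cost, if_pos h, h3, List.length_cons]
        ring
    · obtain ⟨k, h1, h2, h3⟩ := hQ f σ
      refine ⟨k, ?_, ?_, ?_⟩
      · simp [h1, not_lt.1 h]
        ring
      · rw [Prog.run, if_neg h, h2]
      · rw [Prog.cost, if_neg h, h3, List.length_cons]
        ring

/-- Binary insertion into a list with non-increasing keys. -/
theorem exists_insert (key : ι → ρ) (x : ι) : ∀ (s : ℕ) (l : List ι), l.length < 2 ^ s →
    ∀ K : List ι → Prog ρ, ∃ P : Prog ρ, ∀ (f : ℝ → ℝ) (σ : ρ → ℝ),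
      l.Pairwise (fun i j => σ (key j) ≤ σ (key i)) → ∃ l', l'.Perm (x :: l) ∧
        l'.Pairwise (fun i j => σ (key j) ≤ σ (key i)) ∧ P.run f σ = (K l').run f σ ∧
        P.cost f σ ≤ (K l').cost f σ + s := by
  intro s
  induction s with
  | zero =>
    intro l hl K
    obtain rfl : l = [] := List.eq_nil_of_length_eq_zero (by simpa using hl)
    exact ⟨K [x], fun f σ _ => ⟨[x], by simp⟩⟩
  | succ s ih =>
    intro l hl K
    rcases Nat.eq_zero_or_pos l.length with h0 | hpos
    · obtain rfl : l = [] := List.eq_nil_of_length_eq_zero h0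
      exact ⟨K [x], fun f σ _ => ⟨[x], by simp⟩⟩
    obtain ⟨l₁, a, l₂, rfl, h₁, h₂⟩ : ∃ l₁ a l₂, l = l₁ ++ a :: l₂ ∧ l₁.length < 2 ^ s ∧
        l₂.length < 2 ^ s := by
      have hlt : l.length / 2 < l.length := by omega
      refine ⟨l.take (l.length / 2), l[l.length / 2], l.drop (l.length / 2 + 1), ?_, ?_, ?_⟩
      · rw [← List.drop_eq_getElem_cons hlt, List.take_append_drop]
      · rw [List.length_take, pow_succ] at *
        omega
      · rw [List.length_drop, pow_succ] at *
        omega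
    -- The continuation reattaches the part of the list that is not searched. The program text
    -- branches at every comparison, but a single run performs only `s` of them.
    obtain ⟨P, hP⟩ := ih l₁ h₁ fun l' => K (l' ++ a :: l₂)
    obtain ⟨Q, hQ⟩ := ih l₂ h₂ fun l' => K (l₁ ++ a :: l')
    refine ⟨.ifLT (key a) (key x) P Q, fun f σ hl => ?_⟩
    obtain ⟨hl₁, hl₂, hl₃⟩ := List.pairwise_append.1 hl
    obtain ⟨ha, hl₂⟩ := List.pairwise_cons.1 hl₂
    by_cases h : σ (key a) < σ (key x)
    · obtain ⟨l', p1, p2, p3, p4⟩ := hP f σ hl₁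
      refine ⟨l' ++ a :: l₂, ?_, ?_, ?_, ?_⟩
      · simpa using p1.append_right (a :: l₂)
      · refine List.pairwise_append.2 ⟨p2, List.pairwise_cons.2 ⟨ha, hl₂⟩, fun i hi j hj => ?_⟩
        rcases List.mem_cons.1 (p1.mem_iff.1 hi) with rfl | hi
        · rcases List.mem_cons.1 hj with rfl | hj
          · exact h.le
          · exact (ha j hj).trans h.le
        · exact hl₃ i hi j hj
      · rw [Prog.run, if_pos h, p3]
      · rw [Prog.cost, if_pos h]
        omega
    · obtain ⟨l', p1, p2, p3, p4⟩ := hQ f σ hl₂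
      refine ⟨l₁ ++ a :: l', ?_, ?_, ?_, ?_⟩
      · refine ((p1.cons a).append_left l₁).trans ?_
        refine ((List.Perm.swap x a l₂).append_left l₁).trans ?_
        exact List.perm_middle
      · refine List.pairwise_append.2 ⟨hl₁, List.pairwise_cons.2 ⟨fun j hj => ?_, p2⟩,
          fun i hi j hj => ?_⟩
        · rcases List.mem_cons.1 (p1.mem_iff.1 hj) with rfl | hj
          · exact not_lt.1 h
          · exact ha j hj
        · rcases List.mem_cons.1 hj with rfl | hj
          · exact hl₃ i hi _ List.mem_cons_self
          · rcases List.mem_cons.1 (p1.mem_iff.1 hj) with rfl | hj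
            · exact (not_lt.1 h).trans (hl₃ i hi a List.mem_cons_self)
            · exact hl₃ i hi j (List.mem_cons_of_mem _ hj)
      · rw [Prog.run, if_neg h, p3]
      · rw [Prog.cost, if_neg h]
        omega

/-- Sorting by binary insertion. -/
theorem exists_sort (key : ι → ρ) (s : ℕ) : ∀ (l acc : List ι), l.length + acc.length ≤ 2 ^ s →
    ∀ K : List ι → Prog ρ, ∃ P : Prog ρ, ∀ (f : ℝ → ℝ) (σ : ρ → ℝ),
      acc.Pairwise (fun i j => σ (key j) ≤ σ (key i)) → ∃ l', l'.Perm (l ++ acc) ∧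
        l'.Pairwise (fun i j => σ (key j) ≤ σ (key i)) ∧ P.run f σ = (K l').run f σ ∧
        P.cost f σ ≤ (K l').cost f σ + l.length * s := by
  intro l
  induction l with
  | nil => exact fun acc _ K => ⟨K acc, fun f σ h => ⟨acc, by simp [h]⟩⟩
  | cons a l ih =>
    intro acc hlen K
    rw [List.length_cons] at hlen
    -- Choosing continuations requires a program for every list; lists of the wrong length get a
    -- dummy.
    have h1 : ∀ acc' : List ι, ∃ P : Prog ρ, acc'.length = acc.length + 1 →
        ∀ (f : ℝ → ℝ) (σ : ρ → ℝ), acc'.Pairwise (fun i j => σ (key j) ≤ σ (key i)) →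
        ∃ l', l'.Perm (l ++ acc') ∧
        l'.Pairwise (fun i j => σ (key j) ≤ σ (key i)) ∧ P.run f σ = (K l').run f σ ∧
        P.cost f σ ≤ (K l').cost f σ + l.length * s := by
      intro acc'
      by_cases h : acc'.length = acc.length + 1
      · obtain ⟨P, hP⟩ := ih acc' (by omega) K
        exact ⟨P, fun _ => hP⟩
      · exact ⟨.halt, fun h' => absurd h' h⟩
    choose K' hK' using h1
    obtain ⟨P, hP⟩ := exists_insert key a s acc (by omega) K'
    refine ⟨P, fun f σ hacc => ?_⟩
    obtain ⟨acc', p1, p2, p3, p4⟩ := hP f σ hacc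
    obtain ⟨l', q1, q2, q3, q4⟩ := hK' acc' (by simpa using p1.length_eq) f σ p2
    refine ⟨l', ?_, q2, p3.trans q3, ?_⟩
    · refine q1.trans ((p1.append_left l).trans ?_)
      exact List.perm_middle
    · rw [List.length_cons, add_mul]
      omega

/-- The while-loop that enlarges `k`; `zr j` holds `z j`, and `t` is a scratch register. -/
theorem exists_enlarge {n : ℕ} (zr : ℕ → ρ) (t : ρ) (ht : ∀ j, 1 ≤ j → j ≤ n → zr j ≠ t)
    (K : ℕ → Prog ρ) : ∀ (r k : ℕ), n - k ≤ r → 1 ≤ k → k ≤ n → ∃ P : Prog ρ,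
    ∀ (f : ℝ → ℝ) (σ : ρ → ℝ) (z : ℕ → ℝ), (∀ j, 1 ≤ j → j ≤ n → σ (zr j) = z j) →
      ∃ σ' : ρ → ℝ, (∀ x, x ≠ t → σ' x = σ x) ∧ P.run f σ = (K (enlarge n z k)).run f σ' ∧
        P.cost f σ ≤ (K (enlarge n z k)).cost f σ' + 3 * r := by
  intro r
  induction r with
  | zero =>
    intro k hr hk hkn
    refine ⟨K k, fun f σ z _ => ⟨σ, fun _ _ => rfl, ?_⟩⟩
    have : enlarge n z k = k := by
      rw [enlarge, dif_neg]
      omega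
    simp [this]
  | succ r ih =>
    intro k hr hk hkn
    by_cases h : 3 * k < 2 * n
    · obtain ⟨P, hP⟩ := ih ((3 * k + 1) / 2) (by omega) (by omega) (by omega)
      -- A round takes three instructions; the factor depends on `n` only and is therefore a
      -- constant of the program.
      refine ⟨.const t (1 - 1 / Real.logb 2 n) (.arith .mul t t (zr k)
        (.ifLT (zr ((3 * k + 1) / 2)) t (K k) P)), fun f σ z hz => ?_⟩
      have e1 : writeReg (writeReg σ t (1 - 1 / Real.logb 2 n)) t (ArithOp.mul.eval
          (writeReg σ t (1 - 1 / Real.logb 2 n) t) (writeReg σ t (1 - 1 / Real.logb 2 n) (zr k))) =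
          writeReg σ t ((1 - 1 / Real.logb 2 n) * z k) := by
        rw [writeReg_same, writeReg_ne _ _ (ht k hk hkn), hz k hk hkn]
        funext x
        by_cases hx : x = t
        · subst hx
          simp [writeReg_same, ArithOp.eval]
        · simp [writeReg_ne _ _ hx]
      set σ₁ := writeReg σ t ((1 - 1 / Real.logb 2 n) * z k) with hσ₁
      have e2 : σ₁ (zr ((3 * k + 1) / 2)) = z ((3 * k + 1) / 2) := by
        rw [hσ₁, writeReg_ne _ _ (ht _ (by omega) (by omega)), hz _ (by omega) (by omega)]
      have e3 : σ₁ t = (1 - 1 / Real.logb 2 n) * z k := writeReg_same _ _ _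
      rw [Prog.run, Prog.run, Prog.run, Prog.cost, Prog.cost, Prog.cost, e1, e2, e3]
      by_cases hlt : z ((3 * k + 1) / 2) < (1 - 1 / Real.logb 2 n) * z k
      · have he : enlarge n z k = k := by
          rw [enlarge, dif_neg]
          rintro ⟨_, _, h'⟩
          exact absurd hlt (not_lt.2 h')
        rw [he, if_pos hlt, if_pos hlt]
        exact ⟨σ₁, fun x hx => writeReg_ne _ _ hx, rfl, by omega⟩
      · have he : enlarge n z k = enlarge n z ((3 * k + 1) / 2) := by
          conv_lhs => rw [enlarge, dif_pos ⟨hk, h, not_lt.1 hlt⟩]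
        rw [he, if_neg hlt, if_neg hlt]
        obtain ⟨σ', p1, p2, p3⟩ := hP f σ₁ z fun j hj hjn => by
          rw [hσ₁, writeReg_ne _ _ (ht j hj hjn), hz j hj hjn]
        exact ⟨σ', fun x hx => (p1 x hx).trans (writeReg_ne _ _ hx), p2, by omega⟩
    · refine ⟨K k, fun f σ z _ => ⟨σ, fun _ _ => rfl, ?_⟩⟩
      have : enlarge n z k = k := by
        rw [enlarge, dif_neg]
        omega
      simp [this]

end Trees

/-! ### Assembling the program for an update -/

theorem exists_ofFn_of_perm {n : ℕ} {l : List (Fin n)} (h : l.Perm (List.finRange n)) :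
    ∃ π : Equiv.Perm (Fin n), l = List.ofFn π := by
  have hlen : l.length = n := by simpa using h.length_eq
  have hnd : l.Nodup := h.nodup_iff.2 (List.nodup_finRange n)
  have hinj : Function.Injective fun j : Fin n => l.get (Fin.cast hlen.symm j) := fun i j hij =>
    Fin.cast_injective hlen.symm (List.nodup_iff_injective_get.1 hnd hij)
  refine ⟨Equiv.ofBijective _ (Finite.injective_iff_bijective.1 hinj), ?_⟩
  refine List.ext_getElem (by simp [hlen]) fun j h1 h2 => ?_
  simp

/-- The absolute relative deviations are computed into registers `key i`; `tmp b` is free. -/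
theorem exists_relDev (n d : ℕ) : ∃ (F : Prog (DSReg n d) → Prog (DSReg n d))
    (e : (ℝ → ℝ) → (DSReg n d → ℝ) → DSReg n d → ℝ) (s b : ℕ) (key : Fin n → DSReg n d),
    s ≤ 8 * n ∧ IsStraight F e s ∧ (∀ i, key i ≠ .tmp b) ∧ ∀ f σ,
      (∀ i, e f σ (key i) = |σ (.un i) / σ (.ut i) - 1|) ∧
      ∀ x, (∀ l, x ≠ .tmp l) → e f σ x = σ x := by
  let Ω := (ℝ → ℝ) × (DSReg n d → ℝ)
  let c : Ω → ℝ → ℝ := fun p => p.1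
  let V : Set (Ω → ℝ) := regReads fun p : Ω => p.2
  have g : Gen c V (n * 8) (Set.range fun i => fun p : Ω => |p.2 (.un i) / p.2 (.ut i) - 1|) := by
    have := Gen.range (c := c) (V := V) (t := 8)
      (u := fun i => fun p : Ω => |p.2 (.un i) / p.2 (.ut i) - 1|) fun i => by
        have hy : Gen c V 3 {fun p : Ω => p.2 (.un i) / p.2 (.ut i) - 1} :=
          ((Gen.mem (mem_regReads (fun p : Ω => p.2) (x := .un i) (by simp))).div
            (Gen.mem (mem_regReads (fun p : Ω => p.2) (x := .ut i) (by simp)))).sub (Gen.lit 1)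
        -- The absolute value is computed as √(y²); computing y twice at 3 operations each, the
        -- product and the root add up to 8.
        simp only [← Real.sqrt_mul_self_eq_abs]
        exact (hy.mul hy).sqrt'
    simpa only [Fintype.card_fin] using this
  obtain ⟨F, e, s, n₁, -, hs, hF, hW, hfr⟩ := g.compile (tmp := DSReg.tmp)
    (fun _ _ h => DSReg.tmp.inj h) (fun p => p.2) 0 fun g hg => by
      obtain ⟨x, hx, h⟩ := hg
      exact ⟨x, fun l _ => hx l, h⟩
  choose key hk1 hk2 using fun i => hW _ ⟨i, rfl⟩
  exact ⟨F, e, s, n₁, key, by omega, hF, fun i => hk1 i n₁ le_rfl, fun f σ =>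
    ⟨fun i => hk2 i (f, σ), fun x hx => hfr (f, σ) x fun l _ => hx l⟩⟩

theorem length_filter_eq_numLarge {n : ℕ} (ε : ℝ) (y : Fin n → ℝ) (q : Fin n → Prop)
    [DecidablePred q] (hq : ∀ i, q i ↔ ε ≤ |y i|) :
    ((List.finRange n).filter fun i => q i).length = numLarge ε y := by
  classical
  have h1 : numLarge ε y = (Finset.univ.filter q).card := by
    rw [numLarge]
    congr 1
    ext i
    simp [hq]
  rw [h1, ← List.toFinset_card_of_nodup ((List.nodup_finRange n).filter _)]
  congr 1
  ext i
  simp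

/-- The program for `Update`, given the cost of the matrix operations. -/
theorem exists_update {n d : ℕ} {a : ℝ} (ha : 0 ≤ a) (hn : 3 ≤ n) {tm ti : ℕ → ℕ}
    (hm : ∀ k : ℕ, (n : ℝ) ^ a ≤ k → k ≤ n →
      MulBound (Fin n) (Fin k) (Fin n) (tm k) ∧ InvBound (Fin k) (ti k)) :
    ∃ P : Prog (DSReg n d), ∀ (A : Matrix (Fin d) (Fin n) ℝ) (ε : ℝ) (f : ℝ → ℝ) (x : DSState n)
      (un vn : Fin n → ℝ), A.rank = d → 0 < ε → x.M = projCore A x.ut → (∀ i, 0 < x.ut i) →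
      (∀ i, 0 < un i) → ImplementsUpdate P a A ε f x un vn ∧
      ∀ σ, HoldsData σ A ε → HoldsInput σ un vn → HoldsState σ x →
        (¬ RankBranch a ε x un → P.cost f σ ≤ 9 * n) ∧
        (RankBranch a ε x un → ∃ π : Equiv.Perm (Fin n), Antitone (fun j => |relDev x un (π j)|) ∧
          P.cost f σ ≤ 4 * tm (batchSize a ε x un π) + ti (batchSize a ε x un π) +
            50 * (n * n)) := by
  obtain ⟨F, e, s, b, key, hs, hF, hkey, he⟩ := exists_relDev n d
  have hB : ∀ S : Finset (Fin n), ∃ P : Prog (DSReg n d), (n : ℝ) ^ a ≤ S.card →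
      ∀ (A : Matrix (Fin d) (Fin n) ℝ) (ε : ℝ) (f : ℝ → ℝ) (x : DSState n)
      (un vn : Fin n → ℝ) (σ : DSReg n d → ℝ), HoldsData σ A ε → HoldsInput σ un vn →
      HoldsState σ x → (∀ i ∈ S, un i ≠ x.ut i) →
      IsUnit (capMatrix x.M (newU S un x.ut - x.ut) S) →
      ProcessesBatch P f σ A ε x un vn S (4 * tm S.card + ti S.card + 17 * (n * n) + 20 * n + 2) := by
    intro S
    by_cases h : (n : ℝ) ^ a ≤ S.card
    · have hSn : S.card ≤ n := by simpa using Finset.card_le_univ S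
      obtain ⟨P, hP⟩ := exists_batch (d := d) (hm _ h hSn).1 (hm _ h hSn).2
      exact ⟨P, fun _ => hP⟩
    · exact ⟨.halt, fun h' => absurd h' h⟩
  choose PB hPB using hB
  -- The default `.eps` at positions out of range is never read; it only has to differ from the
  -- scratch register of the loop.
  let zr : Equiv.Perm (Fin n) → ℕ → DSReg n d := fun π j =>
    if h : 1 ≤ j ∧ j ≤ n then key (π ⟨j - 1, by omega⟩) else .eps
  have hzr : ∀ π j, zr π j ≠ .tmp b := by
    intro π j
    by_cases h : 1 ≤ j ∧ j ≤ n
    · simp only [zr, dif_pos h]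
      exact hkey _
    · simp [zr, dif_neg h]
  have hE : ∀ (π : Equiv.Perm (Fin n)) (k : ℕ), ∃ P : Prog (DSReg n d), 1 ≤ k → k ≤ n →
      ∀ (f : ℝ → ℝ) (σ : DSReg n d → ℝ) (z : ℕ → ℝ), (∀ j, 1 ≤ j → j ≤ n → σ (zr π j) = z j) →
      ∃ σ' : DSReg n d → ℝ, (∀ x, x ≠ .tmp b → σ' x = σ x) ∧
        P.run f σ = (PB (firstIndices π (enlarge n z k))).run f σ' ∧
        P.cost f σ ≤ (PB (firstIndices π (enlarge n z k))).cost f σ' + 3 * n := by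
    intro π k
    by_cases h : 1 ≤ k ∧ k ≤ n
    · obtain ⟨P, hP⟩ := exists_enlarge (zr π) (.tmp b) (fun j _ _ => hzr π j)
        (fun k => PB (firstIndices π k)) n k (by omega) h.1 h.2
      exact ⟨P, fun _ _ => hP⟩
    · exact ⟨.halt, fun h1 h2 => absurd ⟨h1, h2⟩ h⟩
  choose PE hPE using hE
  classical
  let KS : ℕ → List (Fin n) → Prog (DSReg n d) := fun k l =>
    if h : ∃ π : Equiv.Perm (Fin n), l = List.ofFn π then PE h.choose k else .halt
  have hS := fun k => exists_sort key (Nat.size n) (List.finRange n) []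
    (by simpa using (Nat.lt_size_self n).le) (KS k)
  choose PS hPS using hS
  -- The count decides the branch before anything is sorted, so a call with small `k` spends only 8n
  -- operations on the deviations and n comparisons.
  let KC : ℕ → Prog (DSReg n d) := fun k => if (n : ℝ) ^ a ≤ k then PS k else .halt
  obtain ⟨PC, hPC⟩ := exists_count key .eps (List.finRange n) 0 KC
  refine ⟨F PC, fun A ε f x un vn hA hε hM hut hun => ?_⟩
  have main : ∀ σ, HoldsData σ A ε → HoldsInput σ un vn → HoldsState σ x →
      (¬ RankBranch a ε x un → (F PC).run f σ = e f σ ∧ (F PC).cost f σ ≤ 9 * n) ∧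
      (RankBranch a ε x un → ∃ π : Equiv.Perm (Fin n), Antitone (fun j => |relDev x un (π j)|) ∧
        ∃ σ' : DSReg n d → ℝ, (∀ y, (∀ l, y ≠ .tmp l) → σ' y = σ y) ∧
        (F PC).run f σ = (PB (firstIndices π (batchSize a ε x un π))).run f σ' ∧
        (F PC).cost f σ ≤ (PB (firstIndices π (batchSize a ε x un π))).cost f σ' +
          (12 * n + n * n)) := by
    intro σ hd hin hx
    obtain ⟨he1, he2⟩ := he f σ
    have hy : ∀ i, e f σ (key i) = |relDev x un i| := fun i => by
      rw [he1, hin.1, hx.2.1]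
      rfl
    have heps : e f σ .eps = ε := by rw [he2 _ (by simp), hd.2]
    obtain ⟨k, hk, hk1, hk2⟩ := hPC f (e f σ)
    rw [zero_add, length_filter_eq_numLarge ε (relDev x un) _ fun i => by rw [heps, hy]] at hk
    rw [(hF f σ PC).1, (hF f σ PC).2, hk1, hk2, List.length_finRange]
    constructor
    · intro hr
      have : ¬ (n : ℝ) ^ a ≤ k := by rwa [hk]
      simp only [KC, if_neg this, Prog.run, Prog.cost]
      exact ⟨trivial, by omega⟩
    · intro hr
      have : (n : ℝ) ^ a ≤ k := by rwa [hk]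
      simp only [KC, if_pos this]
      obtain ⟨l, p1, p2, p3, p4⟩ := hPS k f (e f σ) List.Pairwise.nil
      rw [List.append_nil] at p1
      have hl := exists_ofFn_of_perm p1
      have hπ : l = List.ofFn hl.choose := hl.choose_spec
      have hKS : KS k l = PE hl.choose k := dif_pos hl
      rw [hKS] at p3 p4
      generalize hl.choose = π at *
      subst hπ
      have hanti : Antitone fun j => |relDev x un (π j)| := by
        intro i j hij
        rcases hij.eq_or_lt with rfl | hij
        · exact le_rfl
        · have := List.pairwise_ofFn.1 p2 hij
          rwa [hy, hy] at this
      have hk0 : 1 ≤ k := hk ▸ hr.one_le (by omega) ha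
      have hkn : k ≤ n := hk ▸ numLarge_le _ _
      obtain ⟨σ', q1, q2, q3⟩ := hPE π k hk0 hkn f (e f σ) (sortedAbs (relDev x un) π)
        fun j hj hjn => by
          simp only [zr, dif_pos (And.intro hj hjn), hy, sortedAbs]
      have hbs : batchSize a ε x un π = enlarge n (sortedAbs (relDev x un) π) k := by
        rw [batchSize, if_pos hr, hk]
      refine ⟨π, hanti, σ', fun y hy' => ?_, ?_, ?_⟩
      · rw [q1 y (hy' b), he2 y hy']
      · rw [p3, q2, hbs]
      · rw [hbs]
        rw [List.length_finRange] at p4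
        -- Sorting takes O(n log n) comparisons; this crude bound suffices, since a rank update pays
        -- for n² operations anyway.
        have h1 : n * Nat.size n ≤ n * n := Nat.mul_le_mul_left _ (Nat.size_le.2 Nat.lt_two_pow_self)
        omega
  have batch : ∀ σ, HoldsData σ A ε → HoldsInput σ un vn → HoldsState σ x →
      ∀ π : Equiv.Perm (Fin n), Antitone (fun j => |relDev x un (π j)|) → RankBranch a ε x un →
      ∀ σ' : DSReg n d → ℝ, (∀ y, (∀ l, y ≠ .tmp l) → σ' y = σ y) →
      ProcessesBatch (PB (firstIndices π (batchSize a ε x un π))) f σ' A ε x un vn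
        (firstIndices π (batchSize a ε x un π))
        (4 * tm (firstIndices π (batchSize a ε x un π)).card +
          ti (firstIndices π (batchSize a ε x un π)).card + 17 * (n * n) + 20 * n + 2) := by
    intro σ hd hin hx π hπ hr σ' hσ'
    obtain ⟨b1, b2, -, -⟩ := batchSize_spec hn ha hr hπ
    have hcard := card_firstIndices π b2
    have h1 : ∀ i ∈ firstIndices π (batchSize a ε x un π), un i ≠ x.ut i := fun i hi h => by
      refine relDev_ne_zero_of_mem hn ha hε hr hπ hi ?_
      rw [relDev, h, div_self (hut i).ne', sub_self]
    have h2 := woodbury hA hut (u' := newU (firstIndices π (batchSize a ε x un π)) un x.ut)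
      (fun i => by rw [newU]; split_ifs <;> [exact hun i; exact hut i])
      (S := firstIndices π (batchSize a ε x un π))
      (fun i hi => by rw [newU, if_pos hi]; exact h1 i hi) (fun i hi => by rw [newU, if_neg hi])
    exact hPB (firstIndices π (batchSize a ε x un π)) (by
        rw [hcard]
        exact le_trans hr (by exact_mod_cast b1)) A ε f x un vn σ'
      ⟨fun i j => by rw [hσ' _ (by simp), hd.1], by rw [hσ' _ (by simp), hd.2]⟩
      ⟨fun i => by rw [hσ' _ (by simp), hin.1], fun i => by rw [hσ' _ (by simp), hin.2]⟩
      ⟨fun i j => by rw [hσ' _ (by simp), hx.1], fun i => by rw [hσ' _ (by simp), hx.2.1],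
        fun i => by rw [hσ' _ (by simp), hx.2.2.1], fun i => by rw [hσ' _ (by simp), hx.2.2.2]⟩
      h1 (by rw [hM]; exact h2.1)
  constructor
  · intro σ hd hin hx
    obtain ⟨m1, m2⟩ := main σ hd hin hx
    by_cases hr : RankBranch a ε x un
    · obtain ⟨π, hπ, σ', hσ', hrun, -⟩ := m2 hr
      obtain ⟨b1, b2, b3, b4, b5, b6, b7, -⟩ := batch σ hd hin hx π hπ hr σ' hσ'
      rw [← hrun] at b1 b2 b3 b4 b5 b6 b7
      refine ⟨b1, fun _ => ?_, fun h => absurd hr h⟩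
      let S := firstIndices π (batchSize a ε x un π)
      let N := newU S un x.ut
      let M' := x.M - woodburyTerm x.M (N - x.ut) S
      have hN : N = fun i => if i ∈ firstIndices π (batchSize a ε x un π) then un i else x.ut i := by
        funext i
        simp only [N, newU]
        congr
      refine ⟨⟨M', N, vn, M'.mulVec (sqrtMul f N vn)⟩, ⟨N, vn, fun i => f (vn i),
        fun i => √(N i) * M'.mulVec (sqrtMul f N vn) i⟩, ⟨π, hπ, ?_⟩, ⟨b2, b3, b4, b5⟩, b6, b7⟩
      simp only [if_pos hr]
      simp only [M', hN, S, and_true]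
    · obtain ⟨m1, -⟩ := m1 hr
      have h2 := (he f σ).2
      rw [m1]
      refine ⟨⟨fun i j => ?_, ?_⟩, fun h => absurd h hr, fun _ => ⟨⟨fun i => ?_, fun i => ?_⟩,
        fun i j => ?_, fun i => ?_, fun i => ?_, fun i => ?_⟩⟩
      · rw [h2 _ (by simp), hd.1]
      · rw [h2 _ (by simp), hd.2]
      · rw [h2 _ (by simp), hin.1]
      · rw [h2 _ (by simp), hin.2]
      · rw [h2 _ (by simp), hx.1]
      · rw [h2 _ (by simp), hx.2.1]
      · rw [h2 _ (by simp), hx.2.2.1]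
      · rw [h2 _ (by simp), hx.2.2.2]
  · intro σ hd hin hx
    obtain ⟨m1, m2⟩ := main σ hd hin hx
    refine ⟨fun hr => (m1 hr).2, fun hr => ?_⟩
    obtain ⟨π, hπ, σ', hσ', -, hcost⟩ := m2 hr
    obtain ⟨-, -, -, -, -, -, -, b8⟩ := batch σ hd hin hx π hπ hr σ' hσ'
    refine ⟨π, hπ, ?_⟩
    rw [card_firstIndices π (batchSize_spec hn ha hr hπ).2.1] at b8
    have h3 : n * 3 ≤ n * n := Nat.mul_le_mul_left n hn
    omega

/-! ### The state along an execution -/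

section Invariant

variable {n d : ℕ}

/-- Extracts all that the time analysis needs: only `ũ` and `M` matter, and both stay fixed when `k
< n ^ a`. -/
theorem IsUpdate.exists_perm {a ε : ℝ} {f : ℝ → ℝ} {x x' : DSState n} {un vn : Fin n → ℝ}
    {o : DSOutput n} (h : IsUpdate a ε f x un vn x' o) :
    ∃ π : Equiv.Perm (Fin n), Antitone (fun j => |relDev x un (π j)|) ∧
      (RankBranch a ε x un →
        x'.ut = newU (firstIndices π (batchSize a ε x un π)) un x.ut ∧
        x'.M = x.M - woodburyTerm x.M (x'.ut - x.ut) (firstIndices π (batchSize a ε x un π))) ∧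
      (¬ RankBranch a ε x un → x'.ut = x.ut ∧ x'.M = x.M) := by
  obtain ⟨π, hπ, h⟩ := h
  refine ⟨π, hπ, fun hr => ?_, fun hr => ?_⟩
  · simp only [if_pos hr] at h
    have h1 : x'.ut = newU (firstIndices π (batchSize a ε x un π)) un x.ut := by
      rw [h.2.2.1]
      funext i
      simp only [newU]
    exact ⟨h1, by rw [h.1, h.2.2.1]⟩
  · simp only [if_neg hr] at h
    split_ifs at h
    · exact ⟨h.2.2.1, h.1⟩
    · exact ⟨by rw [h.1], by rw [h.1]⟩

theorem SmallChange.pos {C : ℝ} {T : ℕ} {u : ℕ → Fin n → ℝ} (h : SmallChange C T u)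
    (h0 : ∀ i, 0 < u 0 i) : ∀ t ≤ T, ∀ i, 0 < u t i := by
  intro t
  induction t with
  | zero => exact fun _ => h0
  | succ t ih =>
    intro ht i
    have h1 := ih (by omega) i
    have h2 := neg_le_of_abs_le ((h t (by omega)).2 i)
    rw [le_div_iff₀ h1] at h2
    linarith

/-- Along an execution, `ũ` is positive and `M = Aᵀ (A Ũ Aᵀ)⁻¹ A`. -/
theorem IsExecution.invariant {a ε C : ℝ} {A : Matrix (Fin d) (Fin n) ℝ} {f : ℝ → ℝ} {T : ℕ}
    {u v : ℕ → Fin n → ℝ} {s : ℕ → DSState n} (hn : 3 ≤ n) (ha : 0 ≤ a) (hA : A.rank = d)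
    (hε : 0 < ε) (h0 : ∀ i, 0 < u 0 i) (hu : SmallChange C T u)
    (h : IsExecution a ε A f T u v s) :
    ∀ t ≤ T, (∀ i, 0 < (s t).ut i) ∧ (s t).M = projCore A (s t).ut := by
  intro t
  induction t with
  | zero =>
    intro _
    rw [h.1]
    exact ⟨h0, rfl⟩
  | succ t ih =>
    intro ht
    obtain ⟨h1, h2⟩ := ih (by omega)
    obtain ⟨o, ho⟩ := h.2 t (by omega)
    obtain ⟨π, hπ, hr, hr'⟩ := ho.exists_perm
    by_cases hb : RankBranch a ε (s t) (u (t + 1))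
    · obtain ⟨h3, h4⟩ := hr hb
      have h5 : ∀ i, 0 < (s (t + 1)).ut i := fun i => by
        rw [h3, newU]
        split_ifs
        · exact hu.pos h0 _ ht i
        · exact h1 i
      refine ⟨h5, ?_⟩
      rw [h4, h2]
      refine (woodbury hA h1 h5 (fun i hi hi' => ?_) fun i hi => by rw [h3, newU, if_neg hi]).2
      rw [h3, newU, if_pos hi] at hi'
      refine relDev_ne_zero_of_mem hn ha hε hb hπ hi ?_
      rw [relDev, hi', div_self (h1 i).ne', sub_self]
    · rw [(hr' hb).1, (hr' hb).2]
      exact ⟨h1, h2⟩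

/-- Ties can be broken differently by the program and by the given execution; the sorted values, and
with them the batch size, do not depend on that choice. -/
theorem sortedAbs_eq {y : Fin n → ℝ} {π τ : Equiv.Perm (Fin n)}
    (hπ : Antitone fun j => |y (π j)|) (hτ : Antitone fun j => |y (τ j)|) :
    sortedAbs y π = sortedAbs y τ := by
  have h : (fun i => -|y i|) ∘ π = (fun i => -|y i|) ∘ τ :=
    Tuple.unique_monotone (fun i j hij => neg_le_neg (hπ hij)) fun i j hij => neg_le_neg (hτ hij)
  funext k
  rw [sortedAbs, sortedAbs]
  split_ifs with hk
  · exact neg_injective (congrFun h _)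
  · rfl

theorem batchSize_eq {a ε : ℝ} {x : DSState n} {un : Fin n → ℝ} {π τ : Equiv.Perm (Fin n)}
    (hπ : Antitone fun j => |relDev x un (π j)|) (hτ : Antitone fun j => |relDev x un (τ j)|) :
    batchSize a ε x un π = batchSize a ε x un τ := by
  rw [batchSize, batchSize, sortedAbs_eq hπ hτ]

end Invariant

/-! ### The potential function -/

section Potential

variable {n : ℕ}

/-- `∑ g_j z_j`, where the `z_j` are taken in non-increasing order. -/
noncomputable def sortedSum (g : Fin n → ℝ) (z : Fin n → ℝ) : ℝ :=
  ∑ j, g j * z (Tuple.sort (fun i => -z i) j)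

theorem antitone_sort_neg (z : Fin n → ℝ) :
    Antitone fun j => z (Tuple.sort (fun i => -z i) j) := fun _ _ hij =>
  neg_le_neg_iff.1 (Tuple.monotone_sort (fun i => -z i) hij)

/-- The rearrangement inequality: the sorted sum is the maximum over all orders. -/
theorem sum_mul_perm_le_sortedSum {g : Fin n → ℝ} (hg : Antitone g) (z : Fin n → ℝ)
    (σ : Equiv.Perm (Fin n)) : ∑ j, g j * z (σ j) ≤ sortedSum g z := by
  have h := (hg.monovary (antitone_sort_neg z)).sum_mul_comp_perm_le_sum_mul
    (σ := σ.trans (Tuple.sort fun i => -z i).symm)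
  simpa [sortedSum] using h

/-- The order that sorts `z'` is used for `z` and `e` as well: the rearrangement inequality bounds
the first part, Cauchy-Schwarz the second. -/
theorem sortedSum_le_add {g : Fin n → ℝ} (hg : Antitone g) {z z' e : Fin n → ℝ} {E : ℝ}
    (hE : 0 ≤ E) (h : ∀ i, z' i ≤ z i + e i) (hg0 : ∀ j, 0 ≤ g j) (he : ∑ i, e i ^ 2 ≤ E ^ 2) :
    sortedSum g z' ≤ sortedSum g z + E * √(∑ j, g j ^ 2) := by
  set τ := Tuple.sort (fun i => -z' i) with hτ
  have h1 : ∑ j, g j * e (τ j) ≤ E * √(∑ j, g j ^ 2) := by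
    refine (Real.sum_mul_le_sqrt_mul_sqrt _ _ _).trans ?_
    rw [mul_comm, Equiv.sum_comp τ fun i => e i ^ 2]
    gcongr
    rw [Real.sqrt_le_left hE]
    exact he
  calc sortedSum g z' ≤ ∑ j, (g j * z (τ j) + g j * e (τ j)) := by
        refine Finset.sum_le_sum fun j _ => ?_
        rw [← mul_add]
        exact mul_le_mul_of_nonneg_left (h _) (hg0 j)
    _ ≤ _ := by
        rw [Finset.sum_add_distrib]
        exact add_le_add (sum_mul_perm_le_sortedSum hg z τ) h1

/-- The effect on the sorted sum of setting the `k` largest entries to zero. -/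
theorem sortedSum_add_le {g : Fin n → ℝ} (hg : Antitone g) (hg0 : ∀ j, 0 ≤ g j)
    {z z' : Fin n → ℝ} (hz : ∀ i, 0 ≤ z i) {π : Equiv.Perm (Fin n)}
    (hπ : Antitone fun j => z (π j)) {k : ℕ} (hk : 1 ≤ k) (hkn : k ≤ n)
    (h1 : ∀ i, (π.symm i : ℕ) < k → z' i = 0) (h2 : ∀ i, k ≤ (π.symm i : ℕ) → z' i = z i)
    {D : ℝ} (hD0 : 0 ≤ D)
    (hD : ∀ i j : Fin n, (i : ℕ) < k → 3 * k ≤ 2 * j + 1 → z (π j) + D ≤ z (π i))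
    (hD' : 2 * n ≤ 3 * k → ∀ i : Fin n, (i : ℕ) < k → D ≤ z (π i)) :
    sortedSum g z' + k / 2 * (g ⟨k - 1, by omega⟩ * D) ≤ sortedSum g z := by
  set τ := Tuple.sort (fun i => -z' i) with hτdef
  have hτ : Antitone fun j => z' (τ j) := antitone_sort_neg z'
  -- Removing the `k` largest entries shifts the sorted sequence by `k`. Otherwise `j + 1` entries
  -- of `z'` would exceed `z (π i)`, yet only the `j` positions from `k` to `j + k - 1` can hold
  -- them.
  have key : ∀ j i : Fin n, (i : ℕ) = j + k → z' (τ j) ≤ z (π i) := by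
    intro j i hij
    by_contra! hlt
    have hmem : ∀ l ∈ Finset.Iic j, π.symm (τ l) ∈ Finset.univ.filter
        fun m : Fin n => k ≤ (m : ℕ) ∧ (m : ℕ) < j + k := by
      intro l hl
      have h3 : z (π i) < z' (τ l) := hlt.trans_le (hτ (Finset.mem_Iic.1 hl))
      have h4 : k ≤ (π.symm (τ l) : ℕ) := by
        by_contra! hc
        rw [h1 _ hc] at h3
        exact absurd (hz _) (not_le.2 h3)
      rw [h2 _ h4] at h3
      refine Finset.mem_filter.2 ⟨Finset.mem_univ _, h4, ?_⟩
      by_contra! hc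
      have := hπ (Fin.le_def.2 (hij ▸ hc) : i ≤ π.symm (τ l))
      simp only [Equiv.apply_symm_apply] at this
      exact absurd this (not_le.2 h3)
    have hcard := Finset.card_le_card_of_injOn (fun l => π.symm (τ l)) hmem
      (((π.symm.injective).comp τ.injective).injOn)
    have h5 : (Finset.univ.filter fun m : Fin n => k ≤ (m : ℕ) ∧ (m : ℕ) < j + k).card ≤ j := by
      have h6 := Finset.card_le_card_of_injOn (s := Finset.univ.filter
        fun m : Fin n => k ≤ (m : ℕ) ∧ (m : ℕ) < j + k) (t := Finset.Ico k (j + k))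
        (fun m : Fin n => (m : ℕ)) (fun m hm => by simpa using hm) Fin.val_injective.injOn
      simpa using h6
    rw [Fin.card_Iic] at hcard
    omega
  -- At most `n - k` entries are still nonzero, so the shifted sequence ends with zeros.
  have key' : ∀ j : Fin n, n ≤ j + k → z' (τ j) ≤ 0 := by
    intro j hj
    by_contra! hlt
    have hmem : ∀ l ∈ Finset.Iic j, π.symm (τ l) ∈ Finset.univ.filter
        fun m : Fin n => k ≤ (m : ℕ) := by
      intro l hl
      have h3 : 0 < z' (τ l) := hlt.trans_le (hτ (Finset.mem_Iic.1 hl))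
      refine Finset.mem_filter.2 ⟨Finset.mem_univ _, ?_⟩
      by_contra! hc
      exact absurd (h1 _ hc) h3.ne'
    have hcard := Finset.card_le_card_of_injOn (fun l => π.symm (τ l)) hmem
      (((π.symm.injective).comp τ.injective).injOn)
    have h5 : (Finset.univ.filter fun m : Fin n => k ≤ (m : ℕ)).card ≤ n - k := by
      have h6 := Finset.card_le_card_of_injOn (s := Finset.univ.filter
        fun m : Fin n => k ≤ (m : ℕ)) (t := Finset.Ico k n)
        (fun m : Fin n => (m : ℕ)) (fun m hm => by simpa using hm) Fin.val_injective.injOn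
      simpa using h6
    rw [Fin.card_Iic] at hcard
    omega
  have hle : ∀ j, z' (τ j) ≤ z (π j) := by
    intro j
    by_cases hj : (j : ℕ) + k < n
    · exact (key j ⟨j + k, hj⟩ rfl).trans (hπ (Fin.le_def.2 (by simp)))
    · exact (key' j (by omega)).trans (hz _)
  -- For `j ≥ k / 2` the shifted position lies beyond the gap at 1.5k. If it falls outside the range
  -- although the gap does not, the entry at position `3 * k / 2`, counted from 0, witnesses `D ≤ z
  -- (π j)`.
  have hgap : ∀ j : Fin n, k / 2 ≤ (j : ℕ) → (j : ℕ) < k → z' (τ j) + D ≤ z (π j) := by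
    intro j hj hjk
    by_cases hjn : (j : ℕ) + k < n
    · have h3 := key j ⟨j + k, hjn⟩ rfl
      have h4 := hD j ⟨j + k, hjn⟩ hjk (by simp only; omega)
      linarith
    · have h3 := key' j (by omega)
      by_cases h : 2 * n ≤ 3 * k
      · have := hD' h j hjk
        linarith
      · have h4 := hD j ⟨3 * k / 2, by omega⟩ hjk (by simp only; omega)
        have h5 := hz (π ⟨3 * k / 2, by omega⟩)
        linarith
  have hsum : ∑ j, g j * z' (τ j) + ∑ j ∈ Finset.univ.filter
      (fun j : Fin n => k / 2 ≤ (j : ℕ) ∧ (j : ℕ) < k), g ⟨k - 1, by omega⟩ * D ≤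
      ∑ j, g j * z (π j) := by
    rw [Finset.sum_filter, ← Finset.sum_add_distrib]
    refine Finset.sum_le_sum fun j _ => ?_
    split_ifs with hj
    · have h3 : g ⟨k - 1, by omega⟩ ≤ g j := hg (Fin.le_def.2 (by simp only; omega))
      have h4 := mul_le_mul_of_nonneg_left (hgap j hj.1 hj.2) (hg0 j)
      have h5 := mul_le_mul_of_nonneg_right h3 hD0
      linarith
    · rw [add_zero]
      exact mul_le_mul_of_nonneg_left (hle j) (hg0 j)
  -- At least half of the first `k` positions lose `D`, each with weight at least that of the last
  -- one.
  have hcard : (k : ℝ) / 2 ≤ ((Finset.univ.filter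
      (fun j : Fin n => k / 2 ≤ (j : ℕ) ∧ (j : ℕ) < k)).card : ℝ) := by
    have h3 : (Finset.Ico (k / 2) k).card ≤ (Finset.univ.filter
        (fun j : Fin n => k / 2 ≤ (j : ℕ) ∧ (j : ℕ) < k)).card := by
      refine Finset.card_le_card_of_surjOn (fun j : Fin n => (j : ℕ)) fun m hm => ?_
      rw [Finset.coe_Ico, Set.mem_Ico] at hm
      exact ⟨⟨m, by omega⟩, by simpa using hm, rfl⟩
    rw [Nat.card_Ico] at h3
    have h4 : k ≤ 2 * (Finset.univ.filter
      (fun j : Fin n => k / 2 ≤ (j : ℕ) ∧ (j : ℕ) < k)).card := by omega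
    have h5 : (k : ℝ) ≤ 2 * ((Finset.univ.filter
      (fun j : Fin n => k / 2 ≤ (j : ℕ) ∧ (j : ℕ) < k)).card : ℝ) := by exact_mod_cast h4
    linarith
  rw [Finset.sum_const, nsmul_eq_mul] at hsum
  have h3 := mul_le_mul_of_nonneg_right hcard (mul_nonneg (hg0 ⟨k - 1, by omega⟩) hD0)
  have h4 := sum_mul_perm_le_sortedSum hg z π
  have h5 : sortedSum g z' = ∑ j, g j * z' (τ j) := rfl
  linarith

/-- Put L = log₂ n. From 8^m ≤ 9^m ≤ 4^m n² follows m ≤ 2L, and log(1 - 1/L) ≥ -1/(L-1). Since n² ≥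
8 gives L ≥ 3/2, the exponent 2L/(L-1) is at most 6. -/
theorem exp_neg_six_le_pow {n m : ℕ} (hn : 3 ≤ n) (hm : 3 ^ m ≤ 2 ^ m * n) :
    Real.exp (-6) ≤ (1 - 1 / Real.logb 2 n) ^ m := by
  have hnR : (3 : ℝ) ≤ n := by exact_mod_cast hn
  set L := Real.logb 2 n with hLdef
  have hL : 3 / 2 ≤ L := by
    have h1 : (3 : ℝ) ≤ 2 * L := by
      have h2 : Real.logb 2 ((2 : ℝ) ^ 3) ≤ Real.logb 2 ((n : ℝ) ^ 2) := by
        apply Real.logb_le_logb_of_le (by norm_num) (by norm_num)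
        nlinarith
      rw [Real.logb_pow, Real.logb_pow, Real.logb_self_eq_one (by norm_num)] at h2
      push_cast at h2
      linarith
    linarith
  have hmL : (m : ℝ) ≤ 2 * L := by
    have h1 : (2 : ℝ) ^ m ≤ (n : ℝ) ^ 2 := by
      have h2 : (3 : ℝ) ^ m ≤ 2 ^ m * n := by exact_mod_cast hm
      have h3 : (2 : ℝ) ^ m * 4 ^ m ≤ (3 : ℝ) ^ m * 3 ^ m := by
        rw [← mul_pow, ← mul_pow]
        exact pow_le_pow_left₀ (by norm_num) (by norm_num) m
      have h4 : (3 : ℝ) ^ m * 3 ^ m ≤ (2 ^ m * n) * (2 ^ m * n) := by gcongr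
      have h5 : (4 : ℝ) ^ m = 2 ^ m * 2 ^ m := by rw [← mul_pow]; norm_num
      have h6 : (0 : ℝ) < 2 ^ m * 2 ^ m := by positivity
      rw [h5] at h3
      refine le_of_mul_le_mul_right ?_ h6
      calc (2 : ℝ) ^ m * (2 ^ m * 2 ^ m) ≤ _ := h3.trans h4
        _ = _ := by ring
    have h2 := Real.logb_le_logb_of_le (b := 2) (by norm_num) (by positivity) h1
    rw [Real.logb_pow, Real.logb_pow, Real.logb_self_eq_one (by norm_num)] at h2
    push_cast at h2
    linarith
  have h1 : 0 < 1 - 1 / L := by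
    rw [sub_pos, div_lt_one (by linarith)]
    linarith
  have h2 : -(1 / (L - 1)) ≤ Real.log (1 - 1 / L) := by
    refine le_trans (le_of_eq ?_) (Real.one_sub_inv_le_log_of_pos h1)
    have : L ≠ 0 := by linarith
    have : L - 1 ≠ 0 := by linarith
    field_simp
    ring
  rw [← Real.exp_log (pow_pos h1 m), Real.exp_le_exp, Real.log_pow]
  have h3 : (m : ℝ) * -(1 / (L - 1)) ≤ m * Real.log (1 - 1 / L) :=
    mul_le_mul_of_nonneg_left h2 (Nat.cast_nonneg m)
  refine le_trans ?_ h3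
  rw [mul_neg, neg_le_neg_iff, mul_one_div, div_le_iff₀ (by linarith)]
  linarith

/-- A discrete form of the integral comparison: Bernoulli's inequality for exponents at most 1
bounds each term by an increment of x^s / s. -/
theorem sum_rpow_sub_one_le {s : ℝ} (hs : 0 < s) (hs1 : s ≤ 1) (n : ℕ) :
    ∑ j ∈ Finset.range n, ((j : ℝ) + 1) ^ (s - 1) ≤ (n : ℝ) ^ s / s := by
  induction n with
  | zero => simp [Real.zero_rpow hs.ne']
  | succ n ih =>
    rw [Finset.sum_range_succ]
    have hn : (0 : ℝ) < (n : ℝ) + 1 := by positivity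
    have h1 : (n : ℝ) ^ s ≤ ((n : ℝ) + 1) ^ s - s * ((n : ℝ) + 1) ^ (s - 1) := by
      have h2 := rpow_one_add_le_one_add_mul_self (s := -(1 / ((n : ℝ) + 1)))
        (by rw [neg_le_neg_iff, div_le_one hn]; linarith [Nat.cast_nonneg (α := ℝ) n]) hs.le hs1
      have h3 : (n : ℝ) = ((n : ℝ) + 1) * (1 + -(1 / ((n : ℝ) + 1))) := by
        field_simp
        ring
      have h4 : 0 ≤ 1 + -(1 / ((n : ℝ) + 1)) := by
        rw [← sub_eq_add_neg, sub_nonneg, div_le_one hn]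
        linarith [Nat.cast_nonneg (α := ℝ) n]
      calc (n : ℝ) ^ s = (((n : ℝ) + 1) * (1 + -(1 / ((n : ℝ) + 1)))) ^ s := by rw [← h3]
        _ = ((n : ℝ) + 1) ^ s * (1 + -(1 / ((n : ℝ) + 1))) ^ s := Real.mul_rpow hn.le h4
        _ ≤ ((n : ℝ) + 1) ^ s * (1 + s * -(1 / ((n : ℝ) + 1))) := by gcongr
        _ = _ := by
          rw [Real.rpow_sub hn, Real.rpow_one]
          ring
    push_cast
    rw [le_div_iff₀ hs] at ih ⊢
    rw [add_mul]
    linarith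

end Potential

/-! ### The potential along an execution -/

section PotentialBound

variable {n d : ℕ}

/-- The potential of a state `x` with respect to the exact vector `u`. -/
noncomputable def potential (g : Fin n → ℝ) (ε : ℝ) (x : DSState n) (u : Fin n → ℝ) : ℝ :=
  sortedSum g fun i => min |relDev x u i| (2 * ε)

theorem potential_nonneg {g : Fin n → ℝ} (hg0 : ∀ j, 0 ≤ g j) {ε : ℝ} (hε : 0 ≤ ε)
    (x : DSState n) (u : Fin n → ℝ) : 0 ≤ potential g ε x u := by
  unfold potential sortedSum
  exact Finset.sum_nonneg fun j _ => mul_nonneg (hg0 j) (le_min (abs_nonneg _) (by linarith))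

/-- The increase of the potential when `u` changes. -/
theorem potential_le_add {g : Fin n → ℝ} (hg : Antitone g) (hg0 : ∀ j, 0 ≤ g j) {ε C : ℝ}
    (hε' : ε < 1 / 4) (hC : 0 ≤ C) {x : DSState n} (hx : ∀ i, 0 < x.ut i)
    {u un : Fin n → ℝ} (hu : ∀ i, 0 < u i)
    (h : ∑ i, ((un i - u i) / u i) ^ 2 ≤ C ^ 2) :
    potential g ε x un ≤ potential g ε x u + 3 / 2 * C * √(∑ j, g j ^ 2) := by
  refine sortedSum_le_add hg (e := fun i => 3 / 2 * |(un i - u i) / u i|) (by positivity)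
    (fun i => ?_) hg0 ?_
  · have h1 : relDev x un i = relDev x u i + (un i - u i) / u i * (1 + relDev x u i) := by
      have := (hx i).ne'
      have := (hu i).ne'
      simp only [relDev]
      field_simp
      ring
    -- This is the purpose of the truncation: above `2ε` the entry cannot grow, and below it `ε <
    -- 1/4` gives `|1 + y| ≤ 3/2`.
    rcases le_total (2 * ε) |relDev x u i| with h2 | h2
    · rw [min_eq_right h2]
      exact (min_le_right _ _).trans (le_add_of_nonneg_right (by positivity))
    · rw [min_eq_left h2]
      refine (min_le_left _ _).trans ?_
      rw [h1]
      refine (abs_add_le _ _).trans ?_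
      rw [abs_mul, mul_comm]
      have h3 : |1 + relDev x u i| ≤ 3 / 2 := by
        refine (abs_add_le _ _).trans ?_
        rw [abs_one]
        linarith
      gcongr
  · simp only [mul_pow, sq_abs, ← Finset.mul_sum]
    gcongr

/-- The decrease of the potential in the branch `k ≥ n ^ a`. -/
theorem RankBranch.potential_add_le {g : Fin n → ℝ} (hg : Antitone g) (hg0 : ∀ j, 0 ≤ g j)
    {a ε : ℝ} (hn : 3 ≤ n) (ha : 0 ≤ a) (hε : 0 < ε) {x x' : DSState n} {un : Fin n → ℝ}
    (hr : RankBranch a ε x un) {π : Equiv.Perm (Fin n)}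
    (hπ : Antitone fun j => |relDev x un (π j)|) (hun : ∀ i, 0 < un i)
    (hx' : x'.ut = newU (firstIndices π (batchSize a ε x un π)) un x.ut)
    {j : Fin n} (hj : (j : ℕ) + 1 = batchSize a ε x un π) :
    potential g ε x' un + batchSize a ε x un π / 2 *
      (g j * (Real.exp (-6) * ε / Real.logb 2 n)) ≤ potential g ε x un := by
  obtain ⟨b1, b2, b3, m, b4, b5⟩ := batchSize_spec hn ha hr hπ
  have h0 := hr.one_le (by omega) ha
  set k := batchSize a ε x un π with hk
  set L := Real.logb 2 n with hLdef
  have hL : 1 < L := by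
    rw [Real.lt_logb_iff_rpow_lt (by norm_num) (by positivity), Real.rpow_one]
    exact_mod_cast hn
  have hc : Real.exp (-6) * ε ≤ sortedAbs (relDev x un) π k :=
    (mul_le_mul_of_nonneg_right (exp_neg_six_le_pow hn b4) hε.le).trans b5
  have he1 : Real.exp (-6) ≤ 1 := Real.exp_le_one_iff.2 (by norm_num)
  have he0 := Real.exp_pos (-6)
  have hcε : Real.exp (-6) * ε ≤ ε := mul_le_of_le_one_left hε.le he1
  have hDε : Real.exp (-6) * ε / L ≤ Real.exp (-6) * ε := div_le_self (by positivity) hL.le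
  have hjk : j = ⟨k - 1, by omega⟩ := Fin.ext (by simp only; omega)
  have hsk : ∀ i : Fin n, (i : ℕ) < k → sortedAbs (relDev x un) π k ≤ |relDev x un (π i)| := by
    intro i hi
    rw [sortedAbs, dif_pos ⟨by omega, b2⟩]
    exact hπ (Fin.le_def.2 (by simp only; omega))
  rw [hjk]
  refine sortedSum_add_le hg hg0 (fun i => le_min (abs_nonneg _) (by linarith)) (π := π)
    (fun i j hij => min_le_min_right _ (hπ hij)) (by omega) b2 (fun i hi => ?_) (fun i hi => ?_)
    (by positivity) (fun i j hi hj => ?_) fun _ i hi => ?_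
  · have : relDev x' un i = 0 := by
      have hi' : i ∈ firstIndices π k := by simpa [firstIndices] using hi
      rw [relDev, hx', newU, if_pos hi', div_self (hun i).ne', sub_self]
    rw [this, abs_zero, min_eq_left (by linarith)]
  · have hi' : i ∉ firstIndices π k := by simpa [firstIndices] using hi
    rw [relDev, hx', newU, if_neg hi', relDev]
  · have hlt : 3 * k < 2 * n := by omega
    rw [or_iff_right (by omega)] at b3
    have h1 := hsk i hi
    have h2 : |relDev x un (π j)| ≤ sortedAbs (relDev x un) π ((3 * k + 1) / 2) := by
      rw [sortedAbs, dif_pos ⟨by omega, by omega⟩]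
      exact hπ (Fin.le_def.2 (by simp only; omega))
    -- Positions beyond the number of large deviations are below `ε`, so truncation at `2ε` leaves
    -- at least `ε` of room for the gap.
    have h3 : sortedAbs (relDev x un) π ((3 * k + 1) / 2) < ε := by
      by_contra! hcon
      have := (le_sortedAbs_iff hπ ε (by omega) (by omega)).1 hcon
      omega
    have h4 : min |relDev x un (π j)| (2 * ε) ≤ sortedAbs (relDev x un) π ((3 * k + 1) / 2) :=
      (min_le_left _ _).trans h2
    -- The loop condition failed, so the gap is at least 1/L of the last admitted deviation, which
    -- is itself at least e⁻⁶ε.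
    have h5 : Real.exp (-6) * ε / L ≤ 1 / L * sortedAbs (relDev x un) π k := by
      rw [div_eq_inv_mul, one_div]
      gcongr
    refine le_min ?_ ?_
    · linarith
    · linarith
  · exact le_min (by linarith [hsk i hi]) (by linarith)

/-- With weights (j+1)^(θ-1) a batch of size k releases (D/2) k · k^(θ-1) = (D/2) k^θ, while ‖g‖₂² ≤
n^(2θ-1)/(2θ-1) bounds what one step adds. Telescoping from the zero initial potential gives the
sum. The sizes may come from other sorting permutations than those of the execution. -/
theorem sum_batchSize_rpow_le {a ε C θ : ℝ} {A : Matrix (Fin d) (Fin n) ℝ} {f : ℝ → ℝ} {T : ℕ}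
    {u v : ℕ → Fin n → ℝ} {s : ℕ → DSState n} (hn : 3 ≤ n) (ha : 0 ≤ a) (hA : A.rank = d)
    (hε : 0 < ε) (hε' : ε < 1 / 4) (hC : 0 ≤ C) (hθ : 1 / 2 < θ) (hθ1 : θ ≤ 1)
    (h0 : ∀ i, 0 < u 0 i) (hu : SmallChange C T u) (h : IsExecution a ε A f T u v s)
    (κ : ℕ → ℕ) (hκ : ∀ t ∈ rankCalls a ε T u s, ∃ π : Equiv.Perm (Fin n),
      Antitone (fun j => |relDev (s t) (u (t + 1)) (π j)|) ∧
        κ t = batchSize a ε (s t) (u (t + 1)) π) :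
    ∑ t ∈ rankCalls a ε T u s, (κ t : ℝ) ^ θ ≤
      3 * Real.exp 6 / √(2 * θ - 1) * (T * (C / ε * (n : ℝ) ^ (θ - 1 / 2) * Real.logb 2 n)) := by
  classical
  let g : Fin n → ℝ := fun j => ((j : ℝ) + 1) ^ (θ - 1)
  have hg0 : ∀ j, 0 ≤ g j := fun j => by positivity
  have hg : Antitone g := fun i j hij => by
    refine Real.rpow_le_rpow_of_nonpos (by positivity) ?_ (by linarith)
    have : (i : ℕ) ≤ j := hij
    have : (i : ℝ) ≤ (j : ℝ) := by exact_mod_cast this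
    linarith
  set L := Real.logb 2 n with hLdef
  have hL : 1 < L := by
    rw [Real.lt_logb_iff_rpow_lt (by norm_num) (by positivity), Real.rpow_one]
    exact_mod_cast hn
  set G := √(∑ j, g j ^ 2) with hG
  have hGle : G ≤ (n : ℝ) ^ (θ - 1 / 2) / √(2 * θ - 1) := by
    have h1 : ∑ j, g j ^ 2 ≤ (n : ℝ) ^ (2 * θ - 1) / (2 * θ - 1) := by
      have h2 := sum_rpow_sub_one_le (s := 2 * θ - 1) (by linarith) (by linarith) n
      rw [← Fin.sum_univ_eq_sum_range (fun j => ((j : ℝ) + 1) ^ (2 * θ - 1 - 1))] at h2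
      refine le_trans (le_of_eq (Finset.sum_congr rfl fun j _ => ?_)) h2
      simp only [g]
      rw [← Real.rpow_natCast, ← Real.rpow_mul (by positivity)]
      congr 1
      push_cast
      ring
    refine (Real.sqrt_le_sqrt h1).trans (le_of_eq ?_)
    rw [Real.sqrt_div (by positivity), Real.sqrt_eq_rpow, ← Real.rpow_mul (by positivity)]
    congr 2
    ring
  set D := Real.exp (-6) * ε / L with hD
  have hD0 : 0 < D := by positivity
  have inv := h.invariant hn ha hA hε h0 hu
  have step : ∀ t < T, potential g ε (s (t + 1)) (u (t + 1)) +
      (if t ∈ rankCalls a ε T u s then D / 2 * (κ t : ℝ) ^ θ else 0) ≤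
      potential g ε (s t) (u t) + 3 / 2 * C * G := by
    intro t ht
    refine le_trans ?_ (potential_le_add hg hg0 hε' hC (inv t ht.le).1 (hu.pos h0 t ht.le)
      (hu t ht).1)
    obtain ⟨o, ho⟩ := h.2 t ht
    obtain ⟨π, hπ, hr, hr'⟩ := ho.exists_perm
    split_ifs with hb
    · obtain ⟨τ, hτ, hκt⟩ := hκ t hb
      rw [batchSize_eq hτ hπ] at hκt
      simp only [rankCalls, Finset.mem_filter] at hb
      obtain ⟨b1, b2, -⟩ := batchSize_spec hn ha hb.2 hπ
      have hb0 := hb.2.one_le (by omega) ha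
      rw [← hκt] at b1 b2
      have h1 := hb.2.potential_add_le hg hg0 hn ha hε hπ (hu.pos h0 (t + 1) ht) (hr hb.2).1
        (j := ⟨κ t - 1, by omega⟩) (by simp only; omega)
      refine le_trans (add_le_add_right (le_of_eq ?_) _) h1
      have h2 : (((κ t - 1 : ℕ) : ℝ) + 1) = κ t := by
        rw [Nat.cast_sub (by omega)]
        push_cast
        ring
      have h3 : (κ t : ℝ) ≠ 0 := by
        have : κ t ≠ 0 := by omega
        exact_mod_cast this
      simp only [g, h2, ← hκt]
      rw [Real.rpow_sub_one h3]
      field_simp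
      rw [hD]
    · have hb' : ¬ RankBranch a ε (s t) (u (t + 1)) := fun hb' =>
        hb (Finset.mem_filter.2 ⟨Finset.mem_range.2 ht, hb'⟩)
      rw [add_zero, potential, potential]
      refine le_of_eq ?_
      congr 1
      funext i
      rw [relDev, relDev, (hr' hb').1]
  have total : ∀ t ≤ T, potential g ε (s t) (u t) + ∑ r ∈ Finset.range t,
      (if r ∈ rankCalls a ε T u s then D / 2 * (κ r : ℝ) ^ θ else 0) ≤ t * (3 / 2 * C * G) := by
    intro t
    induction t with
    | zero =>
      intro _
      have : ∀ i, relDev (s 0) (u 0) i = 0 := fun i => by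
        rw [relDev, h.1]
        simp only [initState]
        rw [div_self (h0 i).ne', sub_self]
      simp [potential, sortedSum, this, hε.le]
    | succ t ih =>
      intro ht
      have h1 := ih (by omega)
      have h2 := step t (by omega)
      rw [Finset.sum_range_succ]
      push_cast
      linarith
  have h1 := total T le_rfl
  rw [Finset.sum_ite_mem, show Finset.range T ∩ rankCalls a ε T u s = rankCalls a ε T u s from
      Finset.inter_eq_right.2 (Finset.filter_subset _ _),
    ← Finset.mul_sum] at h1
  have h2 := potential_nonneg hg0 hε.le (s T) (u T)
  set Z := ∑ t ∈ rankCalls a ε T u s, (κ t : ℝ) ^ θ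
  have h3 : D / 2 * Z ≤ T * (3 / 2 * C * ((n : ℝ) ^ (θ - 1 / 2) / √(2 * θ - 1))) := by
    have : (T : ℝ) * (3 / 2 * C * G) ≤ T * (3 / 2 * C * ((n : ℝ) ^ (θ - 1 / 2) / √(2 * θ - 1))) := by
      gcongr
    linarith
  have h4 : Real.exp (-6) * Real.exp 6 = 1 := by rw [← Real.exp_add]; simp
  calc Z = 2 * Real.exp 6 * L / ε * (D / 2 * Z) := by
        rw [hD]
        field_simp
        linear_combination (-Z) * h4
    _ ≤ 2 * Real.exp 6 * L / ε * (T * (3 / 2 * C * ((n : ℝ) ^ (θ - 1 / 2) / √(2 * θ - 1)))) := by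
        gcongr
    _ = _ := by
        field_simp

end PotentialBound

/-! ### The total time of the updates -/

/-- There is a program for `Update` on which `T` calls take time `T * (C / ε * B * log n)`, apart
from the body of the branch `k < n ^ a`. -/
def HasUpdateProgram (n d : ℕ) (a B : ℝ) : Prop :=
  ∃ P : Prog (DSReg n d),
    ∀ (A : Matrix (Fin d) (Fin n) ℝ) (ε : ℝ) (f : ℝ → ℝ),
      A.rank = d → 0 < ε → ε < 1 / 4 →
    ∀ (C : ℝ) (T : ℕ) (u v : ℕ → Fin n → ℝ) (s : ℕ → DSState n),
      0 ≤ C → (∀ i, 0 < u 0 i) → SmallChange C T u → IsExecution a ε A f T u v s →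
      (∀ t < T, ImplementsUpdate P a A ε f (s t) (u (t + 1)) (v (t + 1))) ∧
      ∀ σ : ℕ → DSReg n d → ℝ,
        (∀ t < T, HoldsData (σ t) A ε ∧ HoldsInput (σ t) (u (t + 1)) (v (t + 1)) ∧
          HoldsState (σ t) (s t)) →
        ∑ t ∈ rankCalls a ε T u s, (P.cost f (σ t) : ℝ) ≤
          T * (C / ε * B * Real.logb 2 n) ∧
        ∀ t < T, ¬ RankBranch a ε (s t) (u (t + 1)) → (P.cost f (σ t) : ℝ) ≤ 9 * n

theorem one_lt_logb_two {n : ℕ} (hn : 3 ≤ n) : 1 < Real.logb 2 n := by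
  rw [Real.lt_logb_iff_rpow_lt (by norm_num) (by positivity), Real.rpow_one]
  exact_mod_cast hn

theorem HasUpdateProgram.mono {n d : ℕ} {a B B' : ℝ} (hn : 3 ≤ n) (h : HasUpdateProgram n d a B)
    (hB : B ≤ B') : HasUpdateProgram n d a B' := by
  obtain ⟨P, hP⟩ := h
  refine ⟨P, fun A ε f hA hε hε' C T u v s hC h0 hu hs => ?_⟩
  obtain ⟨h1, h2⟩ := hP A ε f hA hε hε' C T u v s hC h0 hu hs
  refine ⟨h1, fun σ hσ => ⟨(h2 σ hσ).1.trans ?_, (h2 σ hσ).2⟩⟩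
  have := one_lt_logb_two hn
  gcongr

/-- The assumption on ω says 5 - 2ω < a, which leaves room for β and δ with (ω-2-δ)/(1-β) > 1/2. The
per-batch cost O(n^(ω-θ) k^θ) and the potential bound then combine, and θ cancels. -/
theorem IsMatMulExponent.exists_hasUpdateProgram {ω a : ℝ} (hω : IsMatMulExponent ω)
    (ha : 0 ≤ a) (ha' : a ≤ dualExponent) (h : 5 / 2 - a / 2 < ω) :
    ∃ K : ℝ, ∀ n d : ℕ, 3 ≤ n → HasUpdateProgram n d a (K * (n : ℝ) ^ (ω - 1 / 2)) := by
  have hω2 := hω.two_le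
  have ha1 := ha'.trans dualExponent_le_one
  -- For `a > 0`, `β` stays strictly below `a` because the dual exponent itself may not be
  -- admissible; for `a = 0` the outer-product algorithm is used.
  obtain ⟨β, hβ0, hβ1, hβa, hβ, hβω⟩ : ∃ β : ℝ, 0 ≤ β ∧ β < 1 ∧ β ≤ a ∧
      (β = 0 ∨ β < dualExponent) ∧ 5 - 2 * ω < β := by
    rcases ha.eq_or_lt with rfl | ha0
    · exact ⟨0, le_rfl, one_pos, le_rfl, Or.inl rfl, by linarith⟩
    · obtain ⟨β, h1, h2⟩ := exists_between (max_lt ha0 (by linarith : 5 - 2 * ω < a))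
      obtain ⟨h3, h4⟩ := max_lt_iff.1 h1
      exact ⟨β, h3.le, h2.trans_le ha1, h2.le, Or.inr (h2.trans_le ha'), h4⟩
  obtain ⟨δ, hδ, hδω⟩ : ∃ δ : ℝ, 0 < δ ∧ 1 - β < 2 * (ω - 2 - δ) :=
    ⟨(β - (5 - 2 * ω)) / 4, by linarith, by linarith⟩
  obtain ⟨K₁, hK₁, hrect⟩ := hω.exists_rect_bound hβ0 hβ1 hβ hδ
  obtain ⟨K₂, hK₂, hinv⟩ := hω.exists_inv_bound
  -- The cap at 1 makes the weights `(j + 1) ^ (θ - 1)` non-increasing.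
  set θ := min 1 ((ω - 2 - δ) / (1 - β)) with hθdef
  have hθ1 : θ ≤ 1 := min_le_left _ _
  have hθ : 1 / 2 < θ := by
    refine lt_min (by norm_num) ?_
    rw [lt_div_iff₀ (by linarith)]
    linarith
  -- 54 is 4 products plus the quadratic overhead 50 n², charged to the multiplication through `n ^
  -- 2 ≤ t`.
  refine ⟨(54 * K₁ + K₂) * (3 * Real.exp 6 / √(2 * θ - 1)), fun n d hn => ?_⟩
  have hn0 : (0 : ℝ) < n := by positivity
  have hn1 : (1 : ℝ) ≤ n := by exact_mod_cast (by omega : 1 ≤ n)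
  have hbound : ∀ k : ℕ, ∃ t s : ℕ, (n : ℝ) ^ a ≤ k → k ≤ n →
      MulBound (Fin n) (Fin k) (Fin n) t ∧ InvBound (Fin k) s ∧
      4 * (t : ℝ) + s + 50 * (n * n) ≤ (54 * K₁ + K₂) * (n : ℝ) ^ (ω - θ) * (k : ℝ) ^ θ := by
    intro k
    by_cases hk : (n : ℝ) ^ a ≤ k ∧ k ≤ n
    · obtain ⟨hka, hkn⟩ := hk
      have hk1 : 1 ≤ k := by
        exact_mod_cast (Real.one_le_rpow hn1 ha).trans hka
      have hkR : (0 : ℝ) < k := by positivity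
      obtain ⟨t, ht, htn, htK⟩ := hrect n k hk1 hkn
        ((Real.rpow_le_rpow_of_exponent_le hn1 hβa).trans hka)
      obtain ⟨s, hs, hsK⟩ := hinv k hk1
      refine ⟨t, s, fun _ _ => ⟨ht, hs, ?_⟩⟩
      have hq0 : (0 : ℝ) < k / n := by positivity
      have hq1 : (k : ℝ) / n ≤ 1 := by
        rw [div_le_one hn0]
        exact_mod_cast hkn
      have hpow : (n : ℝ) ^ ω * ((k : ℝ) / n) ^ θ = (n : ℝ) ^ (ω - θ) * (k : ℝ) ^ θ := by
        rw [Real.div_rpow hkR.le hn0.le, Real.rpow_sub hn0]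
        ring
      have h1 : (t : ℝ) ≤ K₁ * ((n : ℝ) ^ (ω - θ) * (k : ℝ) ^ θ) := by
        rw [← hpow]
        refine htK.trans ?_
        gcongr ?_ * (?_ * ?_)
        exact Real.rpow_le_rpow_of_exponent_ge hq0 hq1 (min_le_right _ _)
      have h2 : (s : ℝ) ≤ K₂ * ((n : ℝ) ^ (ω - θ) * (k : ℝ) ^ θ) := by
        rw [← hpow]
        refine hsK.trans ?_
        gcongr ?_ * ?_
        have h3 : (k : ℝ) ^ ω = (n : ℝ) ^ ω * ((k : ℝ) / n) ^ ω := by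
          rw [Real.div_rpow hkR.le hn0.le]
          field_simp
        rw [h3]
        gcongr ?_ * ?_
        exact Real.rpow_le_rpow_of_exponent_ge hq0 hq1 (by linarith)
      have h3 : (n : ℝ) * n ≤ t := by
        rw [sq] at htn
        exact_mod_cast htn
      nlinarith
    · exact ⟨0, 0, fun h1 h2 => absurd ⟨h1, h2⟩ hk⟩
  choose tm ti htm using hbound
  obtain ⟨P, hP⟩ := exists_update (d := d) ha hn fun k h1 h2 =>
    ⟨(htm k h1 h2).1, (htm k h1 h2).2.1⟩
  refine ⟨P, fun A ε f hA hε hε' C T u v s hC h0 hu hs => ?_⟩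
  have inv := hs.invariant hn ha hA hε h0 hu
  have hcall := fun t (ht : t < T) => hP A ε f (s t) (u (t + 1)) (v (t + 1)) hA hε
    (inv t ht.le).2 (inv t ht.le).1 (hu.pos h0 (t + 1) ht)
  refine ⟨fun t ht => (hcall t ht).1, fun σ hσ => ⟨?_, fun t ht hr => ?_⟩⟩
  · have hcost : ∀ t, ∃ k : ℕ, t ∈ rankCalls a ε T u s →
        (∃ π : Equiv.Perm (Fin n), Antitone (fun j => |relDev (s t) (u (t + 1)) (π j)|) ∧
          k = batchSize a ε (s t) (u (t + 1)) π) ∧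
        (P.cost f (σ t) : ℝ) ≤ (54 * K₁ + K₂) * (n : ℝ) ^ (ω - θ) * (k : ℝ) ^ θ := by
      intro t
      by_cases ht : t ∈ rankCalls a ε T u s
      · simp only [rankCalls, Finset.mem_filter] at ht
        obtain ⟨htT, hr⟩ := ht
        rw [Finset.mem_range] at htT
        obtain ⟨s1, s2, s3⟩ := hσ t htT
        obtain ⟨π, hπ, hc⟩ := ((hcall t htT).2 (σ t) s1 s2 s3).2 hr
        obtain ⟨b1, b2, -⟩ := batchSize_spec hn ha hr hπ
        refine ⟨batchSize a ε (s t) (u (t + 1)) π, fun _ => ⟨⟨π, hπ, rfl⟩, ?_⟩⟩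
        refine le_trans ?_ (htm _ (le_trans hr (by exact_mod_cast b1)) b2).2.2
        exact_mod_cast hc
      · exact ⟨0, fun h => absurd h ht⟩
    choose κ hκ using hcost
    have hsum := sum_batchSize_rpow_le hn ha hA hε hε' hC hθ hθ1 h0 hu hs κ
      fun t ht => (hκ t ht).1
    calc ∑ t ∈ rankCalls a ε T u s, (P.cost f (σ t) : ℝ)
        ≤ ∑ t ∈ rankCalls a ε T u s, (54 * K₁ + K₂) * (n : ℝ) ^ (ω - θ) * (κ t : ℝ) ^ θ :=
          Finset.sum_le_sum fun t ht => (hκ t ht).2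
      _ = (54 * K₁ + K₂) * (n : ℝ) ^ (ω - θ) * ∑ t ∈ rankCalls a ε T u s, (κ t : ℝ) ^ θ := by
          rw [Finset.mul_sum]
      _ ≤ (54 * K₁ + K₂) * (n : ℝ) ^ (ω - θ) * (3 * Real.exp 6 / √(2 * θ - 1) *
          (T * (C / ε * (n : ℝ) ^ (θ - 1 / 2) * Real.logb 2 n))) := by gcongr
      _ = _ := by
          rw [show ω - 1 / 2 = (ω - θ) + (θ - 1 / 2) by ring, Real.rpow_add hn0]
          ring
  · obtain ⟨s1, s2, s3⟩ := hσ t ht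
    exact_mod_cast ((hcall t ht).2 (σ t) s1 s2 s3).1 hr

/-- Bounds `K n ^ (b + δ)` for all `δ > 0` give a bound `n ^ (b + o(1))`. -/
theorem exists_tendsto_zero_of_forall_pos {b : ℝ} {p : ℕ → ℝ → Prop}
    (hp : ∀ n, 3 ≤ n → ∀ x y, x ≤ y → p n x → p n y)
    (h : ∀ δ : ℝ, 0 < δ → ∃ K : ℝ, ∀ n : ℕ, 3 ≤ n → p n (K * (n : ℝ) ^ (b + δ))) :
    ∃ η : ℕ → ℝ, Filter.Tendsto η Filter.atTop (nhds 0) ∧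
      ∀ n : ℕ, 3 ≤ n → p n ((n : ℝ) ^ (b + η n)) := by
  have h' : ∀ j : ℕ, ∃ K : ℝ, 1 ≤ K ∧ ∀ n : ℕ, 3 ≤ n →
      p n (K * (n : ℝ) ^ (b + 1 / ((j : ℝ) + 1))) := fun j => by
    obtain ⟨K, hK⟩ := h (1 / ((j : ℝ) + 1)) (by positivity)
    refine ⟨max 1 K, le_max_left _ _, fun n hn => hp n hn _ _ ?_ (hK n hn)⟩
    gcongr
    exact le_max_right _ _
  choose K hK1 hK using h'
  -- Chosen so that `n ^ e n j` equals `K j * n ^ (1 / (j + 1))`: the constant is moved into the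
  -- exponent.
  let e : ℕ → ℕ → ℝ := fun n j => 1 / ((j : ℝ) + 1) + Real.log (K j) / Real.log n
  have hne : ∀ n : ℕ, (Finset.range (n + 1)).Nonempty := fun n => ⟨0, by simp⟩
  -- The best of the first `n + 1` bounds is taken for each `n`; any fixed `j` eventually competes,
  -- and its exponent tends to `1 / (j + 1)`.
  refine ⟨fun n => (Finset.range (n + 1)).inf' (hne n) (e n), ?_, fun n hn => ?_⟩
  · rw [Metric.tendsto_atTop]
    intro r hr
    obtain ⟨j, hj⟩ := exists_nat_one_div_lt (half_pos hr)
    have h1 : Filter.Tendsto (fun n : ℕ => Real.log (K j) / Real.log n) Filter.atTop (nhds 0) :=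
      (Real.tendsto_log_atTop.comp tendsto_natCast_atTop_atTop).const_div_atTop _
    obtain ⟨N, hN⟩ := Metric.tendsto_atTop.1 h1 (r / 2) (half_pos hr)
    refine ⟨max N j, fun n hn => ?_⟩
    have h2 := hN n (le_of_max_le_left hn)
    rw [Real.dist_eq, sub_zero] at h2
    replace h2 := (abs_lt.1 h2).2
    rw [Real.dist_eq, sub_zero, abs_of_nonneg]
    · refine (Finset.inf'_le (e n) (Finset.mem_range.2
        (Nat.lt_succ_of_le (le_of_max_le_right hn)))).trans_lt ?_
      simp only [e]
      linarith
    · refine Finset.le_inf' _ _ fun i _ => ?_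
      have h3 := Real.log_nonneg (hK1 i)
      have h4 := Real.log_natCast_nonneg n
      positivity
  · obtain ⟨j, -, hj⟩ := Finset.exists_mem_eq_inf' (hne n) (e n)
    simp only
    rw [hj]
    refine hp n hn _ _ (le_of_eq ?_) (hK j n hn)
    have hn0 : (0 : ℝ) < n := by positivity
    have hn1 : (1 : ℝ) < n := by exact_mod_cast (by omega : 1 < n)
    have hlog := Real.log_pos hn1
    have hKj : (0 : ℝ) < K j := by linarith [hK1 j]
    have h5 : (n : ℝ) ^ (Real.log (K j) / Real.log n) = K j := by
      rw [Real.rpow_def_of_pos hn0, mul_div_cancel₀ _ hlog.ne', Real.exp_log hKj]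
    simp only [e]
    rw [← add_assoc, Real.rpow_add hn0 (b + _), h5, mul_comm]

/-! ### The theorem -/

theorem mainTheorem3 (ω : ℝ) (hω : IsMatMulExponent ω) :
    -- Preprocessing.
    (∃ K : ℝ, ∀ n d : ℕ, 1 ≤ d → d ≤ n →
      ∃ P : Prog (DSReg n d),
        ∀ (A : Matrix (Fin d) (Fin n) ℝ) (ε : ℝ) (f : ℝ → ℝ) (u v : Fin n → ℝ),
          A.rank = d → (∀ i, 0 < u i) →
          ImplementsInit P A ε f u v ∧
          ∀ σ : DSReg n d → ℝ, HoldsData σ A ε → HoldsInput σ u v →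
            (P.cost f σ : ℝ) ≤ K * ((n : ℝ) ^ 2 * (d : ℝ) ^ (ω - 2))) ∧
    -- Updates.
    (∀ a : ℝ, 0 ≤ a → a ≤ dualExponent →
      ∃ (K : ℝ) (η : ℕ → ℝ), Filter.Tendsto η Filter.atTop (nhds 0) ∧
      ∀ n d : ℕ, 3 ≤ n → 1 ≤ d → d ≤ n →
      ∃ P : Prog (DSReg n d),
        ∀ (A : Matrix (Fin d) (Fin n) ℝ) (ε : ℝ) (f : ℝ → ℝ),
          A.rank = d → 0 < ε → ε < 1 / 4 →
        ∀ (C : ℝ) (T : ℕ) (u v : ℕ → Fin n → ℝ) (s : ℕ → DSState n),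
          0 ≤ C → (∀ i, 0 < u 0 i) → SmallChange C T u → IsExecution a ε A f T u v s →
          -- `P` implements every call of `Update`.
          (∀ t < T, ImplementsUpdate P a A ε f (s t) (u (t + 1)) (v (t + 1))) ∧
          -- `σ t` is the memory at the start of the call number `t + 1`.
          ∀ σ : ℕ → DSReg n d → ℝ,
            (∀ t < T, HoldsData (σ t) A ε ∧ HoldsInput (σ t) (u (t + 1)) (v (t + 1)) ∧
              HoldsState (σ t) (s t)) →
            -- Total time, where calls that take the branch `k < n ^ a` are ignored.
            ∑ t ∈ rankCalls a ε T u s, (P.cost f (σ t) : ℝ)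
              ≤ K * (T * (C / ε *
                  ((n : ℝ) ^ (ω - 1 / 2) + (n : ℝ) ^ (2 - a / 2 + η n)) * Real.logb 2 n)) ∧
            -- Time spent in an ignored call before that branch is entered.
            ∀ t < T, ¬ RankBranch a ε (s t) (u (t + 1)) →
              (P.cost f (σ t) : ℝ) ≤ K * (n * Real.logb 2 n)) := by
  refine ⟨hω.exists_init, fun a ha ha' => ?_⟩
  obtain ⟨K, η, hη, hprog⟩ : ∃ (K : ℝ) (η : ℕ → ℝ), Filter.Tendsto η Filter.atTop (nhds 0) ∧
      ∀ n d : ℕ, 3 ≤ n → HasUpdateProgram n d a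
        (K * ((n : ℝ) ^ (ω - 1 / 2) + (n : ℝ) ^ (2 - a / 2 + η n))) := by
    -- At the threshold the exponents ω - 1/2 and 2 - a/2 agree; the first bound is used above it,
    -- the second otherwise.
    rcases lt_or_ge (5 / 2 - a / 2) ω with h | h
    · obtain ⟨K, hK⟩ := hω.exists_hasUpdateProgram ha ha' h
      refine ⟨max 0 K, fun _ => 0, tendsto_const_nhds, fun n d hn => (hK n d hn).mono hn ?_⟩
      have h1 : (0 : ℝ) ≤ (n : ℝ) ^ (ω - 1 / 2) := by positivity
      have h2 : (0 : ℝ) ≤ max 0 K * (n : ℝ) ^ (2 - a / 2 + 0) := by positivity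
      rw [mul_add]
      linarith [mul_le_mul_of_nonneg_right (le_max_right 0 K) h1]
    -- Here ω is raised to 5/2 - a/2 + δ, just above the threshold, for each δ > 0. The program may
    -- depend on δ, so the diagonal argument is applied to the existence of a program.
    · obtain ⟨η, hη, h1⟩ := exists_tendsto_zero_of_forall_pos (b := 2 - a / 2)
        (p := fun n B => ∀ d, HasUpdateProgram n d a B)
        (fun n hn x y hxy hp d => (hp d).mono hn hxy) fun δ hδ => by
          obtain ⟨K, hK⟩ := (hω.mono (by linarith : ω ≤ 5 / 2 - a / 2 + δ)).exists_hasUpdateProgram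
            ha ha' (by linarith)
          refine ⟨K, fun n hn d => ?_⟩
          rw [show 2 - a / 2 + δ = 5 / 2 - a / 2 + δ - 1 / 2 by ring]
          exact hK n d hn
      refine ⟨1, η, hη, fun n d hn => (h1 n hn d).mono hn ?_⟩
      rw [one_mul]
      exact le_add_of_nonneg_left (by positivity)
  -- One constant has to serve both bounds; 9 comes from the `9 * n` instructions of an ignored
  -- call.
  refine ⟨max 9 K, η, hη, fun n d hn _ _ => ?_⟩
  obtain ⟨P, hP⟩ := hprog n d hn
  refine ⟨P, fun A ε f hA hε hε' C T u v s hC h0 hu hs => ?_⟩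
  obtain ⟨h1, h2⟩ := hP A ε f hA hε hε' C T u v s hC h0 hu hs
  have hL := one_lt_logb_two hn
  refine ⟨h1, fun σ hσ => ⟨(h2 σ hσ).1.trans ?_, fun t ht hr => ((h2 σ hσ).2 t ht hr).trans ?_⟩⟩
  · have h3 : (0 : ℝ) ≤ T * (C / ε *
        ((n : ℝ) ^ (ω - 1 / 2) + (n : ℝ) ^ (2 - a / 2 + η n)) * Real.logb 2 n) := by positivity
    refine le_trans (le_of_eq ?_) (mul_le_mul_of_nonneg_right (le_max_right 9 K) h3)
    ring
  · have h3 : (n : ℝ) ≤ n * Real.logb 2 n := le_mul_of_one_le_right (Nat.cast_nonneg n) hL.le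
    calc 9 * (n : ℝ) ≤ 9 * (n * Real.logb 2 n) := by linarith
      _ ≤ _ := mul_le_mul_of_nonneg_right (le_max_left 9 K) (by positivity)
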